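/- **Setting.** Fix a horizon $T$, an inventory bound $L$ and a finite set $\mathcal A\subset[0,\bar a]$ of prices. In period $t=1,\dots,T$ the inventory is $X_t\in\{0,\dots,L\}$, a price $A_t\in\mathcal A$ is drawn from a policy (which may be randomised and depend on the history and on $X_t$), the demand is $D_t\sim\mathrm{Poisson}(\lambda_t(A_t))$ given $A_t$, independently of $X_t$ and of the past, the reward is $R_t=A_t\min(D_t,X_t)$, and $X_{t+1}=X_t-\min(X_t,D_t)$. Assume $0\le\lambda_{min}\le\lambda_t(a)\le\lambda_{max}$, and that $a\mapsto\lambda_t(a)$ is non-increasing. $\mathbb E^\pi$ is expectation under the policy $\pi$, $\mathbb P^\pi_t(a)$ is the probability that $A_t=a$ under $\pi$, $\pi^*$ is any policy maximising $\mathbb E^\pi[\sum_tR_t]$, $V_1^\pi(x)=\mathbb E^\pi[\sum_tR_t\mid X_1=x]$, $V_1^*(x)=\sup_\pi V_1^\pi(x)$, and the regret of $\pi$ is $\mu^\pi=\mathbb E[V_1^*(X_1)-V_1^\pi(X_1)]$. The data $\mathcal D_N$ are $N\ge1$ independent trajectories $(X_{i,t},A_{i,t},D_{i,t})_{t\le T}$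 of a (possibly history-dependent) behavior policy $\pi^b$. **Algorithm.** Let $N_t(a)=\#\{i:A_{i,t}=a\}$, $\mathcal A_t^{\mathcal D_N}=\{a:N_t(a)>0\}$, and for $a\in\mathcal A_t^{\mathcal D_N}$ let $\widehat\lambda_t(a)=N_t(a)^{-1}\sum_iD_{i,t}\mathbf 1(A_{i,t}=a)$ and $\delta_t(a)=c\sqrt{\log N_t(a)/N_t(a)}$. Let $\Omega_t(a)=[\widehat\lambda^L_t(a),\widehat\lambda^U_t(a)]$, where $\widehat\lambda^L_t(a)$ is the maximum of $\max(\widehat\lambda_t(a')-\delta_t(a'),\lambda_{min})$ over $a'\in\mathcal A_t^{\mathcal D_N}$ with $a'\ge a$ ($\lambda_{min}$ if there is none), and $\widehat\lambda^U_t(a)$ is the minimum of $\min(\widehat\lambda_t(a')+\delta_t(a'),\lambda_{max})$ over $a'\in\mathcal A_t^{\mathcal D_N}$ with $a'\le a$ ($\lambda_{max}$ if there is none). Put $\widehat V_{T+1}=0$ and, for $t=T,\dots,1$, $\widehat Q_t(x,a)=\min_{\lambda\in\Omega_t(a)}\mathbb E_{D\sim\mathrm{Poisson}(\lambda)}[a\min(D,x)+\widehat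 V_{t+1}(x-\min(x,D))]$ (with $\widehat V_{t+1}(0)=0$) and $\widehat V_t(x)=\max_a\widehat Q_t(x,a)$. The refined pessimistic policy $\widehat\pi^{\mathbf{pess}}$ posts a price $\widehat a_t(x)\in\operatorname{argmax}_a\widehat Q_t(x,a)$ (ties broken arbitrarily); $\mu^{\mathbf{pess}}$ is its regret. **Bound.** Let $\mathcal M_t=\{a:\mathbb P_t^{\pi^*}(a)>0\Rightarrow\mathbb P_t^{\pi^b}(a)>0\}$ and $\kappa_t=\sum_{a:\,\mathbb P_t^{\pi^b}(a)>0}(1-\mathbb P_t^{\pi^b}(a))^N$. Let $a_t^U$ be the largest observed price $\le a$ and $a_t^L$ the smallest observed price $\ge a$ in $\mathcal A_t^{\mathcal D_N}$ (both equal $a$ if $a$ is observed), and let $\eta_t(a)=\lambda_t(a_t^U)-\lambda_t(a_t^L)+2\delta_t(a_t^U)+2\delta_t(a_t^L)$ if both exist, $\lambda_{max}-\lambda_t(a_t^L)+2\delta_t(a_t^L)$ if only $a_t^L$ exists, $\lambda_t(a_t^U)+2\delta_t(a_t^U)$ if only $a_t^U$ exists. For fixed data put $B=F+S$ with $$F=\sum_{t=1}^T\mathbb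 E^{\pi^b}\Big[\tfrac{\mathbb P_t^{\pi^*}(A_t)}{\mathbb P_t^{\pi^b}(A_t)}\sqrt{\tfrac{\log N_t(A_t)}{N_t(A_t)}}\,\mathbf 1(A_t\in\mathcal M_t)\Big],\qquad S=\sum_{t=1}^T\mathbb E^{\pi^*}\big[\eta_t(A_t)\mathbf 1(A_t\notin\mathcal M_t)\big]$$ (the term of a price with $N_t=0$ in $F$ being $0$). **Theorem.** There is $c_0>0$, depending only on $\lambda_{max}$, such that for every $c\ge c_0$, $\lambda_{min}\le\lambda_{max}$, $L$ and $\bar a$ the following hold. 1. There is $C>0$, depending only on these parameters, such that for all $T$, $N\ge 1$, $\mathcal A\subset[0,\bar a]$ and all processes and $\pi^*$ as above, the probability that $\mu^{\mathbf{pess}}\le C\,B$ is at least $1-\sum_{t=1}^T\big(\mathbb E\big[\sum_{a\in\mathcal A_t^{\mathcal D_N}}N_t(a)^{-1}\big]+\kappa_t\big)$. 2. The bound is attainable. Let $\lambda_{min}<\lambda_{max}$, $L\ge1$, $\bar a>0$ and $T\ge1$. There is $c'>0$ such that: (a) there are a price set $\mathcal A\subset(0,\bar a]$ and, for each $N$,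 a process as above, with strictly decreasing $\lambda_t$ and with $c'\,\mathbb P_t^{\pi^*}(a)\le\mathbb P_t^{\pi^b}(a)$ for all $t$, $a$ and every optimal $\pi^*$ (so $S=0$), for which the probability that $F\ge c'\sqrt{\log N/N}$ and $\mu^{\mathbf{pess}}\ge c'B$ tends to $1$ as $N\to\infty$, uniformly in the optimal $\pi^*$; (b) there is $w_0>0$ such that for every scale $w\in(0,w_0]$ there are a price set $\mathcal A\subset(0,\bar a]$ and two processes as above with strictly decreasing demand parameters, which differ in these parameters but induce the same distribution of the data, such that for one of them the probability that $c'w\le S\le w$ and $\mu^{\mathbf{pess}}\ge c'B$ tends to $1$ as $N\to\infty$, uniformly in the optimal $\pi^*$. -/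

import Mathlib

open MeasureTheory ProbabilityTheory
open scoped NNReal ENNReal

noncomputable section

namespace OfflinePricing

/-- One period of a trajectory: inventory level in `{0, …, L}`, price in the finite set `𝒜`,
demand in `ℕ`. -/
abbrev Step (L : ℕ) (𝒜 : Finset ℝ) : Type := Fin (L + 1) × 𝒜 × ℕ

/-- A (randomised, history-dependent) policy. Periods are numbered `0, 1, 2, …`; in period `t` it
maps the past `t` steps and the current inventory level to a distribution over the prices. -/
abbrev Policy (L : ℕ) (𝒜 : Finset ℝ) : Type :=
  (t : ℕ) → (Fin t → Step L 𝒜) → Fin (L + 1) → PMF 𝒜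

/-- Inventory after demand `d` at level `x`: `x - min x d`, without replenishment. -/
def nextLevel {L : ℕ} (x : Fin (L + 1)) (d : ℕ) : Fin (L + 1) :=
  ⟨(x : ℕ) - min (x : ℕ) d, lt_of_le_of_lt (Nat.sub_le _ _) x.isLt⟩

/-- A data-generating process: the law of the initial inventory, the Poisson demand parameters
`lam t a`, and the behavior policy. -/
structure Model (L : ℕ) (𝒜 : Finset ℝ) where
  start : PMF (Fin (L + 1))
  lam : ℕ → 𝒜 → ℝ≥0
  behavior : Policy L 𝒜

/-- A data set of `N` trajectories over `T` periods. -/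
abbrev Data (T N L : ℕ) (𝒜 : Finset ℝ) : Type := Fin N → Fin T → Step L 𝒜

/-- The Markov policy that posts the price `act t x` in period `t` at inventory level `x`. -/
def markovPolicy {L : ℕ} {𝒜 : Finset ℝ} (act : ℕ → Fin (L + 1) → 𝒜) : Policy L 𝒜 :=
  fun t _ x => PMF.pure (act t x)

/-- `∑_{t} min(D_t, X_t) * A_t`. -/
def totalReward {T L : ℕ} {𝒜 : Finset ℝ} (w : Fin T → Step L 𝒜) : ℝ :=
  ∑ t, (min (w t).2.2 ((w t).1 : ℕ) : ℝ) * ((w t).2.1 : ℝ)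

namespace Model

variable {L : ℕ} {𝒜 : Finset ℝ}

/-- Demand parameters lie in `[lmin, lmax]` and are non-increasing in the price, in each of the
`T` periods. -/
structure Admissible (M : Model L 𝒜) (T : ℕ) (lmin lmax : ℝ≥0) : Prop where
  lower : ∀ t < T, ∀ a, lmin ≤ M.lam t a
  upper : ∀ t < T, ∀ a, M.lam t a ≤ lmax
  mono : ∀ t < T, Antitone (M.lam t)

/-- Joint law of the first `n` steps and of the inventory level after them, under the policy `π`,
when the initial inventory has law `s`. -/
def pathPMF (M : Model L 𝒜) (s : PMF (Fin (L + 1))) (π : Policy L 𝒜) :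
    (n : ℕ) → PMF ((Fin n → Step L 𝒜) × Fin (L + 1))
  | 0 => s.map fun x => (fun i => i.elim0, x)
  | n + 1 => (pathPMF M s π n).bind fun h =>
      (π n h.1 h.2).bind fun a =>
        (poissonMeasure (M.lam n a)).toPMF.map fun d =>
          (Fin.snoc (α := fun _ => Step L 𝒜) h.1 (h.2, a, d), nextLevel h.2 d)

/-- Law of the trajectory over `T` periods. -/
def trajLaw (M : Model L 𝒜) (T : ℕ) (s : PMF (Fin (L + 1))) (π : Policy L 𝒜) :
    Measure (Fin T → Step L 𝒜) :=
  ((M.pathPMF s π T).map Prod.fst).toMeasure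

/-- Law of one trajectory of the offline data. -/
def behaviorLaw (M : Model L 𝒜) (T : ℕ) : Measure (Fin T → Step L 𝒜) :=
  M.trajLaw T M.start M.behavior

/-- Law of the offline data: `N` independent trajectories under the behavior policy. -/
def dataLaw (M : Model L 𝒜) (T N : ℕ) : Measure (Data T N L 𝒜) :=
  Measure.pi fun _ => M.behaviorLaw T

/-- `V₁^π(x)`: expected total reward of `π` over `T` periods, starting from inventory `x`. -/
def value (M : Model L 𝒜) (T : ℕ) (π : Policy L 𝒜) (x : Fin (L + 1)) : ℝ :=
  ∫ w, totalReward w ∂(M.trajLaw T (PMF.pure x) π)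

/-- `V₁^*(x)`. -/
def optValue (M : Model L 𝒜) (T : ℕ) (x : Fin (L + 1)) : ℝ :=
  ⨆ π : Policy L 𝒜, M.value T π x

/-- The regret `E[V₁^*(X₁) - V₁^π(X₁)]`. -/
def regret (M : Model L 𝒜) (T : ℕ) (π : Policy L 𝒜) : ℝ :=
  ∫ x, (M.optValue T x - M.value T π x) ∂M.start.toMeasure

/-- `π` maximises the expected total reward among all policies. -/
def IsOptimal (M : Model L 𝒜) (T : ℕ) (π : Policy L 𝒜) : Prop :=
  ∀ π' : Policy L 𝒜,
    ∫ w, totalReward w ∂(M.trajLaw T M.start π') ≤ ∫ w, totalReward w ∂(M.trajLaw T M.start π)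

/-- `P_t^π(a)`: probability that the price in period `t` is `a` under `π`. -/
def priceProb (M : Model L 𝒜) (T : ℕ) (π : Policy L 𝒜) (t : Fin T) (a : 𝒜) : ℝ :=
  (M.trajLaw T M.start π).real {w | (w t).2.1 = a}

open Classical in
/-- `κ_t = ∑ (1 - P_t^b(a))^N` over the prices `a` with `P_t^b(a) > 0`. -/
def kappa (M : Model L 𝒜) (T N : ℕ) (t : Fin T) : ℝ :=
  ∑ a ∈ Finset.univ.filter (fun a : 𝒜 => 0 < M.priceProb T M.behavior t a),
    (1 - M.priceProb T M.behavior t a) ^ N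

end Model

section Estimation

variable {T N L : ℕ} {𝒜 : Finset ℝ}

/-- `N_t(a)`. -/
def count (𝒟 : Data T N L 𝒜) (t : Fin T) (a : 𝒜) : ℕ :=
  (Finset.univ.filter fun i => (𝒟 i t).2.1 = a).card

/-- The prices observed in period `t`. -/
def observed (𝒟 : Data T N L 𝒜) (t : Fin T) : Finset 𝒜 :=
  Finset.univ.filter fun a => 0 < count 𝒟 t a

/-- Average demand in period `t` over the `N_t(a)` trajectories with price `a`. -/
def lamHat (𝒟 : Data T N L 𝒜) (t : Fin T) (a : 𝒜) : ℝ :=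
  (∑ i, if (𝒟 i t).2.1 = a then ((𝒟 i t).2.2 : ℝ) else 0) / count 𝒟 t a

/-- `√(log N_t(a) / N_t(a))`. -/
def rate (𝒟 : Data T N L 𝒜) (t : Fin T) (a : 𝒜) : ℝ :=
  Real.sqrt (Real.log (count 𝒟 t a) / count 𝒟 t a)

/-- `δ_t(a)`. -/
def delta (c : ℝ) (𝒟 : Data T N L 𝒜) (t : Fin T) (a : 𝒜) : ℝ := c * rate 𝒟 t a

/-- Observed prices `≥ a`. -/
def obsAbove (𝒟 : Data T N L 𝒜) (t : Fin T) (a : 𝒜) : Finset 𝒜 :=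
  (observed 𝒟 t).filter fun a' => a ≤ a'

/-- Observed prices `≤ a`. -/
def obsBelow (𝒟 : Data T N L 𝒜) (t : Fin T) (a : 𝒜) : Finset 𝒜 :=
  (observed 𝒟 t).filter fun a' => a' ≤ a

/-- Lower end of the refined interval `Ω_t(a)`. -/
def lamLower (c : ℝ) (lmin : ℝ≥0) (𝒟 : Data T N L 𝒜) (t : Fin T) (a : 𝒜) : ℝ :=
  if h : (obsAbove 𝒟 t a).Nonempty then
    (obsAbove 𝒟 t a).sup' h fun a' => max (lamHat 𝒟 t a' - delta c 𝒟 t a') lmin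
  else lmin

/-- Upper end of the refined interval `Ω_t(a)`. -/
def lamUpper (c : ℝ) (lmax : ℝ≥0) (𝒟 : Data T N L 𝒜) (t : Fin T) (a : 𝒜) : ℝ :=
  if h : (obsBelow 𝒟 t a).Nonempty then
    (obsBelow 𝒟 t a).inf' h fun a' => min (lamHat 𝒟 t a' + delta c 𝒟 t a') lmax
  else lmax

/-- Poisson weight `e^{-l} l^d / d!`. -/
def poissonWeight (l : ℝ) (d : ℕ) : ℝ := Real.exp (-l) * l ^ d / d.factorial

/-- Bellman operator with demand parameter `l`, applied to the continuation value `V` (with the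
convention that an empty inventory has value `0`). -/
def bellman (l : ℝ) (V : Fin (L + 1) → ℝ) (x : Fin (L + 1)) (a : ℝ) : ℝ :=
  ∑ d ∈ Finset.range ((x : ℕ) + 1), poissonWeight l d * (d * a)
    + a * (x : ℕ) * ∑' d : ℕ, poissonWeight l ((x : ℕ) + 1 + d)
    + ∑ d ∈ Finset.range (x : ℕ), V (nextLevel x d) * poissonWeight l d

/-- Minimum over `l ∈ Ω_t(a)` of the Bellman operator applied to `V`. -/
def worstBellman (c : ℝ) (lmin lmax : ℝ≥0) (𝒟 : Data T N L 𝒜) (t : Fin T)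
    (V : Fin (L + 1) → ℝ) (x : Fin (L + 1)) (a : 𝒜) : ℝ :=
  sInf ((fun l : ℝ => bellman l V x (a : ℝ)) ''
    Set.Icc (lamLower c lmin 𝒟 t a) (lamUpper c lmax 𝒟 t a))

/-- Pessimistic value function, by backward recursion from `0` after the last period. -/
def pessValue (c : ℝ) (lmin lmax : ℝ≥0) (𝒟 : Data T N L 𝒜) (t : ℕ) (x : Fin (L + 1)) : ℝ :=
  if h : t < T then
    ⨆ a : 𝒜, worstBellman c lmin lmax 𝒟 ⟨t, h⟩ (fun y => pessValue c lmin lmax 𝒟 (t + 1) y) x a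
  else 0
termination_by T - t

/-- Pessimistic Q-function. -/
def pessQ (c : ℝ) (lmin lmax : ℝ≥0) (𝒟 : Data T N L 𝒜) (t : Fin T) (x : Fin (L + 1))
    (a : 𝒜) : ℝ :=
  worstBellman c lmin lmax 𝒟 t (pessValue c lmin lmax 𝒟 ((t : ℕ) + 1)) x a

/-- `act` is an output of the refined pessimistic algorithm on the data `𝒟`: a maximiser of the
pessimistic Q-function at every period and inventory level, with ties broken in any way. -/
def IsPessimistic (c : ℝ) (lmin lmax : ℝ≥0) (𝒟 : Data T N L 𝒜)
    (act : ℕ → Fin (L + 1) → 𝒜) : Prop :=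
  ∀ (t : Fin T) (x : Fin (L + 1)) (a : 𝒜),
    pessQ c lmin lmax 𝒟 t x a ≤ pessQ c lmin lmax 𝒟 t x (act t x)

/-- `η_t(a)`. The largest observed price `≤ a` is `a` itself if `a` is observed, and otherwise the
closest observed price below `a`; similarly above. If no price at all is observed (so `N = 0`) the
value is irrelevant. -/
def eta (M : Model L 𝒜) (c : ℝ) (lmax : ℝ≥0) (𝒟 : Data T N L 𝒜) (t : Fin T) (a : 𝒜) : ℝ :=
  if hU : (obsBelow 𝒟 t a).Nonempty then
    let aU := (obsBelow 𝒟 t a).max' hU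
    if hL : (obsAbove 𝒟 t a).Nonempty then
      let aL := (obsAbove 𝒟 t a).min' hL
      (M.lam t aU : ℝ) - M.lam t aL + 2 * delta c 𝒟 t aU + 2 * delta c 𝒟 t aL
    else (M.lam t aU : ℝ) + 2 * delta c 𝒟 t aU
  else if hL : (obsAbove 𝒟 t a).Nonempty then
    let aL := (obsAbove 𝒟 t a).min' hL
    (lmax : ℝ) - M.lam t aL + 2 * delta c 𝒟 t aL
  else 0

/-- `M_t`: the prices `a` such that `P_t^{π*}(a) > 0` implies `P_t^b(a) > 0`. -/
def covered (M : Model L 𝒜) (T : ℕ) (πs : Policy L 𝒜) (t : Fin T) : Set 𝒜 :=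
  {a | 0 < M.priceProb T πs t a → 0 < M.priceProb T M.behavior t a}

/-- Estimation part of the regret bound; the data are fixed, and the expectation is over a
trajectory of the behavior policy. -/
def estimationTerm (M : Model L 𝒜) (πs : Policy L 𝒜) (𝒟 : Data T N L 𝒜) : ℝ :=
  ∑ t : Fin T, ∫ w, (covered M T πs t).indicator
      (fun a => M.priceProb T πs t a / M.priceProb T M.behavior t a * rate 𝒟 t a) (w t).2.1
    ∂(M.behaviorLaw T)

/-- Partial-identification part of the regret bound; the data are fixed, and the expectation is
over a trajectory of `πs`. -/
def identificationTerm (M : Model L 𝒜) (c : ℝ) (lmax : ℝ≥0) (πs : Policy L 𝒜)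
    (𝒟 : Data T N L 𝒜) : ℝ :=
  ∑ t : Fin T, ∫ w, (covered M T πs t)ᶜ.indicator (fun a => eta M c lmax 𝒟 t a) (w t).2.1
    ∂(M.trajLaw T M.start πs)

/-- The regret bound, up to a constant factor. -/
def regretBound (M : Model L 𝒜) (c : ℝ) (lmax : ℝ≥0) (πs : Policy L 𝒜)
    (𝒟 : Data T N L 𝒜) : ℝ :=
  estimationTerm M πs 𝒟 + identificationTerm M c lmax πs 𝒟

end Estimation

end OfflinePricing

end

noncomputable section

namespace OfflinePricing

/-! ### Laws along a trajectory -/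

/-! Everything rests on a performance-difference identity, `Model.integral_totalReward_eq_bellman`:
for any functions `V t` that vanish at empty inventory and after the last period, the expected
reward of a policy is the initial mean of `V 0` plus the mean Bellman errors of `V` along that
policy. With the optimal value as `V`, the regret becomes a sum of nonnegative one-period losses;
with the pessimistic value as `V`, the upper bound follows.

Upper bound. Suppose that every observed estimate is within its radius and that every price posted
with positive probability by the behavior policy is observed. Monotone demand puts the true
parameter in `Ω_t(a)` (`Accurate.mem_Icc`). Hence the Bellman errors of the pessimistic value are
nonnegative along the pessimistic policy, which therefore earns at least that value. Along an
optimal policy the errors are at most a Lipschitz constant of the Bellman operator times the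
uncertainty in `Ω_t(a)`: `2δ` at an observed price, `η` in general. The difference is
`regret_le_of_accurate`. As for the probability, given the set of `n` trajectories with price `a`,
their demands are independent Poisson variables, and a Chernoff bound with `θ² = log n / n` gives
failure probability at most `1/n` (`Model.measureReal_bad_indices_le`); missed prices account for
`κ_t`.

Attainability. Starting from one unit, the unit survives to the last period with probability bounded
below, and there the revenue is `a (1 - exp (-l))`, so pessimism only looks at the lower end of
`Ω_t(a)`. For the estimation term, two prices have revenues differing by order `√(log N / N)`, and
the slightly better one is posted rarely: its wider interval makes pessimism reject it
(`act_eq_of_typical`). For the identification term, the best price lies between two observed ones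
and is never posted. Its lower end is that of the higher observed price, so pessimism prefers the
latter (`HiddenPrice.act_ne`), while changing the hidden parameter leaves the law of the data
unchanged. In both cases the forfeited gap is of the order of the bound. -/

theorem integral_bind_toMeasure {α β : Type*} [Fintype α] [MeasurableSpace β] (p : PMF α)
    (q : α → PMF β) (f : β → ℝ) (hf : ∀ a, Integrable f (q a).toMeasure) :
    ∫ y, f y ∂(p.bind q).toMeasure = ∑ a, (p a).toReal * ∫ y, f y ∂(q a).toMeasure := by
  have h : (p.bind q).toMeasure = ∑ a, p a • (q a).toMeasure := by
    ext s hs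
    rw [PMF.toMeasure_bind_apply _ _ _ hs, tsum_fintype]
    simp
  rw [h, integral_finsetSum_measure fun a _ => (hf a).smul_measure (p.apply_ne_top a)]
  simp

namespace Model

variable {L : ℕ} {𝒜 : Finset ℝ}

/-- Joint law of inventory level and price in period `n`. -/
def jointLaw (M : Model L 𝒜) (s : PMF (Fin (L + 1))) (π : Policy L 𝒜) (n : ℕ) :
    PMF (Fin (L + 1) × 𝒜) :=
  (M.pathPMF s π n).bind fun h => (π n h.1 h.2).map fun a => (h.2, a)

/-- Law of the inventory level in period `n`. -/
def levelLaw (M : Model L 𝒜) (s : PMF (Fin (L + 1))) (π : Policy L 𝒜) (n : ℕ) :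
    PMF (Fin (L + 1)) :=
  (M.pathPMF s π n).map Prod.snd

/-- Law of the step of period `n`. -/
def stepLaw (M : Model L 𝒜) (s : PMF (Fin (L + 1))) (π : Policy L 𝒜) (n : ℕ) :
    PMF (Step L 𝒜) :=
  (M.jointLaw s π n).bind fun z =>
    (poissonMeasure (M.lam n z.2)).toPMF.map fun d => (z.1, z.2, d)

variable (M : Model L 𝒜) (s : PMF (Fin (L + 1))) (π : Policy L 𝒜)

theorem levelLaw_zero : M.levelLaw s π 0 = s := by
  simp only [levelLaw, pathPMF, PMF.map_comp]
  exact PMF.map_id s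

theorem levelLaw_succ (n : ℕ) :
    M.levelLaw s π (n + 1) = (M.stepLaw s π n).map fun z => nextLevel z.1 z.2.2 := by
  simp only [levelLaw, pathPMF, stepLaw, jointLaw, PMF.map_bind, PMF.bind_bind, PMF.map_comp,
    PMF.bind_map, Function.comp_def]

theorem map_fst_jointLaw (n : ℕ) : (M.jointLaw s π n).map Prod.fst = M.levelLaw s π n := by
  simp only [levelLaw, jointLaw, PMF.map_bind, PMF.map_comp, Function.comp_def]
  rw [← PMF.bind_pure_comp]
  congr 1
  funext h
  exact PMF.map_const _ _

theorem jointLaw_markovPolicy (act : ℕ → Fin (L + 1) → 𝒜) (n : ℕ) :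
    M.jointLaw s (markovPolicy act) n =
      (M.levelLaw s (markovPolicy act) n).map fun x => (x, act n x) := by
  simp only [levelLaw, jointLaw, markovPolicy, PMF.map_comp, PMF.pure_map]
  rw [← PMF.bind_pure_comp]
  rfl

/-- Later periods only append to the path, so they integrate out; the newest period is the step law
by construction. -/
theorem map_eval_pathPMF (T : ℕ) (t : Fin T) :
    ((M.pathPMF s π T).map Prod.fst).map (fun w => w t) = M.stepLaw s π t := by
  induction T with
  | zero => exact t.elim0
  | succ T ih =>
    simp only [pathPMF, PMF.map_comp, PMF.map_bind, Function.comp_def]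
    refine Fin.lastCases ?_ (fun t => ?_) t
    · simp only [Fin.snoc_last, Fin.val_last, stepLaw, jointLaw, PMF.bind_bind, PMF.bind_map,
        Function.comp_def]
    · simp only [Fin.snoc_castSucc, Fin.val_castSucc, ← ih t, PMF.map_comp]
      rw [← PMF.bind_pure_comp]
      congr 1
      funext h
      have : ∀ a, PMF.map (fun _ : ℕ => h.1 t) (poissonMeasure (M.lam T a)).toPMF
          = PMF.pure (h.1 t) := fun a => PMF.map_const _ _
      simp [this]

theorem map_eval_trajLaw (T : ℕ) (t : Fin T) :
    (M.trajLaw T s π).map (fun w => w t) = (M.stepLaw s π t).toMeasure := by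
  rw [trajLaw, PMF.toMeasure_map _ _ (measurable_pi_apply t), map_eval_pathPMF]

instance (T : ℕ) : IsProbabilityMeasure (M.trajLaw T s π) := by
  unfold trajLaw; infer_instance

instance (T : ℕ) : IsProbabilityMeasure (M.behaviorLaw T) := by
  unfold behaviorLaw; infer_instance

instance (T N : ℕ) : IsProbabilityMeasure (M.dataLaw T N) := by
  unfold dataLaw; infer_instance

theorem toMeasure_map_poisson (z : Fin (L + 1) × 𝒜) (l : ℝ≥0) :
    ((poissonMeasure l).toPMF.map fun d => ((z.1, z.2, d) : Step L 𝒜)).toMeasure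
      = (poissonMeasure l).map fun d => (z.1, z.2, d) := by
  rw [← PMF.toMeasure_map _ _ (by fun_prop), Measure.toPMF_toMeasure]

/-- Isolates the demand as the only infinite coordinate of a step: expectations become finite sums
of Poisson integrals. -/
theorem integral_eval_trajLaw (T : ℕ) (t : Fin T) (g : Step L 𝒜 → ℝ)
    (hg : ∀ x a, Integrable (fun d => g (x, a, d)) (poissonMeasure (M.lam t a))) :
    ∫ w, g (w t) ∂(M.trajLaw T s π) = ∑ z, (M.jointLaw s π t z).toReal *
      ∫ d, g (z.1, z.2, d) ∂(poissonMeasure (M.lam t z.2)) := by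
  rw [← integral_map (φ := fun w : Fin T → Step L 𝒜 => w t) (f := g)
    (measurable_pi_apply t).aemeasurable .of_discrete, map_eval_trajLaw, stepLaw,
    integral_bind_toMeasure]
  · refine Finset.sum_congr rfl fun z _ => ?_
    rw [toMeasure_map_poisson, integral_map (by fun_prop) .of_discrete]
  · intro z
    rw [toMeasure_map_poisson, integrable_map_measure .of_discrete (by fun_prop)]
    exact hg z.1 z.2

theorem integrable_eval_trajLaw (T : ℕ) (t : Fin T) (g : Step L 𝒜 → ℝ)
    (hg : ∀ x a, Integrable (fun d => g (x, a, d)) (poissonMeasure (M.lam t a))) :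
    Integrable (fun w => g (w t)) (M.trajLaw T s π) := by
  have : Integrable g ((M.trajLaw T s π).map (fun w => w t)) := by
    rw [map_eval_trajLaw, stepLaw]
    have h : ((M.jointLaw s π t).bind fun z =>
        (poissonMeasure (M.lam t z.2)).toPMF.map fun d => ((z.1, z.2, d) : Step L 𝒜)).toMeasure
        = ∑ z, (M.jointLaw s π t z) •
          ((poissonMeasure (M.lam t z.2)).map fun d => ((z.1, z.2, d) : Step L 𝒜)) := by
      ext s hs
      rw [PMF.toMeasure_bind_apply _ _ _ hs, tsum_fintype]
      simp [toMeasure_map_poisson]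
    rw [h, integrable_finsetSum_measure]
    intro z _
    refine Integrable.smul_measure ?_ (PMF.apply_ne_top _ _)
    rw [integrable_map_measure .of_discrete (by fun_prop)]
    exact hg z.1 z.2
  exact (integrable_map_measure .of_discrete (measurable_pi_apply t).aemeasurable).1 this

theorem integral_price_trajLaw (T : ℕ) (t : Fin T) (g : 𝒜 → ℝ) :
    ∫ w, g (w t).2.1 ∂(M.trajLaw T s π) =
      ∑ z, (M.jointLaw s π t z).toReal * g z.2 := by
  rw [M.integral_eval_trajLaw s π T t (fun y => g y.2.1) fun x a => by simp]
  simp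

theorem sum_levelLaw (n : ℕ) (f : Fin (L + 1) → ℝ) :
    ∑ x, (M.levelLaw s π n x).toReal * f x = ∑ z, (M.jointLaw s π n z).toReal * f z.1 := by
  rw [← map_fst_jointLaw]
  have := PMF.integral_eq_sum ((M.jointLaw s π n).map Prod.fst) f
  simp only [smul_eq_mul] at this
  rw [← this, ← PMF.toMeasure_map _ _ measurable_fst, integral_map measurable_fst.aemeasurable
    .of_discrete, PMF.integral_eq_sum]
  simp

theorem sum_levelLaw_succ (n : ℕ) (f : Fin (L + 1) → ℝ) :
    ∑ x, (M.levelLaw s π (n + 1) x).toReal * f x = ∑ z, (M.jointLaw s π n z).toReal *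
      ∫ d, f (nextLevel z.1 d) ∂(poissonMeasure (M.lam n z.2)) := by
  have := PMF.integral_eq_sum (M.levelLaw s π (n + 1)) f
  simp only [smul_eq_mul] at this
  have hb : ∀ (μ : Measure ℕ) [IsProbabilityMeasure μ] (x : Fin (L + 1)),
      Integrable (fun d => f (nextLevel x d)) μ := fun μ _ x =>
    Integrable.of_bound .of_discrete (∑ y, ‖f y‖) (Filter.Eventually.of_forall fun d =>
      Finset.single_le_sum (f := fun y => ‖f y‖) (fun _ _ => norm_nonneg _) (Finset.mem_univ _))
  rw [← this, levelLaw_succ, stepLaw, PMF.map_bind, integral_bind_toMeasure]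
  · refine Finset.sum_congr rfl fun z _ => ?_
    rw [PMF.map_comp, ← PMF.toMeasure_map _ _ .of_discrete, Measure.toPMF_toMeasure,
      integral_map Measurable.of_discrete.aemeasurable .of_discrete]
    rfl
  · intro z
    rw [PMF.map_comp, ← PMF.toMeasure_map _ _ .of_discrete, Measure.toPMF_toMeasure,
      integrable_map_measure .of_discrete Measurable.of_discrete.aemeasurable]
    exact hb _ z.1

theorem sum_jointLaw_markovPolicy (act : ℕ → Fin (L + 1) → 𝒜) (n : ℕ)
    (f : Fin (L + 1) × 𝒜 → ℝ) :
    ∑ z, (M.jointLaw s (markovPolicy act) n z).toReal * f z =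
      ∑ x, (M.levelLaw s (markovPolicy act) n x).toReal * f (x, act n x) := by
  have := PMF.integral_eq_sum (M.jointLaw s (markovPolicy act) n) f
  simp only [smul_eq_mul] at this
  rw [← this, jointLaw_markovPolicy, ← PMF.toMeasure_map _ _ .of_discrete,
    integral_map Measurable.of_discrete.aemeasurable .of_discrete, PMF.integral_eq_sum]
  simp

theorem priceProb_eq (T : ℕ) (t : Fin T) (a : 𝒜) :
    M.priceProb T π t a = ∑ x, (M.jointLaw M.start π t (x, a)).toReal := by
  classical
  have h := M.integral_price_trajLaw M.start π T t (fun b => if b = a then 1 else 0)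
  rw [Fintype.sum_prod_type] at h
  simp only [mul_ite, mul_one, mul_zero, Finset.sum_ite_eq', Finset.mem_univ, if_true] at h
  rw [← h, priceProb, ← integral_indicator_one (.of_discrete)]
  congr 1
  funext w
  simp [Set.indicator_apply]

theorem integral_price_eq_priceProb (T : ℕ) (t : Fin T) (g : 𝒜 → ℝ) :
    ∫ w, g (w t).2.1 ∂(M.trajLaw T M.start π) = ∑ a, M.priceProb T π t a * g a := by
  rw [integral_price_trajLaw, Fintype.sum_prod_type_right]
  simp_rw [priceProb_eq, Finset.sum_mul]

theorem priceProb_nonneg (T : ℕ) (t : Fin T) (a : 𝒜) : 0 ≤ M.priceProb T π t a :=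
  measureReal_nonneg

theorem sum_priceProb (T : ℕ) (t : Fin T) : ∑ a, M.priceProb T π t a = 1 := by
  have := M.integral_price_eq_priceProb π T t (fun _ => 1)
  simpa using this.symm

end Model
end OfflinePricing

namespace OfflinePricing

/-! ### Poisson weights and the Bellman operator -/

theorem poissonWeight_nonneg {l : ℝ} (hl : 0 ≤ l) (d : ℕ) : 0 ≤ poissonWeight l d := by
  unfold poissonWeight; positivity

theorem hasSum_poissonWeight (l : ℝ) : HasSum (poissonWeight l) 1 := by
  have h := (NormedSpace.expSeries_div_hasSum_exp l).mul_left (Real.exp (-l))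
  rw [← Real.exp_eq_exp_ℝ, ← Real.exp_add, neg_add_cancel, Real.exp_zero] at h
  unfold poissonWeight
  simpa only [poissonWeight, mul_div_assoc] using h

theorem poissonWeight_le_one {l : ℝ} (hl : 0 ≤ l) (d : ℕ) : poissonWeight l d ≤ 1 :=
  le_hasSum (hasSum_poissonWeight l) d fun _ _ => poissonWeight_nonneg hl _

theorem poissonWeight_zero (l : ℝ) : poissonWeight l 0 = Real.exp (-l) := by
  simp [poissonWeight]

theorem hasDerivAt_poissonWeight_zero (l : ℝ) :
    HasDerivAt (fun l => poissonWeight l 0) (-poissonWeight l 0) l := by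
  simp only [poissonWeight_zero]
  simpa using (hasDerivAt_neg l).exp

theorem hasDerivAt_poissonWeight_succ (l : ℝ) (d : ℕ) :
    HasDerivAt (fun l => poissonWeight l (d + 1))
      (poissonWeight l d - poissonWeight l (d + 1)) l := by
  have h := (((hasDerivAt_neg l).exp).mul (hasDerivAt_pow (d + 1) l)).div_const
    ((d + 1).factorial : ℝ)
  refine h.congr_deriv ?_
  simp only [poissonWeight, Nat.factorial_succ]
  have := Nat.factorial_ne_zero d
  push_cast
  field_simp
  ring

/-- The derivative in `l` is a difference of consecutive weights (or minus the weight at `0`), all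
of them in `[0, 1]`; the mean value inequality on the half-line finishes. -/
theorem abs_poissonWeight_sub_le {l l' : ℝ} (hl : 0 ≤ l) (hl' : 0 ≤ l') (d : ℕ) :
    |poissonWeight l d - poissonWeight l' d| ≤ |l - l'| := by
  have key : ∃ f' : ℝ → ℝ, (∀ y, HasDerivAt (fun l => poissonWeight l d) (f' y) y) ∧
      ∀ y, 0 ≤ y → ‖f' y‖ ≤ 1 := by
    cases d with
    | zero =>
      refine ⟨_, hasDerivAt_poissonWeight_zero, fun y hy => ?_⟩
      rw [norm_neg, Real.norm_eq_abs, abs_of_nonneg (poissonWeight_nonneg hy 0)]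
      exact poissonWeight_le_one hy 0
    | succ d =>
      refine ⟨_, fun y => hasDerivAt_poissonWeight_succ y d, fun y hy => ?_⟩
      rw [Real.norm_eq_abs, abs_sub_le_iff]
      have h1 := poissonWeight_nonneg hy d
      have h2 := poissonWeight_nonneg hy (d + 1)
      have h3 := poissonWeight_le_one hy d
      have h4 := poissonWeight_le_one hy (d + 1)
      constructor <;> linarith
  obtain ⟨f', hf, hb⟩ := key
  have := (convex_Ici (0 : ℝ)).norm_image_sub_le_of_norm_hasDerivWithin_le
    (fun y _ => (hf y).hasDerivWithinAt) (fun y hy => hb y hy) hl' hl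
  simpa using this

theorem tsum_poissonWeight_tail (l : ℝ) (k : ℕ) :
    ∑' d, poissonWeight l (k + d) = 1 - ∑ d ∈ Finset.range k, poissonWeight l d := by
  have h := (hasSum_poissonWeight l).summable.sum_add_tsum_nat_add k
  rw [(hasSum_poissonWeight l).tsum_eq] at h
  simp_rw [add_comm k]
  linarith

variable {L : ℕ}

/-- Removing the Poisson tail leaves `x` terms that depend on `l`, from which the Lipschitz bound
can be read off: selling out earns `a * x`, and each smaller demand corrects this amount. -/
theorem bellman_eq (l : ℝ) (V : Fin (L + 1) → ℝ) (x : Fin (L + 1)) (a : ℝ) :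
    bellman l V x a = a * (x : ℕ) + ∑ d ∈ Finset.range (x : ℕ),
      poissonWeight l d * (V (nextLevel x d) - a * ((x : ℕ) - d)) := by
  rw [bellman, tsum_poissonWeight_tail, Finset.sum_range_succ, Finset.sum_range_succ]
  have : ∑ d ∈ Finset.range (x : ℕ), poissonWeight l d * (V (nextLevel x d) - a * ((x : ℕ) - d))
      = ∑ d ∈ Finset.range (x : ℕ), V (nextLevel x d) * poissonWeight l d
        - a * (x : ℕ) * ∑ d ∈ Finset.range (x : ℕ), poissonWeight l d
        + ∑ d ∈ Finset.range (x : ℕ), poissonWeight l d * (d * a) := by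
    rw [Finset.mul_sum, ← Finset.sum_sub_distrib, ← Finset.sum_add_distrib]
    exact Finset.sum_congr rfl fun d _ => by ring
  rw [this]
  ring

theorem bellman_zero (l : ℝ) (V : Fin (L + 1) → ℝ) (a : ℝ) : bellman l V 0 a = 0 := by
  simp [bellman_eq]

theorem bellman_one (l : ℝ) (V : Fin (L + 1) → ℝ) (x : Fin (L + 1)) (hx : (x : ℕ) = 1) (a : ℝ) :
    bellman l V x a = a * (1 - Real.exp (-l)) + V (nextLevel x 0) * Real.exp (-l) := by
  rw [bellman_eq, hx]
  simp [poissonWeight_zero]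
  ring

theorem integrable_of_forall_abs_le {α : Type*} [MeasurableSpace α] [DiscreteMeasurableSpace α]
    [Countable α] (μ : Measure α) [IsFiniteMeasure μ] {f : α → ℝ} {K : ℝ}
    (hf : ∀ d, |f d| ≤ K) : Integrable f μ :=
  Integrable.of_bound Measurable.of_discrete.aestronglyMeasurable K
    (Filter.Eventually.of_forall hf)

theorem abs_apply_le_sum {ι : Type*} [Fintype ι] (V : ι → ℝ) (x : ι) : |V x| ≤ ∑ y, |V y| :=
  Finset.single_le_sum (f := fun y => |V y|) (fun _ _ => abs_nonneg _) (Finset.mem_univ _)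

theorem integrable_reward (μ : Measure ℕ) [IsFiniteMeasure μ] (x : Fin (L + 1)) (a : ℝ) :
    Integrable (fun d : ℕ => min (d : ℝ) (x : ℕ) * a) μ := by
  refine integrable_of_forall_abs_le μ (K := (x : ℕ) * |a|) fun d => ?_
  rw [abs_mul, abs_of_nonneg (le_min (by positivity) (by positivity))]
  gcongr
  exact min_le_right _ _

theorem integrable_nextLevel (μ : Measure ℕ) [IsFiniteMeasure μ] (V : Fin (L + 1) → ℝ)
    (x : Fin (L + 1)) : Integrable (fun d : ℕ => V (nextLevel x d)) μ :=
  integrable_of_forall_abs_le μ fun _ => abs_apply_le_sum V _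

theorem nextLevel_of_le {x : Fin (L + 1)} {d : ℕ} (h : (x : ℕ) ≤ d) : nextLevel x d = 0 := by
  ext; simp [nextLevel, h]

theorem bellman_eq_integral (l : ℝ≥0) (V : Fin (L + 1) → ℝ) (hV : V 0 = 0) (x : Fin (L + 1))
    (a : ℝ) : bellman l V x a =
      ∫ d : ℕ, (min (d : ℝ) (x : ℕ) * a + V (nextLevel x d)) ∂(poissonMeasure l) := by
  have h := hasSum_integral_poissonMeasure
    ((integrable_reward (poissonMeasure l) x a).add (integrable_nextLevel (poissonMeasure l) V x))
  refine HasSum.unique ?_ h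
  rw [bellman_eq]
  -- Split the integrand into the sell-out revenue and a correction. The correction vanishes for `d
  -- ≥ x` because `V 0 = 0`.
  have h1 := (hasSum_poissonWeight (l : ℝ)).mul_left (a * (x : ℕ))
  have h2 : HasSum (fun d => poissonWeight l d *
      (min (d : ℝ) (x : ℕ) * a + V (nextLevel x d) - a * (x : ℕ)))
      (∑ d ∈ Finset.range (x : ℕ), poissonWeight l d *
      (min (d : ℝ) (x : ℕ) * a + V (nextLevel x d) - a * (x : ℕ))) := by
    refine hasSum_sum_of_ne_finset_zero fun d hd => ?_
    have hd' : (x : ℕ) ≤ d := by simpa using hd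
    rw [nextLevel_of_le hd', hV, min_eq_right (by exact_mod_cast hd')]
    ring
  convert h1.add h2 using 1
  · rfl
  · funext d
    simp [poissonWeight]
    ring
  · rw [mul_one]
    congr 1
    refine Finset.sum_congr rfl fun d hd => ?_
    have hd' : d ≤ (x : ℕ) := (Finset.mem_range.1 hd).le
    rw [min_eq_left (by exact_mod_cast hd')]
    ring

/-- Values between `0` and `K` per unit of inventory. -/
def ValueBound (K : ℝ) (V : Fin (L + 1) → ℝ) : Prop := ∀ x, 0 ≤ V x ∧ V x ≤ K * (x : ℕ)

theorem ValueBound.zero {K : ℝ} {V : Fin (L + 1) → ℝ} (h : ValueBound K V) : V 0 = 0 :=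
  le_antisymm (by simpa using (h 0).2) (h 0).1

/-- Each unit is either sold at a price at most `K` or kept, with continuation value at most `K`. -/
theorem ValueBound.bellman {K a : ℝ} (ha : 0 ≤ a) (haK : a ≤ K) {V : Fin (L + 1) → ℝ}
    (h : ValueBound K V) {l : ℝ} (hl : 0 ≤ l) : ValueBound K fun x => bellman l V x a := by
  intro x
  lift l to ℝ≥0 using hl
  have hi := (integrable_reward (poissonMeasure l) x a).add
    (integrable_nextLevel (poissonMeasure l) V x)
  dsimp only
  rw [bellman_eq_integral l V h.zero]
  constructor
  · refine integral_nonneg fun d => ?_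
    exact add_nonneg (mul_nonneg (le_min (by positivity) (by positivity)) ha) (h _).1
  · refine (integral_mono hi (integrable_const (K * (x : ℕ))) fun d => ?_).trans (by simp)
    have h1 := (h (nextLevel x d)).2
    have h2 : (((nextLevel x d : Fin (L + 1)) : ℕ) : ℝ) = (x : ℕ) - min (d : ℝ) (x : ℕ) := by
      simp only [nextLevel]
      rw [Nat.cast_sub (min_le_left _ _), Nat.cast_min, min_comm]
    rw [h2] at h1
    have h3 : 0 ≤ min (d : ℝ) (x : ℕ) := le_min (by positivity) (by positivity)
    simp only [Pi.add_apply]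
    nlinarith

/-- At most `L` weights vary with `l`. Each multiplies a difference of two numbers in `[0, K * (x -
d)]`, so `K * L ^ 2` suffices; the `+ 1` keeps the factor positive when `L = 0`. -/
theorem ValueBound.abs_bellman_sub_le {K a : ℝ} (ha : 0 ≤ a) (haK : a ≤ K)
    {V : Fin (L + 1) → ℝ} (h : ValueBound K V) {l l' : ℝ} (hl : 0 ≤ l) (hl' : 0 ≤ l')
    (x : Fin (L + 1)) :
    |OfflinePricing.bellman l V x a - OfflinePricing.bellman l' V x a| ≤ K * (L ^ 2 + 1) * |l - l'| := by
  have hK : 0 ≤ K := ha.trans haK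
  have hx : ((x : ℕ) : ℝ) ≤ L := by exact_mod_cast Nat.lt_succ_iff.1 x.isLt
  rw [bellman_eq, bellman_eq, add_sub_add_left_eq_sub, ← Finset.sum_sub_distrib]
  calc _ ≤ ∑ d ∈ Finset.range (x : ℕ), |l - l'| * (K * L) := by
        refine (Finset.abs_sum_le_sum_abs _ _).trans (Finset.sum_le_sum fun d hd => ?_)
        have hd' : d ≤ (x : ℕ) := (Finset.mem_range.1 hd).le
        rw [← sub_mul, abs_mul]
        refine mul_le_mul (abs_poissonWeight_sub_le hl hl' d) ?_ (abs_nonneg _) (abs_nonneg _)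
        have h1 := h (nextLevel x d)
        have h2 : (((nextLevel x d : Fin (L + 1)) : ℕ) : ℝ) = (x : ℕ) - d := by
          simp only [nextLevel]
          rw [min_eq_right hd', Nat.cast_sub hd']
        rw [h2] at h1
        have h3 : (d : ℝ) ≤ (x : ℕ) := by exact_mod_cast hd'
        have h4 : a * ((x : ℕ) - d) ≤ K * ((x : ℕ) - d) :=
          mul_le_mul_of_nonneg_right haK (by linarith)
        have h5 : K * ((x : ℕ) - d) ≤ K * L :=
          mul_le_mul_of_nonneg_left (by linarith [Nat.cast_nonneg (α := ℝ) d]) hK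
        have h6 : 0 ≤ a * ((x : ℕ) - d : ℝ) := mul_nonneg ha (by linarith)
        rw [abs_le]
        constructor <;> linarith [h1.1, h1.2]
    _ = (x : ℕ) * (|l - l'| * (K * L)) := by simp
    _ ≤ L * (|l - l'| * (K * L)) := by gcongr
    _ ≤ _ := by nlinarith [mul_nonneg hK (abs_nonneg (l - l'))]

end OfflinePricing

namespace OfflinePricing

/-! ### Dynamic programming -/

namespace Model

variable {L : ℕ} {𝒜 : Finset ℝ}

theorem integral_totalReward_eq (M : Model L 𝒜) (s : PMF (Fin (L + 1))) (π : Policy L 𝒜) (T : ℕ) :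
    ∫ w, totalReward w ∂(M.trajLaw T s π) = ∑ t ∈ Finset.range T, ∑ z,
      (M.jointLaw s π t z).toReal *
        ∫ d : ℕ, min (d : ℝ) ((z.1 : ℕ) : ℝ) * (z.2 : ℝ) ∂(poissonMeasure (M.lam t z.2)) := by
  simp only [totalReward]
  rw [integral_finsetSum _ fun t _ => M.integrable_eval_trajLaw s π T t
    (fun y => min (y.2.2 : ℝ) ((y.1 : ℕ) : ℝ) * (y.2.1 : ℝ)) fun x a => integrable_reward _ x a]
  rw [Finset.sum_range]
  exact Finset.sum_congr rfl fun t _ => M.integral_eval_trajLaw s π T t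
    (fun y => min (y.2.2 : ℝ) ((y.1 : ℕ) : ℝ) * (y.2.1 : ℝ)) fun x a => integrable_reward _ x a

/-- Performance difference: the expected total reward in terms of the Bellman errors of arbitrary
functions `V t`. -/
theorem integral_totalReward_eq_bellman (M : Model L 𝒜) (s : PMF (Fin (L + 1))) (π : Policy L 𝒜)
    (T : ℕ) (V : ℕ → Fin (L + 1) → ℝ) (hV : ∀ t, V t 0 = 0) (hT : V T = 0) :
    ∫ w, totalReward w ∂(M.trajLaw T s π) = ∑ x, (s x).toReal * V 0 x +
      ∑ t ∈ Finset.range T, ∑ z, (M.jointLaw s π t z).toReal *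
        (bellman (M.lam t z.2) (V (t + 1)) z.1 z.2 - V t z.1) := by
  -- The Bellman error is the reward plus the increment of the mean of `V`; these increments
  -- telescope over the periods.
  have h : ∀ t, ∑ z, (M.jointLaw s π t z).toReal *
        (bellman (M.lam t z.2) (V (t + 1)) z.1 z.2 - V t z.1) =
      ∑ z, (M.jointLaw s π t z).toReal *
        ∫ d : ℕ, min (d : ℝ) ((z.1 : ℕ) : ℝ) * (z.2 : ℝ) ∂(poissonMeasure (M.lam t z.2)) +
      (∑ x, (M.levelLaw s π (t + 1) x).toReal * V (t + 1) x -
        ∑ x, (M.levelLaw s π t x).toReal * V t x) := by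
    intro t
    rw [sum_levelLaw_succ, sum_levelLaw, ← Finset.sum_sub_distrib, ← Finset.sum_add_distrib]
    refine Finset.sum_congr rfl fun z _ => ?_
    rw [bellman_eq_integral _ _ (hV _), integral_add (integrable_reward _ _ _)
      (integrable_nextLevel _ _ _)]
    ring
  simp_rw [h]
  rw [Finset.sum_add_distrib, ← integral_totalReward_eq,
    Finset.sum_range_sub (fun t => ∑ x, (M.levelLaw s π t x).toReal * V t x), hT, levelLaw_zero]
  simp

/-- Optimal value from period `t` on. -/
def optVal (M : Model L 𝒜) (T t : ℕ) (x : Fin (L + 1)) : ℝ :=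
  if t < T then ⨆ a : 𝒜, bellman (M.lam t a) (fun y => optVal M T (t + 1) y) x a else 0
termination_by T - t

/-- Value of a Markov policy from period `t` on. -/
def markovVal (M : Model L 𝒜) (act : ℕ → Fin (L + 1) → 𝒜) (T t : ℕ) (x : Fin (L + 1)) : ℝ :=
  if t < T then bellman (M.lam t (act t x)) (fun y => markovVal M act T (t + 1) y) x (act t x)
  else 0
termination_by T - t

theorem optVal_of_lt (M : Model L 𝒜) {T t : ℕ} (h : t < T) (x : Fin (L + 1)) :
    M.optVal T t x = ⨆ a : 𝒜, bellman (M.lam t a) (M.optVal T (t + 1)) x a := by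
  rw [optVal, if_pos h]

theorem optVal_self (M : Model L 𝒜) (T : ℕ) : M.optVal T T = 0 := by
  funext x
  rw [optVal, if_neg (lt_irrefl _)]
  rfl

theorem optVal_zero (M : Model L 𝒜) (T t : ℕ) : M.optVal T t 0 = 0 := by
  rw [optVal]
  split_ifs with h
  · simp [bellman_zero]
  · rfl

theorem markovVal_of_lt (M : Model L 𝒜) (act : ℕ → Fin (L + 1) → 𝒜) {T t : ℕ} (h : t < T)
    (x : Fin (L + 1)) : M.markovVal act T t x =
      bellman (M.lam t (act t x)) (M.markovVal act T (t + 1)) x (act t x) := by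
  rw [markovVal, if_pos h]

theorem markovVal_self (M : Model L 𝒜) (act : ℕ → Fin (L + 1) → 𝒜) (T : ℕ) :
    M.markovVal act T T = 0 := by
  funext x
  rw [markovVal, if_neg (lt_irrefl _)]
  rfl

theorem markovVal_zero (M : Model L 𝒜) (act : ℕ → Fin (L + 1) → 𝒜) (T t : ℕ) :
    M.markovVal act T t 0 = 0 := by
  rw [markovVal]
  split_ifs with h
  · simp [bellman_zero]
  · rfl

/-- The value functions of a Markov policy have zero Bellman error along that policy. -/
theorem integral_totalReward_markovPolicy (M : Model L 𝒜) (s : PMF (Fin (L + 1)))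
    (act : ℕ → Fin (L + 1) → 𝒜) (T : ℕ) :
    ∫ w, totalReward w ∂(M.trajLaw T s (markovPolicy act)) =
      ∑ x, (s x).toReal * M.markovVal act T 0 x := by
  rw [integral_totalReward_eq_bellman M s _ T (M.markovVal act T) (M.markovVal_zero act T)
    (M.markovVal_self act T), add_eq_left]
  refine Finset.sum_eq_zero fun t ht => ?_
  rw [sum_jointLaw_markovPolicy M s act t
    (fun z => bellman (M.lam t z.2) (M.markovVal act T (t + 1)) z.1 z.2 - M.markovVal act T t z.1)]
  refine Finset.sum_eq_zero fun x _ => ?_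
  rw [M.markovVal_of_lt act (Finset.mem_range.1 ht)]
  simp

theorem sum_pure_mul {α : Type*} [Fintype α] (x : α) (f : α → ℝ) :
    ∑ y, ((PMF.pure x : PMF α) y).toReal * f y = f x := by
  classical
  rw [Finset.sum_eq_single x]
  · simp
  · intro y _ hy; simp [PMF.pure_apply_of_ne _ _ hy]
  · simp

theorem value_markovPolicy (M : Model L 𝒜) (act : ℕ → Fin (L + 1) → 𝒜) (T : ℕ)
    (x : Fin (L + 1)) : M.value T (markovPolicy act) x = M.markovVal act T 0 x := by
  rw [value, integral_totalReward_markovPolicy, sum_pure_mul]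

theorem bellman_le_optVal (M : Model L 𝒜) {T t : ℕ} (h : t < T) (x : Fin (L + 1)) (a : 𝒜) :
    bellman (M.lam t a) (M.optVal T (t + 1)) x a ≤ M.optVal T t x := by
  rw [optVal_of_lt M h]
  exact le_ciSup (f := fun a : 𝒜 => bellman (M.lam t a) (M.optVal T (t + 1)) x a)
    (Set.finite_range _).bddAbove a

theorem integral_totalReward_le_optVal (M : Model L 𝒜) (s : PMF (Fin (L + 1))) (π : Policy L 𝒜)
    (T : ℕ) : ∫ w, totalReward w ∂(M.trajLaw T s π) ≤ ∑ x, (s x).toReal * M.optVal T 0 x := by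
  rw [integral_totalReward_eq_bellman M s π T (M.optVal T) (M.optVal_zero T) (M.optVal_self T)]
  rw [add_le_iff_nonpos_right]
  refine Finset.sum_nonpos fun t ht => Finset.sum_nonpos fun z _ => ?_
  exact mul_nonpos_of_nonneg_of_nonpos ENNReal.toReal_nonneg
    (sub_nonpos.2 (M.bellman_le_optVal (Finset.mem_range.1 ht) z.1 z.2))

/-- The greedy policy has zero Bellman error. It does not depend on the initial law, so it serves
both for the pointwise supremum `optValue` and for optimality under `M.start`. -/
theorem exists_integral_totalReward_eq_optVal [Nonempty 𝒜] (M : Model L 𝒜) (T : ℕ) :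
    ∃ act : ℕ → Fin (L + 1) → 𝒜, ∀ s : PMF (Fin (L + 1)),
      ∫ w, totalReward w ∂(M.trajLaw T s (markovPolicy act)) =
        ∑ x, (s x).toReal * M.optVal T 0 x := by
  choose act hact using fun (t : ℕ) (x : Fin (L + 1)) => exists_eq_ciSup_of_finite
    (f := fun a : 𝒜 => bellman (M.lam t a) (M.optVal T (t + 1)) x a)
  refine ⟨act, fun s => ?_⟩
  rw [integral_totalReward_eq_bellman M s _ T (M.optVal T) (M.optVal_zero T) (M.optVal_self T),
    add_eq_left]
  refine Finset.sum_eq_zero fun t ht => ?_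
  rw [sum_jointLaw_markovPolicy M s act t
    (fun z => bellman (M.lam t z.2) (M.optVal T (t + 1)) z.1 z.2 - M.optVal T t z.1)]
  refine Finset.sum_eq_zero fun x _ => ?_
  rw [M.optVal_of_lt (Finset.mem_range.1 ht), ← hact t x]
  simp

theorem optValue_eq [Nonempty 𝒜] (M : Model L 𝒜) (T : ℕ) (x : Fin (L + 1)) :
    M.optValue T x = M.optVal T 0 x := by
  obtain ⟨act, hact⟩ := M.exists_integral_totalReward_eq_optVal T
  have hle : ∀ π, M.value T π x ≤ M.optVal T 0 x := fun π => by
    have := M.integral_totalReward_le_optVal (PMF.pure x) π T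
    rwa [sum_pure_mul] at this
  have : Nonempty (Policy L 𝒜) := ⟨markovPolicy act⟩
  refine le_antisymm (ciSup_le hle) ?_
  have h := hact (PMF.pure x)
  rw [sum_pure_mul] at h
  rw [← h]
  exact le_ciSup (f := fun π => M.value T π x) ⟨_, Set.forall_mem_range.2 hle⟩ (markovPolicy act)

theorem regret_markovPolicy [Nonempty 𝒜] (M : Model L 𝒜) (T : ℕ) (act : ℕ → Fin (L + 1) → 𝒜) :
    M.regret T (markovPolicy act) = ∑ x, (M.start x).toReal * M.optVal T 0 x -
      ∫ w, totalReward w ∂(M.trajLaw T M.start (markovPolicy act)) := by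
  rw [regret, PMF.integral_eq_sum, integral_totalReward_markovPolicy, ← Finset.sum_sub_distrib]
  refine Finset.sum_congr rfl fun x _ => ?_
  rw [optValue_eq, value_markovPolicy, smul_eq_mul, mul_sub]

theorem IsOptimal.integral_totalReward [Nonempty 𝒜] {M : Model L 𝒜} {T : ℕ} {π : Policy L 𝒜}
    (h : M.IsOptimal T π) : ∫ w, totalReward w ∂(M.trajLaw T M.start π) =
      ∑ x, (M.start x).toReal * M.optVal T 0 x := by
  obtain ⟨act, hact⟩ := M.exists_integral_totalReward_eq_optVal T
  exact le_antisymm (M.integral_totalReward_le_optVal _ _ _) (hact M.start ▸ h _)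

/-- The regret dominates the loss at a single period and inventory level. -/
theorem le_regret_markovPolicy [Nonempty 𝒜] (M : Model L 𝒜) {T t : ℕ} (ht : t < T)
    (act : ℕ → Fin (L + 1) → 𝒜) (x : Fin (L + 1)) :
    (M.levelLaw M.start (markovPolicy act) t x).toReal *
      (M.optVal T t x - bellman (M.lam t (act t x)) (M.optVal T (t + 1)) x (act t x)) ≤
    M.regret T (markovPolicy act) := by
  -- All summands are nonnegative by `bellman_le_optVal`, so a single one bounds the sum from below.
  have key : M.regret T (markovPolicy act) = ∑ t ∈ Finset.range T, ∑ x,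
      (M.levelLaw M.start (markovPolicy act) t x).toReal *
      (M.optVal T t x - bellman (M.lam t (act t x)) (M.optVal T (t + 1)) x (act t x)) := by
    rw [regret_markovPolicy, integral_totalReward_eq_bellman M _ _ T (M.optVal T)
      (M.optVal_zero T) (M.optVal_self T), sub_add_cancel_left, ← Finset.sum_neg_distrib]
    refine Finset.sum_congr rfl fun t _ => ?_
    rw [sum_jointLaw_markovPolicy M _ act t
      (fun z => bellman (M.lam t z.2) (M.optVal T (t + 1)) z.1 z.2 - M.optVal T t z.1),
      ← Finset.sum_neg_distrib]
    exact Finset.sum_congr rfl fun x _ => by ring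
  have hnn : ∀ t ∈ Finset.range T, ∀ x, 0 ≤
      (M.levelLaw M.start (markovPolicy act) t x).toReal *
      (M.optVal T t x - bellman (M.lam t (act t x)) (M.optVal T (t + 1)) x (act t x)) :=
    fun t ht x => mul_nonneg ENNReal.toReal_nonneg
      (sub_nonneg.2 (M.bellman_le_optVal (Finset.mem_range.1 ht) x _))
  rw [key]
  refine le_trans ?_ (Finset.single_le_sum (f := fun t => ∑ x,
      (M.levelLaw M.start (markovPolicy act) t x).toReal *
      (M.optVal T t x - bellman (M.lam t (act t x)) (M.optVal T (t + 1)) x (act t x)))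
      (fun t ht => Finset.sum_nonneg fun x _ => hnn t ht x) (Finset.mem_range.2 ht))
  exact Finset.single_le_sum (f := fun x =>
      (M.levelLaw M.start (markovPolicy act) t x).toReal *
      (M.optVal T t x - bellman (M.lam t (act t x)) (M.optVal T (t + 1)) x (act t x)))
      (fun x _ => hnn t (Finset.mem_range.2 ht) x) (Finset.mem_univ x)

/-- An optimal policy only posts prices that attain the optimal value. -/
theorem IsOptimal.jointLaw_eq_zero [Nonempty 𝒜] {M : Model L 𝒜} {T : ℕ} {π : Policy L 𝒜}
    (h : M.IsOptimal T π) {t : ℕ} (ht : t < T) (x : Fin (L + 1)) (a : 𝒜)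
    (ha : bellman (M.lam t a) (M.optVal T (t + 1)) x a < M.optVal T t x) :
    M.jointLaw M.start π t (x, a) = 0 := by
  have h1 := h.integral_totalReward
  rw [integral_totalReward_eq_bellman M _ _ T (M.optVal T) (M.optVal_zero T) (M.optVal_self T),
    add_eq_left] at h1
  -- By `h1` the nonpositive errors sum to zero, so every one of them vanishes.
  have hnn : ∀ t ∈ Finset.range T, ∀ z, (M.jointLaw M.start π t z).toReal *
      (bellman (M.lam t z.2) (M.optVal T (t + 1)) z.1 z.2 - M.optVal T t z.1) ≤ 0 :=
    fun t ht z => mul_nonpos_of_nonneg_of_nonpos ENNReal.toReal_nonneg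
      (sub_nonpos.2 (M.bellman_le_optVal (Finset.mem_range.1 ht) _ _))
  have ht' := Finset.mem_range.2 ht
  have h2 := (Finset.sum_eq_zero_iff_of_nonpos
    (fun t ht => Finset.sum_nonpos fun z _ => hnn t ht z)).1 h1 t ht'
  have h3 := (Finset.sum_eq_zero_iff_of_nonpos (fun z _ => hnn t ht' z)).1 h2 (x, a)
    (Finset.mem_univ _)
  rcases mul_eq_zero.1 h3 with h4 | h4
  · exact (ENNReal.toReal_eq_zero_iff _).1 h4 |>.resolve_right (PMF.apply_ne_top _ _)
  · exact absurd h4 (sub_neg.2 ha).ne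

end Model
end OfflinePricing

namespace OfflinePricing

/-! ### Concentration of the demand estimates -/

/-- The centred exponential moment of a Poisson variable, from the exponential series at `l * exp
θ`. -/
theorem hasSum_poisson_exp (l : ℝ≥0) (θ : ℝ) :
    HasSum (fun d : ℕ => (Real.exp (-l) * (l : ℝ) ^ d / d.factorial) *
      Real.exp (θ * ((d : ℝ) - l))) (Real.exp (l * (Real.exp θ - 1 - θ))) := by
  have h := (NormedSpace.expSeries_div_hasSum_exp ((l : ℝ) * Real.exp θ)).mul_left
    (Real.exp (-l) * Real.exp (-(θ * l)))
  rw [← Real.exp_eq_exp_ℝ, ← Real.exp_add, ← Real.exp_add] at h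
  have e : -(l : ℝ) + -(θ * l) + l * Real.exp θ = l * (Real.exp θ - 1 - θ) := by ring
  rw [e] at h
  convert h using 1
  · rfl
  funext d
  rw [mul_pow, ← Real.exp_nat_mul, show θ * ((d : ℝ) - l) = -(θ * l) + d * θ by ring, Real.exp_add,
    Real.exp_add]
  ring

theorem integrable_poisson_exp (l : ℝ≥0) (θ : ℝ) :
    Integrable (fun d : ℕ => Real.exp (θ * ((d : ℝ) - l))) (poissonMeasure l) := by
  rw [integrable_poissonMeasure_iff]
  simpa only [Real.norm_eq_abs, Real.abs_exp] using (hasSum_poisson_exp l θ).summable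

theorem integral_poisson_exp (l : ℝ≥0) (θ : ℝ) :
    ∫ d : ℕ, Real.exp (θ * ((d : ℝ) - l)) ∂(poissonMeasure l) =
      Real.exp (l * (Real.exp θ - 1 - θ)) := by
  rw [integral_poissonMeasure]
  simpa only [smul_eq_mul] using (hasSum_poisson_exp l θ).tsum_eq

variable {T N L : ℕ} {𝒜 : Finset ℝ}

/-- The data space is countable, so every event and every statistic of the data is measurable. -/
instance : DiscreteMeasurableSpace (Data T N L 𝒜) := by
  have h1 : MeasurableSingletonClass (Fin T → Step L 𝒜) := inferInstance
  have h2 : MeasurableSingletonClass (Fin N → Fin T → Step L 𝒜) :=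
    Pi.instMeasurableSingletonClass
  have h3 : Countable (Fin T → Step L 𝒜) := inferInstance
  have h4 : Countable (Fin N → Fin T → Step L 𝒜) := inferInstance
  exact MeasurableSingletonClass.toDiscreteMeasurableSpace

/-- The trajectories with price `a` in period `t`. -/
def indices (𝒟 : Data T N L 𝒜) (t : Fin T) (a : 𝒜) : Finset (Fin N) :=
  Finset.univ.filter fun i => (𝒟 i t).2.1 = a

theorem count_eq_card_indices (𝒟 : Data T N L 𝒜) (t : Fin T) (a : 𝒜) :
    count 𝒟 t a = (indices 𝒟 t a).card := rfl

namespace Model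

/-- Factor of one trajectory in the exponential moment on the event that `I` is the set of
trajectories with price `a`. -/
def tilt (M : Model L 𝒜) (t : Fin T) (a : 𝒜) (θ : ℝ) (inI : Prop) [Decidable inI]
    (y : Step L 𝒜) : ℝ :=
  if inI then (if y.2.1 = a then Real.exp (θ * ((y.2.2 : ℝ) - M.lam t a)) else 0)
  else (if y.2.1 = a then 0 else 1)

theorem integrable_tilt_poisson (M : Model L 𝒜) (t : Fin T) (a : 𝒜) (θ : ℝ) (inI : Prop)
    [Decidable inI] (x : Fin (L + 1)) (b : 𝒜) :
    Integrable (fun d => M.tilt t a θ inI (x, b, d)) (poissonMeasure (M.lam t b)) := by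
  unfold tilt
  split_ifs with h1
  · by_cases h2 : b = a
    · subst h2
      simpa using integrable_poisson_exp (M.lam t b) θ
    · simp [h2]
  · by_cases h2 : b = a <;> simp [h2]

/-- Given price `a`, the demand has the same Poisson law at every inventory level, so tilting
multiplies by one common moment factor. At `θ = 0` only the probability of posting or not posting
`a` remains. -/
theorem integral_tilt (M : Model L 𝒜) (t : Fin T) (a : 𝒜) (θ : ℝ) (inI : Prop)
    [Decidable inI] :
    ∫ w, M.tilt t a θ inI (w t) ∂(M.behaviorLaw T) =
      (if inI then Real.exp (M.lam t a * (Real.exp θ - 1 - θ)) else 1) *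
      ∫ w, M.tilt t a 0 inI (w t) ∂(M.behaviorLaw T) := by
  unfold behaviorLaw
  rw [integral_eval_trajLaw _ _ _ _ _ _ (M.integrable_tilt_poisson t a θ inI),
    integral_eval_trajLaw _ _ _ _ _ _ (M.integrable_tilt_poisson t a 0 inI), Finset.mul_sum]
  refine Finset.sum_congr rfl fun z _ => ?_
  unfold tilt
  split_ifs with h1
  · by_cases h2 : z.2 = a
    · simp only [h2, if_true, integral_poisson_exp]
      simp
      ring
    · simp [h2]
  · ring

theorem integrable_prod_tilt (M : Model L 𝒜) (t : Fin T) (a : 𝒜) (θ : ℝ) (I : Finset (Fin N)) :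
    Integrable (fun 𝒟 : Data T N L 𝒜 => ∏ i, M.tilt t a θ (i ∈ I) (𝒟 i t)) (M.dataLaw T N) := by
  unfold dataLaw
  exact Integrable.fintype_prod (f := fun i (w : Fin T → Step L 𝒜) => M.tilt t a θ (i ∈ I) (w t))
    fun i => M.integrable_eval_trajLaw _ _ T t _ (M.integrable_tilt_poisson t a θ (i ∈ I))

theorem prod_tilt_eq (M : Model L 𝒜) (t : Fin T) (a : 𝒜) (θ : ℝ) (I : Finset (Fin N))
    (𝒟 : Data T N L 𝒜) : ∏ i, M.tilt t a θ (i ∈ I) (𝒟 i t) =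
      if indices 𝒟 t a = I then
        Real.exp (θ * ∑ i ∈ I, (((𝒟 i t).2.2 : ℝ) - M.lam t a)) else 0 := by
  split_ifs with h
  · subst h
    rw [Finset.mul_sum, Real.exp_sum, ← Finset.prod_subset (Finset.subset_univ _)]
    · refine Finset.prod_congr rfl fun i hi => ?_
      have : (𝒟 i t).2.1 = a := by simpa [indices] using hi
      simp [tilt, hi, this]
    · intro i _ hi
      have : ¬ (𝒟 i t).2.1 = a := by simpa [indices] using hi
      simp [tilt, hi, this]
  · rw [Finset.prod_eq_zero_iff]
    by_contra hne
    push Not at hne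
    refine h (Finset.ext fun i => ?_)
    have hi := hne i (Finset.mem_univ _)
    simp only [indices, Finset.mem_filter, Finset.mem_univ, true_and]
    unfold tilt at hi
    split_ifs at hi <;> simp_all

/-- Trajectories are independent, so the moment factors. This is the conditional moment generating
function given the index set, multiplied through by the probability of that set. -/
theorem integral_prod_tilt (M : Model L 𝒜) (t : Fin T) (a : 𝒜) (θ : ℝ) (I : Finset (Fin N)) :
    ∫ 𝒟 : Data T N L 𝒜, ∏ i, M.tilt t a θ (i ∈ I) (𝒟 i t) ∂(M.dataLaw T N) =
      Real.exp (I.card * (M.lam t a * (Real.exp θ - 1 - θ))) *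
        (M.dataLaw T N).real {𝒟 | indices 𝒟 t a = I} := by
  have h0 : (M.dataLaw T N).real {𝒟 | indices 𝒟 t a = I} =
      ∫ 𝒟 : Data T N L 𝒜, ∏ i, M.tilt t a 0 (i ∈ I) (𝒟 i t) ∂(M.dataLaw T N) := by
    rw [← integral_indicator_one .of_discrete]
    congr 1
    funext 𝒟
    rw [prod_tilt_eq]
    simp [Set.indicator_apply]
  have hprod : ∀ θ, ∫ 𝒟 : Data T N L 𝒜, ∏ i, M.tilt t a θ (i ∈ I) (𝒟 i t) ∂(M.dataLaw T N) =
      ∏ i, ∫ w, M.tilt t a θ (i ∈ I) (w t) ∂(M.behaviorLaw T) := fun θ =>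
    integral_fintype_prod_eq_prod
      (fun i (w : Fin T → Step L 𝒜) => M.tilt t a θ (i ∈ I) (w t))
  rw [h0, hprod, hprod]
  simp_rw [M.integral_tilt t a θ]
  rw [Finset.prod_mul_distrib, Finset.prod_ite_mem, Finset.univ_inter, Finset.prod_const,
    ← Real.exp_nat_mul]

theorem measureReal_chernoff (M : Model L 𝒜) (t : Fin T) (a : 𝒜) (θ r : ℝ)
    (I : Finset (Fin N)) :
    (M.dataLaw T N).real {𝒟 | indices 𝒟 t a = I ∧
        r ≤ θ * ∑ i ∈ I, (((𝒟 i t).2.2 : ℝ) - M.lam t a)} ≤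
      Real.exp (I.card * (M.lam t a * (Real.exp θ - 1 - θ)) - r) *
        (M.dataLaw T N).real {𝒟 | indices 𝒟 t a = I} := by
  rw [Real.exp_sub, div_mul_eq_mul_div, ← integral_prod_tilt, ← integral_indicator_one .of_discrete,
    ← integral_div]
  refine integral_mono (integrable_of_forall_abs_le _ (K := 1) fun 𝒟 => ?_)
    ((M.integrable_prod_tilt t a θ I).div_const _) fun 𝒟 => ?_
  · rw [Set.indicator_apply]
    split_ifs <;> simp
  · dsimp only
    rw [prod_tilt_eq, Set.indicator_apply]
    by_cases h : indices 𝒟 t a = I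
    · rw [if_pos h]
      split_ifs with h2
      · rw [Pi.one_apply, one_le_div (Real.exp_pos _)]
        exact Real.exp_le_exp.2 h2.2
      · positivity
    · rw [if_neg h, if_neg fun h' => h h'.1]
      simp

/-- Since `|θ| ≤ 1`, `exp θ - 1 - θ ≤ θ ^ 2`, and the exponent is at most `(l - c) * log n ≤ -2 *
log n`. This leaves `n⁻² ≤ n⁻¹ / 2`, the half making room for two tails; hence the requirement `l +
2 ≤ c`. -/
theorem exp_chernoff_exponent_le {n : ℕ} (hn : 2 ≤ n) {l c : ℝ} (hl : 0 ≤ l) (hc : l + 2 ≤ c) {θ : ℝ}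
    (hθ : θ ^ 2 = Real.log n / n) :
    Real.exp (n * (l * (Real.exp θ - 1 - θ)) - n * (c * (Real.log n / n))) ≤ (n : ℝ)⁻¹ / 2 := by
  have hn0 : (0 : ℝ) < n := by positivity
  have hlog : 0 ≤ Real.log n := Real.log_natCast_nonneg n
  have hle : Real.log n ≤ n := (Real.log_le_sub_one_of_pos hn0).trans (by linarith)
  have habs : |θ| ≤ 1 := by
    rw [← sq_le_one_iff_abs_le_one, hθ]
    exact (div_le_one hn0).2 hle
  have h1 := (abs_le.1 (Real.abs_exp_sub_one_sub_id_le habs)).2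
  rw [hθ] at h1
  have h2 : n * (l * (Real.exp θ - 1 - θ)) - n * (c * (Real.log n / n)) ≤
      -(Real.log n + Real.log n) := by
    have h3 : n * (l * (Real.exp θ - 1 - θ)) ≤ n * (l * (Real.log n / n)) := by gcongr
    have h4 : n * (l * (Real.log n / n)) = l * Real.log n := by field_simp
    have h5 : n * (c * (Real.log n / n)) = c * Real.log n := by field_simp
    rw [h5]
    rw [h4] at h3
    nlinarith
  refine (Real.exp_le_exp.2 h2).trans ?_
  rw [Real.exp_neg, Real.exp_add, Real.exp_log hn0, mul_inv, div_eq_mul_inv]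
  have : (2 : ℝ) ≤ n := by exact_mod_cast hn
  gcongr

theorem lamHat_sub_eq (𝒟 : Data T N L 𝒜) (t : Fin T) (a : 𝒜) (h : 0 < count 𝒟 t a) (l : ℝ) :
    count 𝒟 t a * (lamHat 𝒟 t a - l) =
      ∑ i ∈ indices 𝒟 t a, (((𝒟 i t).2.2 : ℝ) - l) := by
  have h' : (count 𝒟 t a : ℝ) ≠ 0 := by positivity
  rw [Finset.sum_sub_distrib, Finset.sum_const, ← count_eq_card_indices, indices,
    Finset.sum_filter, lamHat]
  field_simp
  simp

/-- Conditionally on the set of trajectories with price `a`, the estimate misses by more than its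
confidence radius with probability at most the inverse of the count. -/
theorem measureReal_bad_indices_le (M : Model L 𝒜) (t : Fin T) (a : 𝒜) {lmax : ℝ≥0}
    (hl : M.lam t a ≤ lmax) {c : ℝ} (hc : (lmax : ℝ) + 2 ≤ c) (I : Finset (Fin N))
    (hI : I.Nonempty) :
    (M.dataLaw T N).real {𝒟 | indices 𝒟 t a = I ∧ delta c 𝒟 t a < |lamHat 𝒟 t a - M.lam t a|} ≤
      (I.card : ℝ)⁻¹ * (M.dataLaw T N).real {𝒟 | indices 𝒟 t a = I} := by
  -- A single observation has radius `0` because `log 1 = 0`, but then the claimed factor is `1` and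
  -- nothing is to prove.
  rcases (Nat.succ_le_of_lt hI.card_pos).eq_or_lt with h1 | h1
  · rw [← h1]
    simp only [Nat.succ_eq_add_one, zero_add, Nat.cast_one, inv_one, one_mul]
    exact measureReal_mono fun 𝒟 h => h.1
  have hn : 2 ≤ I.card := h1
  set n := I.card with hndef
  have hn0 : (0 : ℝ) < n := by positivity
  have hq : 0 ≤ Real.log n / n := div_nonneg (Real.log_natCast_nonneg n) hn0.le
  set θ := Real.sqrt (Real.log n / n) with hθ
  have hθ2 : θ ^ 2 = Real.log n / n := Real.sq_sqrt hq
  have hl' : (M.lam t a : ℝ) + 2 ≤ c := le_trans (by gcongr) hc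
  -- The deviation threshold `n * (c * θ)` multiplied by the tilt `θ`; the lower tail uses `-θ`.
  set r := n * (c * (Real.log n / n)) with hr
  have hsub : {𝒟 : Data T N L 𝒜 | indices 𝒟 t a = I ∧
      delta c 𝒟 t a < |lamHat 𝒟 t a - M.lam t a|} ⊆
      {𝒟 | indices 𝒟 t a = I ∧ r ≤ θ * ∑ i ∈ I, (((𝒟 i t).2.2 : ℝ) - M.lam t a)} ∪
      {𝒟 | indices 𝒟 t a = I ∧ r ≤ (-θ) * ∑ i ∈ I, (((𝒟 i t).2.2 : ℝ) - M.lam t a)} := by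
    rintro 𝒟 ⟨h, hd⟩
    have hcount : count 𝒟 t a = n := by rw [count_eq_card_indices, h]
    have hs := lamHat_sub_eq 𝒟 t a (by rw [hcount]; omega) (M.lam t a)
    rw [h, hcount] at hs
    have hd' : c * θ < |lamHat 𝒟 t a - M.lam t a| := by
      simpa only [delta, rate, hcount] using hd
    have hrr : r = θ * (n * (c * θ)) := by
      rw [hr, ← hθ2]; ring
    have hθ0 : 0 ≤ θ := Real.sqrt_nonneg _
    rcases lt_abs.1 hd' with h2 | h2
    · refine Or.inl ⟨h, ?_⟩
      rw [hrr, ← hs]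
      gcongr
    · refine Or.inr ⟨h, ?_⟩
      rw [hrr, ← hs, neg_mul, ← mul_neg, ← mul_neg]
      gcongr
  calc _ ≤ _ := measureReal_mono hsub
    _ ≤ _ := measureReal_union_le _ _
    _ ≤ ((n : ℝ)⁻¹ / 2) * (M.dataLaw T N).real {𝒟 | indices 𝒟 t a = I} +
        ((n : ℝ)⁻¹ / 2) * (M.dataLaw T N).real {𝒟 | indices 𝒟 t a = I} := by
      refine add_le_add ((M.measureReal_chernoff t a θ r I).trans ?_)
        ((M.measureReal_chernoff t a (-θ) r I).trans ?_)
      · exact mul_le_mul_of_nonneg_right (exp_chernoff_exponent_le hn (NNReal.coe_nonneg _) hl' hθ2)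
          measureReal_nonneg
      · exact mul_le_mul_of_nonneg_right
          (exp_chernoff_exponent_le hn (NNReal.coe_nonneg _) hl' (by rw [neg_sq, hθ2])) measureReal_nonneg
    _ = _ := by ring

theorem measureReal_bad_le_sum (M : Model L 𝒜) (t : Fin T) (a : 𝒜) {lmax : ℝ≥0}
    (hl : M.lam t a ≤ lmax) {c : ℝ} (hc : (lmax : ℝ) + 2 ≤ c) {m : ℕ} (hm : 0 < m) :
    (M.dataLaw T N).real {𝒟 | m ≤ count 𝒟 t a ∧ delta c 𝒟 t a < |lamHat 𝒟 t a - M.lam t a|} ≤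
      ∑ I : Finset (Fin N) with m ≤ I.card,
        (I.card : ℝ)⁻¹ * (M.dataLaw T N).real {𝒟 | indices 𝒟 t a = I} := by
  have hsub : {𝒟 : Data T N L 𝒜 | m ≤ count 𝒟 t a ∧
      delta c 𝒟 t a < |lamHat 𝒟 t a - M.lam t a|} ⊆
      ⋃ I ∈ Finset.univ.filter (fun I : Finset (Fin N) => m ≤ I.card),
        {𝒟 | indices 𝒟 t a = I ∧ delta c 𝒟 t a < |lamHat 𝒟 t a - M.lam t a|} := by
    rintro 𝒟 ⟨h, hd⟩
    simp only [Set.mem_iUnion]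
    exact ⟨indices 𝒟 t a, by simpa [← count_eq_card_indices] using h, rfl, hd⟩
  refine (measureReal_mono hsub (measure_ne_top _ _)).trans ((measureReal_biUnion_finset_le _ _).trans
    (Finset.sum_le_sum fun I hI => M.measureReal_bad_indices_le t a hl hc I ?_))
  have : m ≤ I.card := by simpa using hI
  exact Finset.card_pos.1 (hm.trans_le this)

theorem sum_measureReal_indices (M : Model L 𝒜) (t : Fin T) (a : 𝒜) (f : Finset (Fin N) → ℝ) :
    ∑ I, f I * (M.dataLaw T N).real {𝒟 | indices 𝒟 t a = I} =
      ∫ 𝒟, f (indices 𝒟 t a) ∂(M.dataLaw T N) := by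
  have : ∀ 𝒟 : Data T N L 𝒜, f (indices 𝒟 t a) =
      ∑ I, f I * {𝒟 : Data T N L 𝒜 | indices 𝒟 t a = I}.indicator 1 𝒟 := fun 𝒟 => by
    simp [Set.indicator_apply]
  simp_rw [this]
  rw [integral_finsetSum]
  · simp_rw [integral_const_mul, integral_indicator_one (MeasurableSet.of_discrete)]
  · intro I _
    refine (integrable_of_forall_abs_le _ (K := 1) fun 𝒟 => ?_).const_mul _
    rw [Set.indicator_apply]
    split_ifs <;> simp

/-- Version with a deterministic floor on the count, used for attainability, where counts are of
order `N`. -/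
theorem measureReal_bad_le_inv (M : Model L 𝒜) (t : Fin T) (a : 𝒜) {lmax : ℝ≥0}
    (hl : M.lam t a ≤ lmax) {c : ℝ} (hc : (lmax : ℝ) + 2 ≤ c) {m : ℕ} (hm : 0 < m) :
    (M.dataLaw T N).real {𝒟 | m ≤ count 𝒟 t a ∧ delta c 𝒟 t a < |lamHat 𝒟 t a - M.lam t a|} ≤
      (m : ℝ)⁻¹ := by
  refine (M.measureReal_bad_le_sum t a hl hc hm).trans ?_
  have h := M.sum_measureReal_indices (N := N) t a (fun _ => (m : ℝ)⁻¹)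
  simp only [integral_const, probReal_univ, smul_eq_mul, one_mul] at h
  rw [← h]
  calc _ ≤ ∑ I : Finset (Fin N) with m ≤ I.card,
        (m : ℝ)⁻¹ * (M.dataLaw T N).real {𝒟 | indices 𝒟 t a = I} := by
        refine Finset.sum_le_sum fun I hI => mul_le_mul_of_nonneg_right ?_ measureReal_nonneg
        have : m ≤ I.card := by simpa using hI
        gcongr
    _ ≤ _ := Finset.sum_le_sum_of_subset_of_nonneg (Finset.filter_subset _ _)
        fun _ _ _ => mul_nonneg (by positivity) measureReal_nonneg

theorem measureReal_bad_le_integral (M : Model L 𝒜) (t : Fin T) (a : 𝒜) {lmax : ℝ≥0}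
    (hl : M.lam t a ≤ lmax) {c : ℝ} (hc : (lmax : ℝ) + 2 ≤ c) :
    (M.dataLaw T N).real {𝒟 | 0 < count 𝒟 t a ∧ delta c 𝒟 t a < |lamHat 𝒟 t a - M.lam t a|} ≤
      ∫ 𝒟, (count 𝒟 t a : ℝ)⁻¹ ∂(M.dataLaw T N) := by
  refine (M.measureReal_bad_le_sum t a hl hc one_pos).trans ?_
  have h := M.sum_measureReal_indices (N := N) t a (fun I => (I.card : ℝ)⁻¹)
  simp only [count_eq_card_indices]
  rw [← h]
  exact Finset.sum_le_sum_of_subset_of_nonneg (Finset.filter_subset _ _)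
    fun _ _ _ => mul_nonneg (by positivity) measureReal_nonneg

/-- Probability that a price is never posted in period `t`. -/
theorem measureReal_count_eq_zero (M : Model L 𝒜) (t : Fin T) (a : 𝒜) :
    (M.dataLaw T N).real {𝒟 | count 𝒟 t a = 0} = (1 - M.priceProb T M.behavior t a) ^ N := by
  have : {𝒟 : Data T N L 𝒜 | count 𝒟 t a = 0} =
      Set.univ.pi fun _ => {w : Fin T → Step L 𝒜 | (w t).2.1 = a}ᶜ := by
    ext 𝒟
    simp [count, Finset.filter_eq_empty_iff]
  rw [this, measureReal_def, dataLaw, Measure.pi_pi, ENNReal.toReal_prod]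
  simp only [← measureReal_def]
  rw [Finset.prod_const, Finset.card_univ, Fintype.card_fin, probReal_compl_eq_one_sub .of_discrete]
  rfl

end Model
end OfflinePricing

namespace OfflinePricing

/-! ### The regret bound -/

variable {T N L : ℕ} {𝒜 : Finset ℝ}

theorem mem_observed {𝒟 : Data T N L 𝒜} {t : Fin T} {a : 𝒜} :
    a ∈ observed 𝒟 t ↔ 0 < count 𝒟 t a := by simp [observed]

theorem mem_obsAbove {𝒟 : Data T N L 𝒜} {t : Fin T} {a b : 𝒜} :
    b ∈ obsAbove 𝒟 t a ↔ 0 < count 𝒟 t b ∧ a ≤ b := by simp [obsAbove, mem_observed]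

theorem mem_obsBelow {𝒟 : Data T N L 𝒜} {t : Fin T} {a b : 𝒜} :
    b ∈ obsBelow 𝒟 t a ↔ 0 < count 𝒟 t b ∧ b ≤ a := by simp [obsBelow, mem_observed]

theorem exists_count_pos (hN : 1 ≤ N) (𝒟 : Data T N L 𝒜) (t : Fin T) :
    ∃ a, 0 < count 𝒟 t a :=
  ⟨(𝒟 ⟨0, hN⟩ t).2.1, Finset.card_pos.2 ⟨⟨0, hN⟩, by simp⟩⟩

theorem rate_nonneg (𝒟 : Data T N L 𝒜) (t : Fin T) (a : 𝒜) : 0 ≤ rate 𝒟 t a :=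
  Real.sqrt_nonneg _

theorem lmin_le_lamLower (c : ℝ) (lmin : ℝ≥0) (𝒟 : Data T N L 𝒜) (t : Fin T) (a : 𝒜) :
    (lmin : ℝ) ≤ lamLower c lmin 𝒟 t a := by
  unfold lamLower
  split_ifs with h
  · obtain ⟨b, hb⟩ := h
    exact (le_max_right _ _).trans (Finset.le_sup' (fun a' =>
      max (lamHat 𝒟 t a' - delta c 𝒟 t a') (lmin : ℝ)) hb)
  · exact le_rfl

theorem lamUpper_le_lmax (c : ℝ) (lmax : ℝ≥0) (𝒟 : Data T N L 𝒜) (t : Fin T) (a : 𝒜) :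
    lamUpper c lmax 𝒟 t a ≤ lmax := by
  unfold lamUpper
  split_ifs with h
  · obtain ⟨b, hb⟩ := h
    exact (Finset.inf'_le (fun a' =>
      min (lamHat 𝒟 t a' + delta c 𝒟 t a') (lmax : ℝ)) hb).trans (min_le_right _ _)
  · exact le_rfl

theorem le_lamLower (c : ℝ) (lmin : ℝ≥0) {𝒟 : Data T N L 𝒜} {t : Fin T} {a b : 𝒜}
    (hb : b ∈ obsAbove 𝒟 t a) :
    lamHat 𝒟 t b - delta c 𝒟 t b ≤ lamLower c lmin 𝒟 t a := by
  unfold lamLower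
  rw [dif_pos ⟨b, hb⟩]
  exact (le_max_left _ _).trans (Finset.le_sup' (fun a' =>
      max (lamHat 𝒟 t a' - delta c 𝒟 t a') (lmin : ℝ)) hb)

theorem lamUpper_le (c : ℝ) (lmax : ℝ≥0) {𝒟 : Data T N L 𝒜} {t : Fin T} {a b : 𝒜}
    (hb : b ∈ obsBelow 𝒟 t a) :
    lamUpper c lmax 𝒟 t a ≤ lamHat 𝒟 t b + delta c 𝒟 t b := by
  unfold lamUpper
  rw [dif_pos ⟨b, hb⟩]
  exact (Finset.inf'_le (fun a' =>
      min (lamHat 𝒟 t a' + delta c 𝒟 t a') (lmax : ℝ)) hb).trans (min_le_left _ _)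

/-- All estimates of observed demand parameters are within their confidence radii. -/
def Accurate (M : Model L 𝒜) (c : ℝ) (𝒟 : Data T N L 𝒜) : Prop :=
  ∀ t a, 0 < count 𝒟 t a → |lamHat 𝒟 t a - M.lam t a| ≤ delta c 𝒟 t a

/-- Demand at a higher price is no larger, so a lower confidence bound there is also one at `a`;
symmetrically for upper bounds at lower prices. -/
theorem Accurate.mem_Icc {M : Model L 𝒜} {c : ℝ} {𝒟 : Data T N L 𝒜} (h : Accurate M c 𝒟)
    {lmin lmax : ℝ≥0} (hM : M.Admissible T lmin lmax) (t : Fin T) (a : 𝒜) :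
    (M.lam t a : ℝ) ∈ Set.Icc (lamLower c lmin 𝒟 t a) (lamUpper c lmax 𝒟 t a) := by
  constructor
  · unfold lamLower
    split_ifs with hne
    · refine Finset.sup'_le _ _ fun b hb => max_le ?_ (hM.lower t t.isLt a)
      rw [mem_obsAbove] at hb
      have h1 := (abs_le.1 (h t b hb.1)).2
      have h2 : (M.lam t b : ℝ) ≤ M.lam t a := hM.mono t t.isLt hb.2
      linarith
    · exact hM.lower t t.isLt a
  · unfold lamUpper
    split_ifs with hne
    · refine Finset.le_inf' _ _ fun b hb => le_min ?_ (hM.upper t t.isLt a)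
      rw [mem_obsBelow] at hb
      have h1 := (abs_le.1 (h t b hb.1)).1
      have h2 : (M.lam t a : ℝ) ≤ M.lam t b := hM.mono t t.isLt hb.2
      linarith
    · exact hM.upper t t.isLt a

theorem Accurate.abs_sub_le_delta {M : Model L 𝒜} {c : ℝ} {𝒟 : Data T N L 𝒜}
    (h : Accurate M c 𝒟) {lmin lmax : ℝ≥0} {t : Fin T} {a : 𝒜} (ha : 0 < count 𝒟 t a) {l : ℝ}
    (hl : l ∈ Set.Icc (lamLower c lmin 𝒟 t a) (lamUpper c lmax 𝒟 t a)) :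
    |l - M.lam t a| ≤ 2 * delta c 𝒟 t a := by
  have h1 := le_lamLower c lmin (mem_obsAbove.2 ⟨ha, le_refl a⟩)
  have h2 := lamUpper_le c lmax (mem_obsBelow.2 ⟨ha, le_refl a⟩)
  have h3 := abs_le.1 (h t a ha)
  rw [abs_le]
  constructor <;> linarith [hl.1, hl.2, h3.1, h3.2]

/-- The interval is no wider than the one cut out by the nearest observed neighbours alone, and by
accuracy each neighbour's bound is within `2δ` of its true parameter. -/
theorem Accurate.abs_sub_le_eta {M : Model L 𝒜} {c : ℝ} {𝒟 : Data T N L 𝒜}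
    (h : Accurate M c 𝒟) {lmin lmax : ℝ≥0} (hM : M.Admissible T lmin lmax) (hN : 1 ≤ N)
    (t : Fin T) (a : 𝒜) {l : ℝ}
    (hl : l ∈ Set.Icc (lamLower c lmin 𝒟 t a) (lamUpper c lmax 𝒟 t a)) :
    |l - M.lam t a| ≤ eta M c lmax 𝒟 t a := by
  have hm := h.mem_Icc hM t a
  have hwidth : |l - M.lam t a| ≤ lamUpper c lmax 𝒟 t a - lamLower c lmin 𝒟 t a := by
    rw [abs_le]
    constructor <;> linarith [hl.1, hl.2, hm.1, hm.2]
  refine hwidth.trans ?_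
  have hU : ∀ b ∈ obsBelow 𝒟 t a,
      lamUpper c lmax 𝒟 t a ≤ M.lam t b + 2 * delta c 𝒟 t b := fun b hb => by
    have h1 := lamUpper_le c lmax hb
    have h2 := (abs_le.1 (h t b (mem_obsBelow.1 hb).1)).2
    linarith
  have hL : ∀ b ∈ obsAbove 𝒟 t a,
      M.lam t b - 2 * delta c 𝒟 t b ≤ lamLower c lmin 𝒟 t a := fun b hb => by
    have h1 := le_lamLower c lmin hb
    have h2 := (abs_le.1 (h t b (mem_obsAbove.1 hb).1)).1
    linarith
  -- With no observed price above, `0` serves as the lower end, which is why `eta` subtracts nothing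
  -- in that case.
  have h0 : (0 : ℝ) ≤ lamLower c lmin 𝒟 t a :=
    (NNReal.coe_nonneg _).trans (lmin_le_lamLower c lmin 𝒟 t a)
  unfold eta
  split_ifs with h1 h2 h2
  · have := hU _ (Finset.max'_mem _ h1)
    have := hL _ (Finset.min'_mem _ h2)
    dsimp only
    linarith
  · have := hU _ (Finset.max'_mem _ h1)
    dsimp only
    linarith
  · have := hL _ (Finset.min'_mem _ h2)
    have := lamUpper_le_lmax c lmax 𝒟 t a
    dsimp only
    linarith
  · obtain ⟨b, hb⟩ := exists_count_pos hN 𝒟 t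
    rcases le_total a b with hab | hab
    · exact absurd ⟨b, mem_obsAbove.2 ⟨hb, hab⟩⟩ h2
    · exact absurd ⟨b, mem_obsBelow.2 ⟨hb, hab⟩⟩ h1

theorem worstBellman_bddBelow {K : ℝ} {V : Fin (L + 1) → ℝ} (hV : ValueBound K V) (c : ℝ)
    (lmin lmax : ℝ≥0) (𝒟 : Data T N L 𝒜) (t : Fin T) (x : Fin (L + 1)) {a : 𝒜} (ha : 0 ≤ (a : ℝ))
    (haK : (a : ℝ) ≤ K) : BddBelow ((fun l : ℝ => bellman l V x (a : ℝ)) ''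
      Set.Icc (lamLower c lmin 𝒟 t a) (lamUpper c lmax 𝒟 t a)) := by
  refine ⟨0, ?_⟩
  rintro _ ⟨l, hl, rfl⟩
  exact (hV.bellman ha haK ((NNReal.coe_nonneg _).trans
    ((lmin_le_lamLower c lmin 𝒟 t a).trans hl.1)) x).1

theorem ValueBound.worstBellman {K : ℝ} {V : Fin (L + 1) → ℝ} (hV : ValueBound K V) (c : ℝ)
    (lmin lmax : ℝ≥0) (𝒟 : Data T N L 𝒜) (t : Fin T) {a : 𝒜} (ha : 0 ≤ (a : ℝ))
    (haK : (a : ℝ) ≤ K) : ValueBound K fun x => worstBellman c lmin lmax 𝒟 t V x a := by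
  intro x
  have hl0 : ∀ l ∈ Set.Icc (lamLower c lmin 𝒟 t a) (lamUpper c lmax 𝒟 t a), 0 ≤ l :=
    fun l hl => (NNReal.coe_nonneg _).trans ((lmin_le_lamLower c lmin 𝒟 t a).trans hl.1)
  unfold OfflinePricing.worstBellman
  constructor
  · refine Real.sInf_nonneg ?_
    rintro _ ⟨l, hl, rfl⟩
    exact (hV.bellman ha haK (hl0 l hl) x).1
  -- Inaccurate data may make the interval empty; then `sInf ∅ = 0` still satisfies the bound.
  · rcases (Set.Icc (lamLower c lmin 𝒟 t a) (lamUpper c lmax 𝒟 t a)).eq_empty_or_nonempty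
      with he | ⟨l, hl⟩
    · dsimp only
      rw [he, Set.image_empty, Real.sInf_empty]
      exact mul_nonneg (ha.trans haK) (Nat.cast_nonneg _)
    · exact (csInf_le (worstBellman_bddBelow hV c lmin lmax 𝒟 t x ha haK) ⟨l, hl, rfl⟩).trans
        (hV.bellman ha haK (hl0 l hl) x).2

theorem pessValue_of_lt (c : ℝ) (lmin lmax : ℝ≥0) (𝒟 : Data T N L 𝒜) (t : Fin T)
    (x : Fin (L + 1)) : pessValue c lmin lmax 𝒟 t x = ⨆ a, pessQ c lmin lmax 𝒟 t x a := by
  rw [pessValue, dif_pos t.isLt]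
  rfl

theorem pessValue_self (c : ℝ) (lmin lmax : ℝ≥0) (𝒟 : Data T N L 𝒜) :
    pessValue c lmin lmax 𝒟 T = 0 := by
  funext x
  rw [pessValue, dif_neg (lt_irrefl _)]
  rfl

theorem valueBound_pessValue [Nonempty 𝒜] {K : ℝ} (h𝒜 : ∀ a ∈ 𝒜, 0 ≤ a ∧ a ≤ K) (c : ℝ)
    (lmin lmax : ℝ≥0) (𝒟 : Data T N L 𝒜) (t : ℕ) :
    ValueBound K (pessValue c lmin lmax 𝒟 t) := by
  induction hk : T - t generalizing t with
  | zero =>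
    intro x
    rw [pessValue, dif_neg (by omega)]
    obtain ⟨a⟩ := ‹Nonempty 𝒜›
    exact ⟨le_rfl, mul_nonneg ((h𝒜 a a.2).1.trans (h𝒜 a a.2).2) (Nat.cast_nonneg _)⟩
  | succ k ih =>
    intro x
    have ht : t < T := by omega
    have hV := ih (t + 1) (by omega)
    have hb : ∀ a, 0 ≤ pessQ c lmin lmax 𝒟 ⟨t, ht⟩ x a ∧
        pessQ c lmin lmax 𝒟 ⟨t, ht⟩ x a ≤ K * (x : ℕ) := fun a =>
      hV.worstBellman c lmin lmax 𝒟 ⟨t, ht⟩ (h𝒜 a a.2).1 (h𝒜 a a.2).2 x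
    have he := pessValue_of_lt c lmin lmax 𝒟 ⟨t, ht⟩ x
    dsimp only at he
    rw [he]
    exact ⟨Real.iSup_nonneg fun a => (hb a).1, ciSup_le fun a => (hb a).2⟩

/-- The importance weight turns the behavior mean into a mean under `πs`. Where the behavior
probability is `0`, coverage forces the probability under `πs` to be `0` too, so division by zero is
harmless. -/
theorem estimationTerm_eq (M : Model L 𝒜) (πs : Policy L 𝒜) (𝒟 : Data T N L 𝒜) :
    estimationTerm M πs 𝒟 = ∑ t : Fin T, ∑ a, (covered M T πs t).indicator
      (fun a => M.priceProb T πs t a * rate 𝒟 t a) a := by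
  classical
  unfold estimationTerm
  refine Finset.sum_congr rfl fun t _ => ?_
  rw [Model.behaviorLaw, M.integral_price_eq_priceProb M.behavior T t
    ((covered M T πs t).indicator
      (fun a => M.priceProb T πs t a / M.priceProb T M.behavior t a * rate 𝒟 t a))]
  refine Finset.sum_congr rfl fun a _ => ?_
  rw [Set.indicator_apply, Set.indicator_apply]
  split_ifs with h
  · rcases (M.priceProb_nonneg M.behavior T t a).eq_or_lt with h0 | h0
    · have : M.priceProb T πs t a = 0 := by
        by_contra hne
        exact absurd (h ((M.priceProb_nonneg πs T t a).lt_of_ne' hne)) (by rw [← h0]; simp)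
      simp [this]
    · field_simp
  · simp

theorem identificationTerm_eq (M : Model L 𝒜) (c : ℝ) (lmax : ℝ≥0) (πs : Policy L 𝒜)
    (𝒟 : Data T N L 𝒜) : identificationTerm M c lmax πs 𝒟 = ∑ t : Fin T, ∑ a,
      (covered M T πs t)ᶜ.indicator (fun a => M.priceProb T πs t a * eta M c lmax 𝒟 t a) a := by
  classical
  unfold identificationTerm
  refine Finset.sum_congr rfl fun t _ => ?_
  rw [M.integral_price_eq_priceProb πs T t
    ((covered M T πs t)ᶜ.indicator (fun a => eta M c lmax 𝒟 t a))]
  refine Finset.sum_congr rfl fun a _ => ?_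
  rw [Set.indicator_apply, Set.indicator_apply]
  split_ifs <;> simp

/-- The mean of the pessimistic value separates the two rewards: the pessimistic policy earns at
least this much, and an optimal policy exceeds it by at most the weighted interval widths. -/
theorem regret_le_of_accurate {K : ℝ} (h𝒜 : ∀ a ∈ 𝒜, 0 ≤ a ∧ a ≤ K) {M : Model L 𝒜} {c : ℝ}
    (hc : 0 ≤ c) {𝒟 : Data T N L 𝒜} (h : Accurate M c 𝒟) {lmin lmax : ℝ≥0}
    (hM : M.Admissible T lmin lmax) (hN : 1 ≤ N)
    (hobs : ∀ t a, 0 < M.priceProb T M.behavior t a → 0 < count 𝒟 t a) {πs : Policy L 𝒜}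
    (hπ : M.IsOptimal T πs) {act : ℕ → Fin (L + 1) → 𝒜}
    (hact : IsPessimistic c lmin lmax 𝒟 act) :
    M.regret T (markovPolicy act) ≤ K * (L ^ 2 + 1) * (2 * c + 1) * regretBound M c lmax πs 𝒟 := by
  classical
  have : Nonempty 𝒜 := ⟨act 0 0⟩
  have hK : 0 ≤ K := (h𝒜 _ (act 0 0).2).1.trans (h𝒜 _ (act 0 0).2).2
  set V := pessValue c lmin lmax 𝒟 with hVdef
  have hV : ∀ t, ValueBound K (V t) := valueBound_pessValue h𝒜 c lmin lmax 𝒟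
  -- The true parameter competes in the infimum defining the worst case, so the true Bellman update
  -- is at least the pessimistic one.
  have hpess : ∀ (t : Fin T) (x : Fin (L + 1)),
      V t x ≤ bellman (M.lam t (act t x)) (V (t + 1)) x (act t x) := fun t x => by
    rw [hVdef, pessValue_of_lt]
    refine (ciSup_le fun a => hact t x a).trans ?_
    exact csInf_le (worstBellman_bddBelow (hV _) c lmin lmax 𝒟 t x (h𝒜 _ (act t x).2).1
      (h𝒜 _ (act t x).2).2) ⟨_, h.mem_Icc hM t (act t x), rfl⟩
  let W : Fin T → 𝒜 → ℝ := fun t a =>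
    if a ∈ covered M T πs t then 2 * c * rate 𝒟 t a else eta M c lmax 𝒟 t a
  -- Positive probability under `πs` is needed: a covered price that `πs` never posts may be
  -- unobserved.
  have hW : ∀ (t : Fin T) (x : Fin (L + 1)) (a : 𝒜), 0 < M.priceProb T πs t a →
      bellman (M.lam t a) (V (t + 1)) x a - V t x ≤ K * (L ^ 2 + 1) * W t a := fun t x a hpos => by
    have hl0 : ∀ l ∈ Set.Icc (lamLower c lmin 𝒟 t a) (lamUpper c lmax 𝒟 t a), 0 ≤ l :=
      fun l hl => (NNReal.coe_nonneg _).trans ((lmin_le_lamLower c lmin 𝒟 t a).trans hl.1)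
    have h1 : ∀ l ∈ Set.Icc (lamLower c lmin 𝒟 t a) (lamUpper c lmax 𝒟 t a),
        |l - M.lam t a| ≤ W t a := fun l hl => by
      by_cases hcov : a ∈ covered M T πs t
      · simp only [W, if_pos hcov]
        have := h.abs_sub_le_delta (hobs t a (hcov hpos)) hl
        rw [delta] at this
        linarith
      · simp only [W, if_neg hcov]
        exact h.abs_sub_le_eta hM hN t a hl
    have h2 : bellman (M.lam t a) (V (t + 1)) x a - K * (L ^ 2 + 1) * W t a ≤
        pessQ c lmin lmax 𝒟 t x a := by
      refine le_csInf ⟨_, _, h.mem_Icc hM t a, rfl⟩ ?_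
      rintro _ ⟨l, hl, rfl⟩
      have h3 := (hV (t + 1)).abs_bellman_sub_le (h𝒜 a a.2).1 (h𝒜 a a.2).2 (hl0 l hl)
        (NNReal.coe_nonneg (M.lam t a)) x
      have h4 : K * (L ^ 2 + 1) * |l - M.lam t a| ≤ K * (L ^ 2 + 1) * W t a :=
        mul_le_mul_of_nonneg_left (h1 l hl) (by positivity)
      have h5 := (abs_le.1 (h3.trans h4)).1
      change _ ≤ bellman l (V (t + 1)) x a
      linarith
    have h3 : pessQ c lmin lmax 𝒟 t x a ≤ V t x := by
      rw [hVdef, pessValue_of_lt]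
      exact le_ciSup (f := pessQ c lmin lmax 𝒟 t x) (Set.finite_range _).bddAbove a
    linarith
  have hlow : ∑ x, (M.start x).toReal * V 0 x ≤
      ∫ w, totalReward w ∂(M.trajLaw T M.start (markovPolicy act)) := by
    rw [M.integral_totalReward_eq_bellman M.start _ T V (fun t => (hV t).zero)
      (pessValue_self c lmin lmax 𝒟), le_add_iff_nonneg_right]
    refine Finset.sum_nonneg fun t ht => ?_
    rw [M.sum_jointLaw_markovPolicy M.start act t
      (fun z => bellman (M.lam t z.2) (V (t + 1)) z.1 z.2 - V t z.1)]
    exact Finset.sum_nonneg fun x _ => mul_nonneg ENNReal.toReal_nonneg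
      (sub_nonneg.2 (hpess ⟨t, Finset.mem_range.1 ht⟩ x))
  have hup : ∫ w, totalReward w ∂(M.trajLaw T M.start πs) ≤
      ∑ x, (M.start x).toReal * V 0 x +
        K * (L ^ 2 + 1) * ∑ t : Fin T, ∑ a, M.priceProb T πs t a * W t a := by
    rw [M.integral_totalReward_eq_bellman M.start _ T V (fun t => (hV t).zero)
      (pessValue_self c lmin lmax 𝒟)]
    rw [add_le_add_iff_left, Finset.sum_range, Finset.mul_sum]
    refine Finset.sum_le_sum fun t _ => ?_
    rw [Fintype.sum_prod_type_right, Finset.mul_sum]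
    refine Finset.sum_le_sum fun a _ => ?_
    rw [M.priceProb_eq, Finset.sum_mul, Finset.mul_sum]
    refine Finset.sum_le_sum fun x _ => ?_
    rcases (ENNReal.toReal_nonneg (a := M.jointLaw M.start πs t (x, a))).eq_or_lt with h0 | h0
    · rw [← h0]; simp
    · rw [mul_left_comm]
      refine mul_le_mul_of_nonneg_left (hW t x a ?_) h0.le
      rw [M.priceProb_eq]
      exact h0.trans_le (Finset.single_le_sum
        (f := fun x => (M.jointLaw M.start πs t (x, a)).toReal)
        (fun _ _ => ENNReal.toReal_nonneg) (Finset.mem_univ x))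
  have hsplit : ∑ t : Fin T, ∑ a, M.priceProb T πs t a * W t a =
      2 * c * estimationTerm M πs 𝒟 + identificationTerm M c lmax πs 𝒟 := by
    rw [estimationTerm_eq, identificationTerm_eq, Finset.mul_sum, ← Finset.sum_add_distrib]
    refine Finset.sum_congr rfl fun t _ => ?_
    rw [Finset.mul_sum, ← Finset.sum_add_distrib]
    refine Finset.sum_congr rfl fun a _ => ?_
    by_cases hcov : a ∈ covered M T πs t
    · simp only [W, if_pos hcov, Set.indicator_of_mem hcov]
      rw [Set.indicator_of_notMem (by simpa using hcov)]
      ring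
    · simp only [W, if_neg hcov, Set.indicator_of_notMem hcov]
      rw [Set.indicator_of_mem (by simpa using hcov)]
      ring
  have hF : 0 ≤ estimationTerm M πs 𝒟 := by
    rw [estimationTerm_eq]
    exact Finset.sum_nonneg fun t _ => Finset.sum_nonneg fun a _ => Set.indicator_nonneg
      (fun a _ => mul_nonneg (M.priceProb_nonneg _ _ _ _) (rate_nonneg _ _ _)) _
  -- `eta` is nonnegative here because it dominates an absolute value on accurate data.
  have hS : 0 ≤ identificationTerm M c lmax πs 𝒟 := by
    rw [identificationTerm_eq]
    exact Finset.sum_nonneg fun t _ => Finset.sum_nonneg fun a _ => Set.indicator_nonneg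
      (fun a _ => mul_nonneg (M.priceProb_nonneg _ _ _ _)
        ((abs_nonneg _).trans (h.abs_sub_le_eta hM hN t a (h.mem_Icc hM t a)))) _
  rw [M.regret_markovPolicy, ← hπ.integral_totalReward]
  rw [hsplit] at hup
  have hfin : 2 * c * estimationTerm M πs 𝒟 + identificationTerm M c lmax πs 𝒟 ≤
      (2 * c + 1) * regretBound M c lmax πs 𝒟 := by
    rw [regretBound]
    nlinarith [mul_nonneg hc hS]
  have hfin' := mul_le_mul_of_nonneg_left hfin (a := K * (L ^ 2 + 1)) (by positivity)
  rw [← mul_assoc] at hfin'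
  linarith

/-- Unobserved prices contribute `0⁻¹ = 0`, so the random index set can be replaced by all prices.
-/
theorem integral_sum_inv_count (M : Model L 𝒜) (t : Fin T) :
    ∫ 𝒟, ∑ a ∈ observed 𝒟 t, (count 𝒟 t a : ℝ)⁻¹ ∂(M.dataLaw T N) =
      ∑ a, ∫ 𝒟, (count 𝒟 t a : ℝ)⁻¹ ∂(M.dataLaw T N) := by
  rw [← integral_finsetSum]
  · congr 1
    funext 𝒟
    refine Finset.sum_subset (Finset.subset_univ _) fun a _ ha => ?_
    rw [mem_observed, not_lt, Nat.le_zero] at ha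
    simp [ha]
  · intro a _
    refine integrable_of_forall_abs_le _ (K := 1) fun 𝒟 => ?_
    rw [abs_of_nonneg (by positivity)]
    exact Nat.cast_inv_le_one _

theorem one_sub_le_measureReal_accurate (M : Model L 𝒜) {lmin lmax : ℝ≥0}
    (hM : M.Admissible T lmin lmax) {c : ℝ} (hc : (lmax : ℝ) + 2 ≤ c) :
    1 - ∑ t : Fin T, ((∫ 𝒟, ∑ a ∈ observed 𝒟 t, (count 𝒟 t a : ℝ)⁻¹ ∂(M.dataLaw T N)) +
        M.kappa T N t) ≤
      (M.dataLaw T N).real {𝒟 | Accurate M c 𝒟 ∧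
        ∀ t a, 0 < M.priceProb T M.behavior t a → 0 < count 𝒟 t a} := by
  classical
  set G := {𝒟 : Data T N L 𝒜 | Accurate M c 𝒟 ∧
        ∀ t a, 0 < M.priceProb T M.behavior t a → 0 < count 𝒟 t a} with hG
  let P : Fin T → Finset 𝒜 := fun t =>
    Finset.univ.filter (fun a : 𝒜 => 0 < M.priceProb T M.behavior t a)
  have hsub : Gᶜ ⊆ ⋃ t ∈ (Finset.univ : Finset (Fin T)),
      ((⋃ a ∈ (Finset.univ : Finset 𝒜),
        {𝒟 | 0 < count 𝒟 t a ∧ delta c 𝒟 t a < |lamHat 𝒟 t a - M.lam t a|}) ∪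
        ⋃ a ∈ P t, {𝒟 | count 𝒟 t a = 0}) := by
    intro 𝒟 h𝒟
    by_contra hcon
    refine h𝒟 ⟨fun t a hpos => ?_, fun t a hpos => ?_⟩
    · by_contra hlt
      exact hcon (Set.mem_biUnion (Finset.mem_univ t) (Or.inl
        (Set.mem_biUnion (Finset.mem_univ a) ⟨hpos, not_le.1 hlt⟩)))
    · by_contra hlt
      exact hcon (Set.mem_biUnion (Finset.mem_univ t) (Or.inr
        (Set.mem_biUnion (x := a) (by simpa [P] using hpos) (by simpa using hlt))))
  have hle : (M.dataLaw T N).real Gᶜ ≤ ∑ t : Fin T,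
      ((∫ 𝒟, ∑ a ∈ observed 𝒟 t, (count 𝒟 t a : ℝ)⁻¹ ∂(M.dataLaw T N)) + M.kappa T N t) := by
    refine (measureReal_mono hsub (measure_ne_top _ _)).trans
      ((measureReal_biUnion_finset_le _ _).trans (Finset.sum_le_sum fun t _ => ?_))
    refine (measureReal_union_le _ _).trans (add_le_add ?_ ?_)
    · rw [integral_sum_inv_count]
      exact (measureReal_biUnion_finset_le _ _).trans (Finset.sum_le_sum fun a _ =>
        M.measureReal_bad_le_integral t a (hM.upper t t.isLt a) hc)
    · refine (measureReal_biUnion_finset_le _ _).trans (le_of_eq ?_)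
      exact Finset.sum_congr rfl fun a _ => M.measureReal_count_eq_zero t a
  rw [probReal_compl_eq_one_sub .of_discrete] at hle
  linarith

theorem measureReal_regret_le {K : ℝ} {lmin lmax : ℝ≥0} {c : ℝ} (hc : (lmax : ℝ) + 2 ≤ c)
    (h𝒜 : ∀ a ∈ 𝒜, 0 ≤ a ∧ a ≤ K) {M : Model L 𝒜} (hM : M.Admissible T lmin lmax)
    {πs : Policy L 𝒜} (hπ : M.IsOptimal T πs) (hN : 1 ≤ N) {C : ℝ}
    (hC : K * (L ^ 2 + 1) * (2 * c + 1) = C) :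
    1 - ∑ t : Fin T, ((∫ 𝒟, ∑ a ∈ observed 𝒟 t, (count 𝒟 t a : ℝ)⁻¹ ∂(M.dataLaw T N)) +
        M.kappa T N t) ≤
      (M.dataLaw T N).real {𝒟 | ∀ act, IsPessimistic c lmin lmax 𝒟 act →
        M.regret T (markovPolicy act) ≤ C * regretBound M c lmax πs 𝒟} := by
  refine (one_sub_le_measureReal_accurate M hM hc).trans (measureReal_mono ?_)
  rintro 𝒟 ⟨h1, h2⟩ act hact
  have hc0 : 0 ≤ c := le_trans (by positivity) hc
  exact hC ▸ regret_le_of_accurate h𝒜 hc0 h1 hM hN h2 hπ hact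

end OfflinePricing

namespace OfflinePricing

/-! ### Counts and estimates for long data -/

variable {T N L : ℕ} {𝒜 : Finset ℝ}

namespace Model

/-- Chebyshev for a sum of `N` independent indicators, each of variance at most `1`. -/
theorem measureReal_count_deviation_le (M : Model L 𝒜) (t : Fin T) (a : 𝒜) {s : ℝ} (hs : 0 < s)
    (hN : 1 ≤ N) :
    (M.dataLaw T N).real {𝒟 | s * N < |(count 𝒟 t a : ℝ) - N * M.priceProb T M.behavior t a|} ≤
      1 / s ^ 2 / N := by
  classical
  have hN0 : (0 : ℝ) < N := by exact_mod_cast hN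
  let Y : (Fin T → Step L 𝒜) → ℝ := fun w => if (w t).2.1 = a then 1 else 0
  have hYm : MemLp Y 2 (M.behaviorLaw T) := by
    refine MemLp.of_bound Measurable.of_discrete.aestronglyMeasurable 1
      (Filter.Eventually.of_forall fun w => ?_)
    simp only [Y]; split_ifs <;> simp
  have hYint : ∫ w, Y w ∂(M.behaviorLaw T) = M.priceProb T M.behavior t a := by
    rw [behaviorLaw, priceProb, ← integral_indicator_one .of_discrete]
    congr 1
    funext w
    simp [Y, Set.indicator_apply]
  have hcount : ∀ 𝒟 : Data T N L 𝒜, (count 𝒟 t a : ℝ) = ∑ i, Y (𝒟 i) := fun 𝒟 => by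
    simp [Y, count]
  have hvar : Var[fun 𝒟 : Data T N L 𝒜 => (count 𝒟 t a : ℝ); M.dataLaw T N] ≤ N := by
    have h1 : (fun 𝒟 : Data T N L 𝒜 => (count 𝒟 t a : ℝ)) =
        ∑ i : Fin N, fun 𝒟 : Data T N L 𝒜 => Y (𝒟 i) := by
      funext 𝒟; rw [hcount, Finset.sum_apply]
    rw [h1, dataLaw, variance_sum_pi (X := fun _ => Y) (fun _ => hYm)]
    have h2 : Var[Y; M.behaviorLaw T] ≤ 1 := by
      refine (variance_le_expectation_sq hYm.1).trans ?_
      refine (integral_mono (integrable_of_forall_abs_le _ (K := 1) fun w => ?_)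
        (integrable_const 1) fun w => ?_).trans (by simp)
      · simp only [Y, Pi.pow_apply]; split_ifs <;> simp
      · simp only [Y, Pi.pow_apply]; split_ifs <;> simp
    calc _ ≤ ∑ _i : Fin N, (1 : ℝ) := Finset.sum_le_sum fun _ _ => h2
      _ = N := by simp
  have hmean : ∫ 𝒟 : Data T N L 𝒜, (count 𝒟 t a : ℝ) ∂(M.dataLaw T N) =
      N * M.priceProb T M.behavior t a := by
    simp_rw [hcount]
    rw [integral_finsetSum _ fun i _ => integrable_of_forall_abs_le _ (K := 1) fun 𝒟 => by
      simp only [Y]; split_ifs <;> simp]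
    have : ∀ i : Fin N, ∫ 𝒟 : Data T N L 𝒜, Y (𝒟 i) ∂(M.dataLaw T N) =
        M.priceProb T M.behavior t a := fun i => by
      rw [dataLaw, ← hYint]
      have hp := measurePreserving_eval (fun _ : Fin N => M.behaviorLaw T) i
      conv_rhs => rw [← hp.map_eq]
      exact (integral_map hp.measurable.aemeasurable .of_discrete).symm
    simp [this]
  have hmem : MemLp (fun 𝒟 : Data T N L 𝒜 => (count 𝒟 t a : ℝ)) 2 (M.dataLaw T N) := by
    refine MemLp.of_bound Measurable.of_discrete.aestronglyMeasurable N
      (Filter.Eventually.of_forall fun 𝒟 => ?_)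
    simp only [Real.norm_natCast, Nat.cast_le, count]
    simpa using Finset.card_le_univ (Finset.univ.filter fun i => (𝒟 i t).2.1 = a)
  have hch := meas_ge_le_variance_div_sq hmem (c := s * N) (by positivity)
  rw [hmean] at hch
  have h2 : (M.dataLaw T N).real {𝒟 | s * N ≤
      |(count 𝒟 t a : ℝ) - N * M.priceProb T M.behavior t a|} ≤
      Var[fun 𝒟 : Data T N L 𝒜 => (count 𝒟 t a : ℝ); M.dataLaw T N] / (s * N) ^ 2 :=
    ENNReal.toReal_le_of_le_ofReal (div_nonneg (variance_nonneg _ _) (by positivity)) hch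
  refine le_trans (measureReal_mono ?_ (measure_ne_top _ _)) (h2.trans ?_)
  · intro 𝒟 h
    simp only [Set.mem_ofPred_eq] at h ⊢
    exact h.le
  calc _ ≤ (N : ℝ) / (s * N) ^ 2 := by gcongr
    _ = _ := by field_simp

/-- The counts are within `s * N` of their means, prices that are never posted are not observed, and
the estimates with at least `s * N` observations are within their confidence radii. -/
def Typical (M : Model L 𝒜) (c s : ℝ) (𝒟 : Data T N L 𝒜) : Prop :=
  ∀ t a, |(count 𝒟 t a : ℝ) - N * M.priceProb T M.behavior t a| ≤ s * N ∧
    (M.priceProb T M.behavior t a = 0 → count 𝒟 t a = 0) ∧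
    (s * N ≤ count 𝒟 t a → |lamHat 𝒟 t a - M.lam t a| ≤ delta c 𝒟 t a)

theorem one_sub_le_measureReal_typical (M : Model L 𝒜) {lmax : ℝ≥0}
    (hM : ∀ t < T, ∀ a, M.lam t a ≤ lmax) {c : ℝ} (hc : (lmax : ℝ) + 2 ≤ c) {s : ℝ} (hs : 0 < s)
    (hN : 1 ≤ N) :
    1 - T * 𝒜.card * (1 / s ^ 2 + 1 / s) / N ≤
      (M.dataLaw T N).real {𝒟 : Data T N L 𝒜 | M.Typical c s 𝒟} := by
  have hN0 : (0 : ℝ) < N := by exact_mod_cast hN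
  have hm : 0 < ⌈s * N⌉₊ := Nat.ceil_pos.2 (by positivity)
  let E : Fin T → 𝒜 → Set (Data T N L 𝒜) := fun t a =>
    {𝒟 | s * N < |(count 𝒟 t a : ℝ) - N * M.priceProb T M.behavior t a|} ∪
    ({𝒟 | M.priceProb T M.behavior t a = 0 ∧ count 𝒟 t a ≠ 0} ∪
    {𝒟 | ⌈s * N⌉₊ ≤ count 𝒟 t a ∧ delta c 𝒟 t a < |lamHat 𝒟 t a - M.lam t a|})
  have hE : ∀ t a, (M.dataLaw T N).real (E t a) ≤ (1 / s ^ 2 + 1 / s) / N := fun t a => by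
    have h1 := M.measureReal_count_deviation_le t a hs hN
    have h2 : (M.dataLaw T N).real
        {𝒟 : Data T N L 𝒜 | M.priceProb T M.behavior t a = 0 ∧ count 𝒟 t a ≠ 0} = 0 := by
      by_cases hp : M.priceProb T M.behavior t a = 0
      · have h3 := M.measureReal_count_eq_zero (N := N) t a
        rw [hp, sub_zero, one_pow] at h3
        have h4 := probReal_compl_eq_one_sub (μ := M.dataLaw T N)
          (s := {𝒟 | count 𝒟 t a = 0}) .of_discrete
        rw [h3, sub_self] at h4
        simpa [hp, Set.compl_def] using h4
      · simp [hp]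
    have h3 := M.measureReal_bad_le_inv (N := N) t a (hM t t.isLt a) hc hm
    have h4 : ((⌈s * N⌉₊ : ℕ) : ℝ)⁻¹ ≤ 1 / s / N := by
      rw [div_div, one_div]
      exact inv_anti₀ (by positivity) (Nat.le_ceil _)
    have h5 := measureReal_union_le (μ := M.dataLaw T N)
      {𝒟 | s * N < |(count 𝒟 t a : ℝ) - N * M.priceProb T M.behavior t a|}
      ({𝒟 | M.priceProb T M.behavior t a = 0 ∧ count 𝒟 t a ≠ 0} ∪
      {𝒟 | ⌈s * N⌉₊ ≤ count 𝒟 t a ∧ delta c 𝒟 t a < |lamHat 𝒟 t a - M.lam t a|})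
    have h6 := measureReal_union_le (μ := M.dataLaw T N)
      {𝒟 | M.priceProb T M.behavior t a = 0 ∧ count 𝒟 t a ≠ 0}
      {𝒟 | ⌈s * N⌉₊ ≤ count 𝒟 t a ∧ delta c 𝒟 t a < |lamHat 𝒟 t a - M.lam t a|}
    rw [add_div]
    linarith
  have hsub : {𝒟 : Data T N L 𝒜 | M.Typical c s 𝒟}ᶜ ⊆
      ⋃ z ∈ (Finset.univ : Finset (Fin T × 𝒜)), E z.1 z.2 := by
    intro 𝒟 h𝒟
    by_contra hcon
    refine h𝒟 fun t a => ?_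
    have hz : 𝒟 ∉ E t a := fun h => hcon (Set.mem_biUnion (x := (t, a)) (Finset.mem_univ _) h)
    simp only [E, Set.mem_union, Set.mem_ofPred_eq, not_or, not_lt, not_and, not_not] at hz
    exact ⟨hz.1, hz.2.1, fun h => hz.2.2 (Nat.ceil_le.2 h)⟩
  have hle : (M.dataLaw T N).real {𝒟 : Data T N L 𝒜 | M.Typical c s 𝒟}ᶜ ≤
      T * 𝒜.card * (1 / s ^ 2 + 1 / s) / N := by
    refine (measureReal_mono hsub (measure_ne_top _ _)).trans
      ((measureReal_biUnion_finset_le _ _).trans ((Finset.sum_le_sum fun z _ => hE z.1 z.2).trans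
        (le_of_eq ?_)))
    simp
    ring
  rw [probReal_compl_eq_one_sub .of_discrete] at hle
  linarith

/-- Inventory is kept with probability at least `exp (-lmax)` per period. -/
theorem exp_pow_le_levelLaw (M : Model L 𝒜) {lmax : ℝ≥0} (hM : ∀ t < T, ∀ a, M.lam t a ≤ lmax)
    (x : Fin (L + 1)) (hx : M.start = PMF.pure x) (π : Policy L 𝒜) {t : ℕ} (ht : t ≤ T) :
    Real.exp (-lmax) ^ t ≤ (M.levelLaw M.start π t x).toReal := by
  classical
  have hind : ∀ n, (M.levelLaw M.start π n x).toReal =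
      ∑ y, (M.levelLaw M.start π n y).toReal * (if y = x then 1 else 0) := fun n => by simp
  induction t with
  | zero => simp [levelLaw_zero, hx]
  | succ n ih =>
    have ih := ih (by omega)
    rw [hind n, sum_levelLaw] at ih
    rw [hind, M.sum_levelLaw_succ M.start π n (fun y => if y = x then 1 else 0), pow_succ]
    refine (mul_le_mul_of_nonneg_right ih (Real.exp_pos _).le).trans ?_
    rw [Finset.sum_mul]
    refine Finset.sum_le_sum fun z _ => ?_
    rw [mul_assoc]
    refine mul_le_mul_of_nonneg_left ?_ ENNReal.toReal_nonneg
    by_cases hz : z.1 = x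
    · rw [if_pos hz, one_mul]
      -- Zero demand keeps the level, whatever price is posted.
      have h1 : (poissonMeasure (M.lam n z.2)).real {0} ≤
          ∫ d, (if nextLevel z.1 d = x then (1 : ℝ) else 0) ∂(poissonMeasure (M.lam n z.2)) := by
        rw [← integral_indicator_one .of_discrete]
        refine integral_mono (integrable_of_forall_abs_le _ (K := 1) fun d => ?_)
          (integrable_of_forall_abs_le _ (K := 1) fun d => ?_) fun d => ?_
        · rw [Set.indicator_apply]; split_ifs <;> simp
        · split_ifs <;> simp
        · rw [Set.indicator_apply]
          by_cases hd : d = 0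
          · subst hd
            have : nextLevel z.1 0 = x := by rw [← hz]; ext; simp [nextLevel]
            simp [this]
          · simp only [Set.mem_singleton_iff, hd, if_false]
            split_ifs <;> simp
      refine le_trans ?_ h1
      rw [poissonMeasure_real_singleton]
      have : (M.lam n z.2 : ℝ) ≤ lmax := hM n (by omega) z.2
      simpa using this
    · rw [if_neg hz, zero_mul]
      exact integral_nonneg fun d => by split_ifs <;> simp

/-- Constant demand parameters, initial inventory `x`, and prices drawn independently from `q`. -/
def iid (x : Fin (L + 1)) (lam : 𝒜 → ℝ≥0) (q : PMF 𝒜) : Model L 𝒜 where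
  start := PMF.pure x
  lam := fun _ => lam
  behavior := fun _ _ _ => q

theorem priceProb_iid (x : Fin (L + 1)) (lam : 𝒜 → ℝ≥0) (q : PMF 𝒜) (t : Fin T) (a : 𝒜) :
    (iid x lam q).priceProb T (iid x lam q).behavior t a = (q a).toReal := by
  classical
  have h := (iid x lam q).integral_price_eq_priceProb (iid x lam q).behavior T t
    (fun b => if b = a then 1 else 0)
  simp only [mul_ite, mul_one, mul_zero, Finset.sum_ite_eq', Finset.mem_univ, if_true] at h
  rw [← h, (iid x lam q).integral_price_trajLaw _ _ T t (fun b => if b = a then 1 else 0)]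
  have hq : ((iid x lam q).jointLaw (iid x lam q).start (iid x lam q).behavior t).map Prod.snd
      = q := by
    simp only [jointLaw, PMF.map_bind, PMF.map_comp, Function.comp_def, iid]
    exact (congrArg _ (funext fun _ => PMF.map_id q)).trans (PMF.bind_const _ _)
  have h1 := PMF.integral_eq_sum q (fun b => if b = a then (1 : ℝ) else 0)
  have h2 := PMF.integral_eq_sum
    ((iid x lam q).jointLaw (iid x lam q).start (iid x lam q).behavior t)
    (fun z => if z.2 = a then (1 : ℝ) else 0)
  simp only [smul_eq_mul] at h1 h2
  rw [← h2]
  rw [← hq, ← PMF.toMeasure_map _ _ .of_discrete,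
    integral_map Measurable.of_discrete.aemeasurable .of_discrete, hq] at h1
  rw [h1]
  simp

/-- The law of the data does not depend on the demand parameters of prices that are never posted. -/
theorem behaviorLaw_iid_congr (x : Fin (L + 1)) {lam lam' : 𝒜 → ℝ≥0} {q : PMF 𝒜}
    (h : ∀ a, q a ≠ 0 → lam a = lam' a) :
    (iid x lam q).behaviorLaw T = (iid x lam' q).behaviorLaw T := by
  have key : ∀ n, (iid x lam q).pathPMF (PMF.pure x) (fun _ _ _ => q) n =
      (iid x lam' q).pathPMF (PMF.pure x) (fun _ _ _ => q) n := fun n => by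
    induction n with
    | zero => rfl
    | succ n ih =>
      simp only [pathPMF, ih]
      congr 1
      funext y
      refine PMF.ext fun z => ?_
      simp only [PMF.bind_apply]
      refine tsum_congr fun a => ?_
      by_cases ha : q a = 0
      · simp [ha]
      · simp only [iid, h a ha]
  simp only [behaviorLaw, trajLaw]
  exact congrArg _ (congrArg _ (key T))

end Model

/-- Price `B` with probability `p`, price `A` otherwise. -/
def twoPoint {α : Type*} (A B : α) (p : ℝ≥0) (hp : p ≤ 1) : PMF α :=
  (PMF.ofFintype (fun b : Bool => cond b (p : ℝ≥0∞) (1 - p)) (by simp [hp])).map fun b => cond b B A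

theorem twoPoint_right {α : Type*} {A B : α} (hAB : A ≠ B) (p : ℝ≥0) (hp : p ≤ 1) :
    (twoPoint A B p hp B).toReal = p := by
  simp [twoPoint, PMF.map_apply, hAB.symm]

theorem twoPoint_left {α : Type*} {A B : α} (hAB : A ≠ B) (p : ℝ≥0) (hp : p ≤ 1) :
    (twoPoint A B p hp A).toReal = 1 - p := by
  simp [twoPoint, PMF.map_apply, hAB, ENNReal.toReal_sub_of_le, hp]

theorem twoPoint_of_ne {α : Type*} {A B C : α} (hA : C ≠ A) (hB : C ≠ B) (p : ℝ≥0) (hp : p ≤ 1) :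
    twoPoint A B p hp C = 0 := by
  simp [twoPoint, PMF.map_apply, hA, hB]

/-! ### The last period -/

/-- With one unit and no future, revenue increases with the demand parameter, so the worst case is
the lower end. -/
theorem pessQ_last_eq {c : ℝ} {lmin lmax : ℝ≥0} {𝒟 : Data T N L 𝒜} {t : Fin T}
    (ht : (t : ℕ) + 1 = T) {x : Fin (L + 1)} (hx : (x : ℕ) = 1) {a : 𝒜} (ha : 0 ≤ (a : ℝ))
    (hΩ : lamLower c lmin 𝒟 t a ≤ lamUpper c lmax 𝒟 t a) :
    pessQ c lmin lmax 𝒟 t x a = a * (1 - Real.exp (-lamLower c lmin 𝒟 t a)) := by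
  have hfun : (fun l : ℝ => bellman l (pessValue c lmin lmax 𝒟 ((t : ℕ) + 1)) x (a : ℝ)) =
      fun l => (a : ℝ) * (1 - Real.exp (-l)) := by
    funext l
    rw [bellman_one _ _ x hx, ht, pessValue_self]
    simp
  rw [pessQ, worstBellman, hfun]
  refine IsLeast.csInf_eq ⟨⟨_, Set.left_mem_Icc.2 hΩ, rfl⟩, ?_⟩
  rintro _ ⟨l, hl, rfl⟩
  refine mul_le_mul_of_nonneg_left ?_ ha
  have := Real.exp_le_exp.2 (neg_le_neg hl.1)
  linarith

theorem Model.bellman_optVal_last (M : Model L 𝒜) {t : ℕ} (ht : t + 1 = T) {x : Fin (L + 1)}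
    (hx : (x : ℕ) = 1) (l a : ℝ) :
    bellman l (M.optVal T (t + 1)) x a = a * (1 - Real.exp (-l)) := by
  rw [bellman_one _ _ x hx, ht, M.optVal_self]
  simp

/-! ### The rate `√(log n / n)` -/

/-- `log x / x` decreases only beyond `exp 1 < 3`. -/
theorem sqrt_log_div_le {N n : ℕ} (hn : 3 ≤ n) (hnN : n ≤ N) :
    Real.sqrt (Real.log N / N) ≤ Real.sqrt (Real.log n / n) := by
  have h3 : Real.exp 1 ≤ 3 := Real.exp_one_lt_three.le
  have hn' : (3 : ℝ) ≤ n := by exact_mod_cast hn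
  have hnN' : (n : ℝ) ≤ N := by exact_mod_cast hnN
  exact Real.sqrt_le_sqrt (Real.log_div_self_antitoneOn (h3.trans hn')
    (h3.trans (hn'.trans hnN')) hnN')

theorem sqrt_log_div_le_mul {N n : ℕ} {k : ℝ} (hk : 0 < k) (hN : 1 ≤ N) (hn : (N : ℝ) ≤ k ^ 2 * n)
    (hnN : n ≤ N) : Real.sqrt (Real.log n / n) ≤ k * Real.sqrt (Real.log N / N) := by
  have hN0 : (0 : ℝ) < N := by exact_mod_cast hN
  have hn0 : (0 : ℝ) < n := by
    by_contra h
    have : (n : ℝ) = 0 := le_antisymm (not_lt.1 h) (Nat.cast_nonneg _)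
    rw [this, mul_zero] at hn
    linarith
  have hlog : Real.log n ≤ Real.log N := Real.log_le_log hn0 (by exact_mod_cast hnN)
  have hlogN : 0 ≤ Real.log N := Real.log_natCast_nonneg N
  rw [← Real.sqrt_sq hk.le, ← Real.sqrt_mul (by positivity)]
  refine Real.sqrt_le_sqrt ?_
  rw [div_le_iff₀ hn0]
  refine hlog.trans ?_
  rw [mul_div_assoc', div_mul_eq_mul_div, le_div_iff₀ hN0]
  nlinarith

/-- `N ≤ n ^ 2` gives `log N ≤ 2 * log n`; this is the factor `2` in `hn`. -/
theorem mul_sqrt_log_div_le {N n : ℕ} {k : ℝ} (hk : 0 < k) (hN : 1 ≤ N)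
    (hn : 2 * k ^ 2 * n ≤ N) (hn2 : (N : ℝ) ≤ n ^ 2) :
    k * Real.sqrt (Real.log N / N) ≤ Real.sqrt (Real.log n / n) := by
  have hN0 : (0 : ℝ) < N := by exact_mod_cast hN
  have hn0 : (0 : ℝ) < n := by
    by_contra h
    have : (n : ℝ) = 0 := le_antisymm (not_lt.1 h) (Nat.cast_nonneg _)
    rw [this] at hn2
    norm_num at hn2
    omega
  have hlog : Real.log N ≤ 2 * Real.log n := by
    have := Real.log_le_log hN0 hn2
    rwa [Real.log_pow, Nat.cast_ofNat] at this
  have hlogn : 0 ≤ Real.log n := Real.log_natCast_nonneg n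
  rw [← Real.sqrt_sq hk.le, ← Real.sqrt_mul (by positivity)]
  refine Real.sqrt_le_sqrt ?_
  rw [le_div_iff₀ hn0, mul_div_assoc', div_mul_eq_mul_div, div_le_iff₀ hN0]
  calc k ^ 2 * Real.log N * n ≤ k ^ 2 * (2 * Real.log n) * n := by gcongr
    _ = Real.log n * (2 * k ^ 2 * n) := by ring
    _ ≤ _ := by gcongr

theorem tendsto_sqrt_log_div :
    Filter.Tendsto (fun N : ℕ => Real.sqrt (Real.log N / N)) Filter.atTop (nhds 0) := by
  have h : Filter.Tendsto (fun x : ℝ => Real.log x / x) Filter.atTop (nhds 0) :=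
    Real.isLittleO_log_id_atTop.tendsto_div_nhds_zero
  have h2 := (h.comp tendsto_natCast_atTop_atTop).sqrt
  rw [Real.sqrt_zero] at h2
  exact h2

theorem count_le (𝒟 : Data T N L 𝒜) (t : Fin T) (a : 𝒜) : count 𝒟 t a ≤ N := by
  simpa [count] using Finset.card_le_univ (Finset.univ.filter fun i => (𝒟 i t).2.1 = a)

end OfflinePricing

namespace OfflinePricing

/-! ### Attaining the estimation term -/

variable {T N L : ℕ} {𝒜 : Finset ℝ}

theorem covered_eq_univ {M : Model L 𝒜} {t : Fin T} (h : ∀ a, 0 < M.priceProb T M.behavior t a)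
    (πs : Policy L 𝒜) : covered M T πs t = Set.univ :=
  Set.eq_univ_of_forall fun a _ => h a

theorem identificationTerm_eq_zero {M : Model L 𝒜}
    (h : ∀ t a, 0 < M.priceProb T M.behavior t a) (c : ℝ) (lmax : ℝ≥0) (πs : Policy L 𝒜)
    (𝒟 : Data T N L 𝒜) : identificationTerm M c lmax πs 𝒟 = 0 := by
  simp [identificationTerm_eq, covered_eq_univ (h _)]

theorem estimationTerm_le {M : Model L 𝒜} {𝒟 : Data T N L 𝒜} {πs : Policy L 𝒜} {R : ℝ}
    (h : ∀ t, ∀ a ∈ covered M T πs t, 0 < M.priceProb T πs t a → rate 𝒟 t a ≤ R) (hR : 0 ≤ R) :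
    estimationTerm M πs 𝒟 ≤ T * R := by
  classical
  rw [estimationTerm_eq]
  calc _ ≤ ∑ _t : Fin T, R := Finset.sum_le_sum fun t _ => ?_
    _ = T * R := by simp
  calc _ ≤ ∑ a, M.priceProb T πs t a * R := Finset.sum_le_sum fun a _ => ?_
    _ = R := by rw [← Finset.sum_mul, M.sum_priceProb, one_mul]
  have h0 := M.priceProb_nonneg πs T t a
  rw [Set.indicator_apply]
  split_ifs with hcov
  · rcases h0.eq_or_lt with h1 | h1
    · rw [← h1]; simp
    · exact mul_le_mul_of_nonneg_left (h t a hcov h1) h0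
  · exact mul_nonneg h0 hR

theorem le_estimationTerm {M : Model L 𝒜} (hM : ∀ t a, 0 < M.priceProb T M.behavior t a)
    {𝒟 : Data T N L 𝒜} (πs : Policy L 𝒜) {R : ℝ} (t : Fin T) (h : ∀ a, R ≤ rate 𝒟 t a) :
    R ≤ estimationTerm M πs 𝒟 := by
  rw [estimationTerm_eq]
  simp only [covered_eq_univ (hM _), Set.indicator_univ]
  calc R = ∑ a, M.priceProb T πs t a * R := by
        rw [← Finset.sum_mul, M.sum_priceProb, one_mul]
    _ ≤ ∑ a, M.priceProb T πs t a * rate 𝒟 t a := Finset.sum_le_sum fun a _ =>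
        mul_le_mul_of_nonneg_left (h a) (M.priceProb_nonneg πs T t a)
    _ ≤ _ := Finset.single_le_sum (f := fun t => ∑ a, M.priceProb T πs t a * rate 𝒟 t a)
        (fun t _ => Finset.sum_nonneg fun a _ =>
          mul_nonneg (M.priceProb_nonneg πs T t a) (rate_nonneg 𝒟 t a)) (Finset.mem_univ t)

theorem exp_sub_one_le {u : ℝ} (h0 : 0 ≤ u) (h1 : u ≤ 1) : Real.exp u - 1 ≤ 2 * u := by
  have h := (abs_le.1 (Real.abs_exp_sub_one_sub_id_le (abs_le.2 ⟨by linarith, h1⟩))).2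
  nlinarith

theorem exp_neg_sub_ge (x y : ℝ) :
    Real.exp (-y) * (y - x) ≤ Real.exp (-x) - Real.exp (-y) := by
  have h : Real.exp (-x) = Real.exp (-y) * Real.exp (y - x) := by
    rw [← Real.exp_add]; congr 1; ring
  have h2 := Real.add_one_le_exp (y - x)
  have h3 := Real.exp_pos (-y)
  rw [h]
  nlinarith

/-- The regret in terms of the gap between the posted price and a price `b` in the last period, from
one unit of initial inventory. -/
theorem Model.mul_gap_le_regret [Nonempty 𝒜] (M : Model L 𝒜) {lmax : ℝ≥0}
    (hM : ∀ t < T, ∀ a, M.lam t a ≤ lmax) {x : Fin (L + 1)} (hstart : M.start = PMF.pure x)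
    (hx : (x : ℕ) = 1) {t : ℕ} (ht : t + 1 = T) (act : ℕ → Fin (L + 1) → 𝒜) (b : 𝒜) {g : ℝ}
    (hg : 0 ≤ g) (hgap : g ≤ b * (1 - Real.exp (-M.lam t b)) -
      act t x * (1 - Real.exp (-M.lam t (act t x)))) :
    Real.exp (-lmax) ^ T * g ≤ M.regret T (markovPolicy act) := by
  have htT : t < T := by omega
  refine le_trans ?_ (M.le_regret_markovPolicy htT act x)
  have h1 := M.exp_pow_le_levelLaw hM x hstart (markovPolicy act) htT.le
  have h2 : Real.exp (-lmax) ^ T ≤ Real.exp (-(lmax : ℝ)) ^ t :=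
    pow_le_pow_of_le_one (Real.exp_pos _).le (Real.exp_le_one_iff.2 (by simp)) htT.le
  have h3 := M.bellman_le_optVal htT x b
  rw [M.bellman_optVal_last ht hx] at h3
  rw [M.bellman_optVal_last ht hx]
  exact mul_le_mul (h2.trans h1) (by linarith) hg ENNReal.toReal_nonneg

/-- With two prices, one of them posted rarely, of almost equal revenue in the last period,
pessimism prefers the price that is posted often. -/
theorem act_eq_of_typical {A₁ A₂ : 𝒜} (hcov : ∀ b, b = A₁ ∨ b = A₂) (hA : A₁ < A₂)
    (hA₁ : 0 < (A₁ : ℝ)) {M : Model L 𝒜} {lmin lmax : ℝ≥0} (hM : M.Admissible T lmin lmax)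
    {t : Fin T} (ht : (t : ℕ) + 1 = T) {l₂ c r : ℝ} (hc : 0 < c)
    (hr : r = Real.sqrt (Real.log N / N)) (hN : 400000000 ≤ N)
    (hrev : (A₁ : ℝ) * (1 - Real.exp (-M.lam t A₁)) = A₂ * (1 - Real.exp (-l₂)))
    (hl₂ : (M.lam t A₂ : ℝ) = l₂ + c * r) (hlow : lmin + 24 * c * r ≤ l₂) (hr1 : 3 * c * r ≤ 1)
    (hp₁ : M.priceProb T M.behavior t A₁ = 9999 / 10000)
    (hp₂ : M.priceProb T M.behavior t A₂ = 1 / 10000) {𝒟 : Data T N L 𝒜}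
    (hacc : Accurate M c 𝒟) (h𝒟 : M.Typical (c / 2) (1 / 20000) 𝒟)
    {x : Fin (L + 1)} (hx : (x : ℕ) = 1) {act : ℕ → Fin (L + 1) → 𝒜}
    (hact : IsPessimistic c lmin lmax 𝒟 act) : act t x = A₁ := by
  have hNr : (400000000 : ℝ) ≤ N := by exact_mod_cast hN
  have hN1 : 1 ≤ N := by omega
  have hr0 : 0 < r := by
    rw [hr]
    refine Real.sqrt_pos.2 (div_pos (Real.log_pos (by linarith)) (by linarith))
  refine (hcov (act t x)).resolve_right fun hact₂ => ?_
  obtain ⟨d₁, -, e₁⟩ := h𝒟 t A₁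
  obtain ⟨d₂, -, e₂⟩ := h𝒟 t A₂
  rw [hp₁, abs_le] at d₁
  rw [hp₂, abs_le] at d₂
  have e₁ := abs_le.1 (e₁ (by linarith))
  have e₂ := abs_le.1 (e₂ (by linarith))
  have hrate₁ : rate 𝒟 t A₁ ≤ 2 * r := by
    rw [hr]
    exact sqrt_log_div_le_mul two_pos hN1 (by linarith) (count_le 𝒟 t A₁)
  -- The count of `A₂` is between `N / 20000` and `3 * N / 20000`. The upper end gives the factor
  -- `50`; the lower end gives `N ≤ n ^ 2` once `N ≥ 20000 ^ 2`.
  have hrate₂ : 50 * r ≤ rate 𝒟 t A₂ := by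
    rw [hr]
    refine mul_sqrt_log_div_le (by norm_num) hN1 (by linarith) ?_
    have : (N : ℝ) / 20000 ≤ count 𝒟 t A₂ := by linarith
    nlinarith
  simp only [delta] at e₁ e₂
  -- Estimation error `c / 2` plus radius `c`, times a rate at most `2 * r`.
  have hlow₁ : M.lam t A₁ - 3 * c * r ≤ lamLower c lmin 𝒟 t A₁ := by
    have hpos : 0 < count 𝒟 t A₁ := by
      have : (0 : ℝ) < count 𝒟 t A₁ := by linarith
      exact_mod_cast this
    have h1 := le_lamLower c lmin (mem_obsAbove.2 ⟨hpos, le_refl A₁⟩)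
    simp only [delta] at h1
    nlinarith
  -- The error uses only half the radius, so at least `(c / 2) * 50 * r` is subtracted from `l₂ + c
  -- * r`. This is why the estimates must be typical at `c / 2`.
  have hlow₂ : lamLower c lmin 𝒟 t A₂ ≤ l₂ - 24 * c * r := by
    have h0 : (lmin : ℝ) ≤ l₂ - 24 * c * r := by linarith
    unfold lamLower
    split_ifs with hne
    · refine Finset.sup'_le _ _ fun b hb => max_le ?_ h0
      have hb' : b = A₂ := by
        rcases hcov b with rfl | rfl
        · exact absurd (mem_obsAbove.1 hb).2 (not_le.2 hA)
        · rfl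
      subst hb'
      simp only [delta]
      nlinarith
    · exact h0
  have hA₂ : (A₁ : ℝ) < A₂ := hA
  have hq := hact t x A₁
  rw [hact₂, pessQ_last_eq ht hx hA₁.le ((hacc.mem_Icc hM t A₁).1.trans (hacc.mem_Icc hM t A₁).2),
    pessQ_last_eq ht hx (hA₁.trans hA₂).le
      ((hacc.mem_Icc hM t A₂).1.trans (hacc.mem_Icc hM t A₂).2)] at hq
  have f₁ : Real.exp (-lamLower c lmin 𝒟 t A₁) ≤
      Real.exp (-M.lam t A₁) * Real.exp (3 * c * r) := by
    rw [← Real.exp_add]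
    exact Real.exp_le_exp.2 (by linarith)
  have f₂ : Real.exp (-l₂) * Real.exp (24 * c * r) ≤ Real.exp (-lamLower c lmin 𝒟 t A₂) := by
    rw [← Real.exp_add]
    exact Real.exp_le_exp.2 (by linarith)
  have hl : l₂ ≤ M.lam t A₁ := by
    have : (M.lam t A₂ : ℝ) ≤ M.lam t A₁ := hM.mono t t.isLt hA.le
    nlinarith
  have hE : Real.exp (-M.lam t A₁) ≤ Real.exp (-l₂) := Real.exp_le_exp.2 (by linarith)
  have g₁ := exp_sub_one_le (u := 3 * c * r) (by positivity) hr1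
  have g₂ := Real.add_one_le_exp (24 * c * r)
  have hcr : 0 < c * r := by positivity
  have hEpos := Real.exp_pos (-(M.lam t A₁ : ℝ))
  -- Relative to the equal revenues in `hrev`, pessimism costs `A₁` at most order `6 * c * r` and
  -- `A₂` at least order `24 * c * r`, contradicting the choice of `A₂`.
  have k₁ : A₁ * (Real.exp (-M.lam t A₁) * (Real.exp (3 * c * r) - 1)) ≤
      A₁ * (Real.exp (-M.lam t A₁) * (6 * (c * r))) := by
    gcongr; linarith
  have k₂ : A₂ * (Real.exp (-l₂) * (24 * (c * r))) ≤
      A₂ * (Real.exp (-l₂) * (Real.exp (24 * c * r) - 1)) := by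
    have := hA₁.trans hA₂
    gcongr; linarith
  have k₃ : A₁ * (Real.exp (-M.lam t A₁) * (6 * (c * r))) <
      A₂ * (Real.exp (-l₂) * (24 * (c * r))) := by
    calc _ ≤ A₁ * (Real.exp (-l₂) * (6 * (c * r))) := by gcongr
      _ < A₂ * (Real.exp (-l₂) * (6 * (c * r))) := by
          have := Real.exp_pos (-l₂)
          gcongr
      _ ≤ _ := by
          have := hA₁.trans hA₂
          gcongr; norm_num
  have m₁ := mul_le_mul_of_nonneg_left f₁ hA₁.le
  have m₂ := mul_le_mul_of_nonneg_left f₂ (hA₁.trans hA₂).le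
  linarith

theorem eventually_const_div_le (K : ℝ) {ε : ℝ} (hε : 0 < ε) :
    ∀ᶠ N : ℕ in Filter.atTop, K / N ≤ ε :=
  (tendsto_const_div_atTop_nhds_zero_nat K).eventually_le_const hε

theorem eventually_mul_rate_le (K : ℝ) {ε : ℝ} (hε : 0 < ε) :
    ∀ᶠ N : ℕ in Filter.atTop, K * Real.sqrt (Real.log N / N) ≤ ε := by
  have h := tendsto_sqrt_log_div.const_mul K
  rw [mul_zero] at h
  exact h.eventually_le_const hε

set_option maxHeartbeats 1000000 in
-- Two prices, the better one posted with probability `1 / 10000` and better by order `c * r` in the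
-- last period. Allowing every `c' ≤ k` lets one constant serve both halves of attainability.
theorem estimationTerm_attainable {lmin lmax : ℝ≥0} (hlt : lmin < lmax) {c : ℝ}
    (hc : 2 * ((lmax : ℝ) + 2) ≤ c) (hL : 1 ≤ L) {abar : ℝ} (habar : 0 < abar) (hT : 1 ≤ T) :
    ∃ k : ℝ, 0 < k ∧ ∀ c' : ℝ, 0 < c' → c' ≤ k →
      ∃ (𝒜 : Finset ℝ) (M : ℕ → Model L 𝒜),
        (∀ a ∈ 𝒜, 0 < a ∧ a ≤ abar) ∧
        (∀ N, (M N).Admissible T lmin lmax ∧ (∀ t < T, StrictAnti ((M N).lam t)) ∧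
          ∀ πs, (M N).IsOptimal T πs → ∀ (t : Fin T) (a : 𝒜),
            c' * (M N).priceProb T πs t a ≤ (M N).priceProb T (M N).behavior t a) ∧
        ∀ ε : ℝ, 0 < ε → ∃ N₀ : ℕ, ∀ N, N₀ ≤ N → ∀ πs, (M N).IsOptimal T πs →
          1 - ε ≤ ((M N).dataLaw T N).real {𝒟 |
            c' * Real.sqrt (Real.log N / N) ≤ estimationTerm (M N) πs 𝒟 ∧
            ∀ act, IsPessimistic c lmin lmax 𝒟 act →
              c' * regretBound (M N) c lmax πs 𝒟 ≤ (M N).regret T (markovPolicy act)} := by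
  classical
  have hlt' : (lmin : ℝ) < lmax := hlt
  have hc0 : 0 < c := by
    have : (0 : ℝ) ≤ lmax := NNReal.coe_nonneg _
    linarith
  have hT0 : (0 : ℝ) < T := by exact_mod_cast hT
  set ρ := Real.exp (-(lmax : ℝ)) ^ T with hρ
  have hρ0 : 0 < ρ := by positivity
  -- Ratio of the forfeited revenue to the upper bound `T * (200 * r)` on the estimation term. The
  -- other constraint, `1 / 10000`, is the smallest behavior probability.
  set κ := ρ * (abar * Real.exp (-(lmax : ℝ)) * c) / (200 * T) with hκ
  have hκ0 : 0 < κ := by positivity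
  refine ⟨min κ (1 / 10000), by positivity, fun c' hc'0 hc' => ?_⟩
  have hc'κ : c' ≤ κ := hc'.trans (min_le_left _ _)
  have hc'p : c' ≤ 1 / 10000 := hc'.trans (min_le_right _ _)
  -- Room on every side: `l₂ - D ≥ lmin`, `l₂ + D < l₁` and `l₁ < lmax`.
  set D : ℝ := (lmax - lmin) / 4 with hD
  have hD0 : 0 < D := by rw [hD]; linarith
  have hlmin0 : (0 : ℝ) ≤ lmin := NNReal.coe_nonneg _
  set l₂ : ℝ := lmin + D with hl₂
  set l₁ : ℝ := lmin + 3 * D with hl₁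
  have g₁ : 0 < 1 - Real.exp (-l₁) := sub_pos.2 (Real.exp_lt_one_iff.2 (by linarith))
  have g₂ : 0 < 1 - Real.exp (-l₂) := sub_pos.2 (Real.exp_lt_one_iff.2 (by linarith))
  have g₁₂ : 1 - Real.exp (-l₂) < 1 - Real.exp (-l₁) := by
    have := Real.exp_lt_exp.2 (show -l₁ < -l₂ by linarith)
    linarith
  -- Equalises the last-period revenues at parameters `l₁` and `l₂`.
  set a₁ : ℝ := abar * (1 - Real.exp (-l₂)) / (1 - Real.exp (-l₁)) with ha₁
  have ha₁0 : 0 < a₁ := by positivity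
  have ha₁lt : a₁ < abar := by
    rw [ha₁, div_lt_iff₀ g₁]
    exact mul_lt_mul_of_pos_left g₁₂ habar
  have hrev : a₁ * (1 - Real.exp (-l₁)) = abar * (1 - Real.exp (-l₂)) := by
    rw [ha₁]; field_simp
  let 𝒜 : Finset ℝ := {a₁, abar}
  let A₁ : 𝒜 := ⟨a₁, by simp [𝒜]⟩
  let A₂ : 𝒜 := ⟨abar, by simp [𝒜]⟩
  have hcov : ∀ b : 𝒜, b = A₁ ∨ b = A₂ := fun b => by
    have := b.2
    simp only [𝒜, Finset.mem_insert, Finset.mem_singleton] at this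
    rcases this with h | h
    · exact Or.inl (Subtype.ext h)
    · exact Or.inr (Subtype.ext h)
  have hA : A₁ < A₂ := ha₁lt
  have hne : A₁ ≠ A₂ := hA.ne
  have : Nonempty 𝒜 := ⟨A₁⟩
  -- The cap keeps every `N` admissible; it is inactive for large `N`.
  let m : ℕ → ℝ := fun N => min (c * Real.sqrt (Real.log N / N)) D
  have hm0 : ∀ N, 0 ≤ m N := fun N => le_min (by positivity) hD0.le
  let lam : ℕ → 𝒜 → ℝ≥0 := fun N a =>
    if a = A₁ then l₁.toNNReal else (l₂ + m N).toNNReal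
  have hlam₁ : ∀ N, (lam N A₁ : ℝ) = l₁ := fun N => by
    simp only [lam, if_true]
    exact Real.coe_toNNReal _ (by linarith)
  have hlam₂ : ∀ N, (lam N A₂ : ℝ) = l₂ + m N := fun N => by
    simp only [lam, if_neg hne.symm]
    exact Real.coe_toNNReal _ (by linarith [hm0 N])
  let x : Fin (L + 1) := ⟨1, by omega⟩
  let q : PMF 𝒜 := twoPoint A₁ A₂ (1 / 10000) (by
    rw [← NNReal.coe_le_coe]; push_cast; norm_num)
  let M : ℕ → Model L 𝒜 := fun N => Model.iid x (lam N) q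
  have hp₁ : ∀ N (t : Fin T), (M N).priceProb T (M N).behavior t A₁ = 9999 / 10000 := fun N t => by
    rw [Model.priceProb_iid, twoPoint_left hne]; push_cast; norm_num
  have hp₂ : ∀ N (t : Fin T), (M N).priceProb T (M N).behavior t A₂ = 1 / 10000 := fun N t => by
    rw [Model.priceProb_iid, twoPoint_right hne]; push_cast; norm_num
  have hpos : ∀ N (t : Fin T) a, 1 / 10000 ≤ (M N).priceProb T (M N).behavior t a :=
    fun N t a => by
      rcases hcov a with rfl | rfl
      · rw [hp₁]; norm_num
      · rw [hp₂]
  have hpos' : ∀ N (t : Fin T) a, 0 < (M N).priceProb T (M N).behavior t a :=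
    fun N t a => lt_of_lt_of_le (by norm_num) (hpos N t a)
  have hmD : ∀ N, m N ≤ D := fun N => min_le_right _ _
  have hanti : ∀ N, StrictAnti (lam N) := fun N a b hab => by
    rw [← NNReal.coe_lt_coe]
    rcases hcov a with rfl | rfl <;> rcases hcov b with rfl | rfl
    · exact absurd hab (lt_irrefl _)
    · rw [hlam₁, hlam₂]; linarith [hmD N]
    · exact absurd hab (not_lt.2 hA.le)
    · exact absurd hab (lt_irrefl _)
  have hadm : ∀ N, (M N).Admissible T lmin lmax := fun N => by
    refine ⟨fun t _ a => ?_, fun t _ a => ?_, fun t _ => (hanti N).antitone⟩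
    · rw [← NNReal.coe_le_coe]
      change (lmin : ℝ) ≤ lam N a
      rcases hcov a with rfl | rfl
      · rw [hlam₁]; linarith
      · rw [hlam₂]; linarith [hm0 N]
    · rw [← NNReal.coe_le_coe]
      change (lam N a : ℝ) ≤ lmax
      rcases hcov a with rfl | rfl
      · rw [hlam₁]; linarith
      · rw [hlam₂]; linarith [hmD N]
  refine ⟨𝒜, M, ?_, fun N => ⟨hadm N, fun t _ => hanti N, fun πs _ t a => ?_⟩, fun ε hε => ?_⟩
  · intro a ha
    simp only [𝒜, Finset.mem_insert, Finset.mem_singleton] at ha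
    rcases ha with rfl | rfl
    · exact ⟨ha₁0, ha₁lt.le⟩
    · exact ⟨habar, le_rfl⟩
  · have h1 : (M N).priceProb T πs t a ≤ 1 := measureReal_le_one
    have h0 := (M N).priceProb_nonneg πs T t a
    refine le_trans ?_ (hpos N t a)
    nlinarith
  have hev := (eventually_const_div_le
      (T * 𝒜.card * (1 / (1 / 20000 : ℝ) ^ 2 + 1 / (1 / 20000 : ℝ))) hε).and
    ((Filter.eventually_ge_atTop 400000000).and ((eventually_mul_rate_le (24 * c) hD0).and
      (eventually_mul_rate_le (3 * c) one_pos)))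
  refine Filter.eventually_atTop.1 (hev.mono ?_)
  rintro N ⟨hNε, hN, hrD, hr1⟩ πs hπ
  set r := Real.sqrt (Real.log N / N) with hr
  have hr0 : 0 ≤ r := Real.sqrt_nonneg _
  have hNr : (400000000 : ℝ) ≤ N := by exact_mod_cast hN
  have hN1 : 1 ≤ N := by omega
  have hmN : m N = c * r := min_eq_left (by nlinarith)
  have htyp := (M N).one_sub_le_measureReal_typical (hadm N).upper (c := c / 2) (by linarith)
    (s := 1 / 20000) (by norm_num) hN1
  refine le_trans (by linarith) (htyp.trans (measureReal_mono ?_ (measure_ne_top _ _)))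
  intro 𝒟 h𝒟
  have hcount : ∀ t a, (N : ℝ) / 20000 ≤ count 𝒟 t a := fun t a => by
    have h1 := (abs_le.1 (h𝒟 t a).1).1
    have h2 := hpos N t a
    nlinarith
  have hrate : ∀ t a, rate 𝒟 t a ≤ 200 * r := fun t a =>
    sqrt_log_div_le_mul (by norm_num) hN1 (by linarith [hcount t a]) (count_le 𝒟 t a)
  have hrate' : ∀ t a, r ≤ rate 𝒟 t a := fun t a => by
    refine sqrt_log_div_le ?_ (count_le 𝒟 t a)
    have : (3 : ℝ) ≤ count 𝒟 t a := by linarith [hcount t a]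
    exact_mod_cast this
  have hacc : Accurate (M N) c 𝒟 := fun t a _ => by
    refine ((h𝒟 t a).2.2 (by linarith [hcount t a])).trans ?_
    simp only [delta]
    nlinarith [rate_nonneg 𝒟 t a]
  have hF := estimationTerm_le (M := M N) (πs := πs) (fun t a _ _ => hrate t a) (by positivity)
  let t : Fin T := ⟨T - 1, by omega⟩
  have ht : (t : ℕ) + 1 = T := by simp only [t]; omega
  have hF' := le_estimationTerm (hpos' N) πs t (hrate' t)
  refine ⟨le_trans (by nlinarith) hF', fun act hact => ?_⟩
  have hacteq := act_eq_of_typical hcov hA ha₁0 (hadm N) ht hc0 hr hN (l₂ := l₂)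
    (by change a₁ * (1 - Real.exp (-(lam N A₁ : ℝ))) = _; rw [hlam₁, hrev])
    (by change (lam N A₂ : ℝ) = _; rw [hlam₂, hmN])
    (by linarith) hr1 (hp₁ N t) (hp₂ N t) hacc h𝒟 (x := x) rfl hact
  have hreg := (M N).mul_gap_le_regret (hadm N).upper (x := x) rfl rfl ht act A₂
    (g := abar * Real.exp (-(lmax : ℝ)) * c * r) (by positivity) (by
      rw [hacteq]
      change _ ≤ abar * (1 - Real.exp (-(lam N A₂ : ℝ))) -
        a₁ * (1 - Real.exp (-(lam N A₁ : ℝ)))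
      rw [hlam₁, hlam₂, hrev, hmN]
      have h1 := exp_neg_sub_ge l₂ (l₂ + c * r)
      have h2 : Real.exp (-(lmax : ℝ)) ≤ Real.exp (-(l₂ + c * r)) :=
        Real.exp_le_exp.2 (by have := hmD N; rw [hmN] at this; linarith)
      have h3 : Real.exp (-(lmax : ℝ)) * (c * r) ≤ Real.exp (-(l₂ + c * r)) * (c * r) := by
        gcongr
      rw [add_sub_cancel_left] at h1
      have h4 := mul_le_mul_of_nonneg_left (h3.trans h1) habar.le
      linarith)
  refine le_trans ?_ hreg
  rw [regretBound, identificationTerm_eq_zero (hpos' N), add_zero]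
  calc c' * estimationTerm (M N) πs 𝒟 ≤ κ * (T * (200 * r)) := by
        have := hr0.trans hF'
        gcongr
    _ = ρ * (abar * Real.exp (-(lmax : ℝ)) * c * r) := by
        rw [hκ]; field_simp

end OfflinePricing

namespace OfflinePricing

/-! ### Attaining the identification term -/

variable {T N L : ℕ} {𝒜 : Finset ℝ}

/-- Three prices, the middle one never posted; the demand parameters of the outer two are `v`
apart, and the middle one is better than both in the last period by `g`. -/
structure HiddenPrice (M : Model L 𝒜) (T : ℕ) (x : Fin (L + 1)) (A₁ A₀ A₂ : 𝒜) (l v g : ℝ) :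
    Prop where
  cases : ∀ b, b = A₁ ∨ b = A₀ ∨ b = A₂
  lt₁ : A₁ < A₀
  lt₂ : A₀ < A₂
  pos : 0 < (A₁ : ℝ)
  start : M.start = PMF.pure x
  level : (x : ℕ) = 1
  prob₁ : ∀ t : Fin T, M.priceProb T M.behavior t A₁ = 1 / 2
  prob₀ : ∀ t : Fin T, M.priceProb T M.behavior t A₀ = 0
  prob₂ : ∀ t : Fin T, M.priceProb T M.behavior t A₂ = 1 / 2
  lam₁ : ∀ t, (M.lam t A₁ : ℝ) = l + v
  lam₂ : ∀ t, (M.lam t A₂ : ℝ) = l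
  gap_pos : 0 < g
  gap : ∀ t, ∀ b, b ≠ A₀ → g ≤ A₀ * (1 - Real.exp (-M.lam t A₀)) - b * (1 - Real.exp (-M.lam t b))

namespace HiddenPrice

variable {M : Model L 𝒜} {x : Fin (L + 1)} {A₁ A₀ A₂ : 𝒜} {l v g c : ℝ} {lmin lmax : ℝ≥0}
  {𝒟 : Data T N L 𝒜}

theorem count_ge (H : HiddenPrice M T x A₁ A₀ A₂ l v g) (h𝒟 : M.Typical c (1 / 4) 𝒟) (t : Fin T)
    {a : 𝒜} (ha : a ≠ A₀) : (N : ℝ) / 4 ≤ count 𝒟 t a := by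
  have h1 := (abs_le.1 (h𝒟 t a).1).1
  have h2 : M.priceProb T M.behavior t a = 1 / 2 := by
    rcases H.cases a with rfl | rfl | rfl
    · exact H.prob₁ t
    · exact absurd rfl ha
    · exact H.prob₂ t
  rw [h2] at h1
  linarith

theorem count_pos (H : HiddenPrice M T x A₁ A₀ A₂ l v g) (h𝒟 : M.Typical c (1 / 4) 𝒟)
    (hN : 1 ≤ N) (t : Fin T) {a : 𝒜} (ha : a ≠ A₀) : 0 < count 𝒟 t a := by
  have h1 := H.count_ge h𝒟 t ha
  have h2 : (0 : ℝ) < N := by exact_mod_cast hN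
  have : (0 : ℝ) < count 𝒟 t a := by linarith
  exact_mod_cast this

theorem count_eq_zero (H : HiddenPrice M T x A₁ A₀ A₂ l v g) (h𝒟 : M.Typical c (1 / 4) 𝒟)
    (t : Fin T) : count 𝒟 t A₀ = 0 := (h𝒟 t A₀).2.1 (H.prob₀ t)

theorem ne_of_count_pos (H : HiddenPrice M T x A₁ A₀ A₂ l v g) (h𝒟 : M.Typical c (1 / 4) 𝒟)
    {t : Fin T} {a : 𝒜} (ha : 0 < count 𝒟 t a) : a ≠ A₀ := by
  rintro rfl
  rw [H.count_eq_zero h𝒟] at ha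
  exact lt_irrefl _ ha

theorem rate_le (H : HiddenPrice M T x A₁ A₀ A₂ l v g) (h𝒟 : M.Typical c (1 / 4) 𝒟)
    (hN : 1 ≤ N) (t : Fin T) {a : 𝒜} (ha : a ≠ A₀) :
    rate 𝒟 t a ≤ 2 * Real.sqrt (Real.log N / N) :=
  sqrt_log_div_le_mul two_pos hN (by linarith [H.count_ge h𝒟 t ha]) (count_le 𝒟 t a)

theorem accurate (H : HiddenPrice M T x A₁ A₀ A₂ l v g) (h𝒟 : M.Typical c (1 / 4) 𝒟) :
    Accurate M c 𝒟 := fun t a ha =>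
  (h𝒟 t a).2.2 (by linarith [H.count_ge h𝒟 t (H.ne_of_count_pos h𝒟 ha)])

theorem obsAbove_hidden (H : HiddenPrice M T x A₁ A₀ A₂ l v g) (h𝒟 : M.Typical c (1 / 4) 𝒟)
    (hN : 1 ≤ N) (t : Fin T) : obsAbove 𝒟 t A₀ = {A₂} := by
  ext b
  rw [mem_obsAbove, Finset.mem_singleton]
  constructor
  · rintro ⟨h1, h2⟩
    rcases H.cases b with rfl | rfl | rfl
    · exact absurd h2 (not_le.2 H.lt₁)
    · exact absurd rfl (H.ne_of_count_pos h𝒟 h1)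
    · rfl
  · rintro rfl
    exact ⟨H.count_pos h𝒟 hN t H.lt₂.ne', H.lt₂.le⟩

theorem obsAbove_right (H : HiddenPrice M T x A₁ A₀ A₂ l v g) (h𝒟 : M.Typical c (1 / 4) 𝒟)
    (hN : 1 ≤ N) (t : Fin T) : obsAbove 𝒟 t A₂ = {A₂} := by
  ext b
  rw [mem_obsAbove, Finset.mem_singleton]
  constructor
  · rintro ⟨h1, h2⟩
    rcases H.cases b with rfl | rfl | rfl
    · exact absurd h2 (not_le.2 (H.lt₁.trans H.lt₂))
    · exact absurd h2 (not_le.2 H.lt₂)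
    · rfl
  · rintro rfl
    exact ⟨H.count_pos h𝒟 hN t H.lt₂.ne', le_rfl⟩

theorem obsBelow_hidden (H : HiddenPrice M T x A₁ A₀ A₂ l v g) (h𝒟 : M.Typical c (1 / 4) 𝒟)
    (hN : 1 ≤ N) (t : Fin T) : obsBelow 𝒟 t A₀ = {A₁} := by
  ext b
  rw [mem_obsBelow, Finset.mem_singleton]
  constructor
  · rintro ⟨h1, h2⟩
    rcases H.cases b with rfl | rfl | rfl
    · rfl
    · exact absurd rfl (H.ne_of_count_pos h𝒟 h1)
    · exact absurd h2 (not_le.2 H.lt₂)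
  · rintro rfl
    exact ⟨H.count_pos h𝒟 hN t H.lt₁.ne, H.lt₁.le⟩

theorem eta_eq (H : HiddenPrice M T x A₁ A₀ A₂ l v g) (h𝒟 : M.Typical c (1 / 4) 𝒟)
    (hN : 1 ≤ N) (t : Fin T) :
    eta M c lmax 𝒟 t A₀ = v + 2 * delta c 𝒟 t A₁ + 2 * delta c 𝒟 t A₂ := by
  have hb := H.obsBelow_hidden h𝒟 hN t
  have ha := H.obsAbove_hidden h𝒟 hN t
  simp only [eta, ha, hb, Finset.singleton_nonempty, dif_pos, Finset.max'_singleton,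
    Finset.min'_singleton, H.lam₁, H.lam₂]
  ring

/-- The pessimistic policy does not post the hidden price in the last period. -/
theorem act_ne (H : HiddenPrice M T x A₁ A₀ A₂ l v g) (h𝒟 : M.Typical c (1 / 4) 𝒟)
    (hM : M.Admissible T lmin lmax) (hc : 0 ≤ c) (hN : 1 ≤ N) {t : Fin T} (ht : (t : ℕ) + 1 = T)
    (hr : 4 * c * Real.sqrt (Real.log N / N) < l)
    {act : ℕ → Fin (L + 1) → 𝒜} (hact : IsPessimistic c lmin lmax 𝒟 act) : act t x ≠ A₀ := by
  intro h0
  have hacc := H.accurate h𝒟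
  have hpos₀ : 0 < (A₀ : ℝ) := H.pos.trans H.lt₁
  have hlt : (A₀ : ℝ) < A₂ := H.lt₂
  -- Only `A₂` is observed at or above the hidden price, so both have the same worst-case demand and
  -- the larger price wins.
  have hlow : lamLower c lmin 𝒟 t A₀ = lamLower c lmin 𝒟 t A₂ := by
    simp only [lamLower, H.obsAbove_hidden h𝒟 hN t, H.obsAbove_right h𝒟 hN t]
  -- The lower end is at least `l - 2δ ≥ l - 4 * c * r`; positivity makes the comparison strict even
  -- if `lmin = 0`.
  have hl : 0 < lamLower c lmin 𝒟 t A₂ := by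
    have hcnt := H.count_pos h𝒟 hN t H.lt₂.ne'
    have h1 := le_lamLower c lmin (mem_obsAbove.2 ⟨hcnt, le_refl A₂⟩)
    have h2 := (abs_le.1 (hacc t A₂ hcnt)).1
    rw [H.lam₂] at h2
    have h3 := mul_le_mul_of_nonneg_left (H.rate_le h𝒟 hN t H.lt₂.ne') hc
    simp only [delta] at h1 h2
    linarith
  have hq := hact t x A₂
  rw [h0, pessQ_last_eq ht H.level hpos₀.le
      ((hacc.mem_Icc hM t A₀).1.trans (hacc.mem_Icc hM t A₀).2),
    pessQ_last_eq ht H.level (hpos₀.trans hlt).le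
      ((hacc.mem_Icc hM t A₂).1.trans (hacc.mem_Icc hM t A₂).2), hlow] at hq
  have h1 : 0 < 1 - Real.exp (-lamLower c lmin 𝒟 t A₂) :=
    sub_pos.2 (Real.exp_lt_one_iff.2 (by linarith))
  exact absurd hq (not_le.2 (mul_lt_mul_of_pos_right hlt h1))

/-- An optimal policy posts the hidden price in the last period. -/
theorem le_priceProb (H : HiddenPrice M T x A₁ A₀ A₂ l v g)
    (hM : ∀ t < T, ∀ a, M.lam t a ≤ lmax) {t : Fin T} (ht : (t : ℕ) + 1 = T) {πs : Policy L 𝒜}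
    (hπ : M.IsOptimal T πs) : Real.exp (-lmax) ^ T ≤ M.priceProb T πs t A₀ := by
  classical
  have : Nonempty 𝒜 := ⟨A₀⟩
  have h1 := M.exp_pow_le_levelLaw hM x H.start πs t.isLt.le
  have h2 : Real.exp (-lmax) ^ T ≤ Real.exp (-(lmax : ℝ)) ^ (t : ℕ) :=
    pow_le_pow_of_le_one (Real.exp_pos _).le (Real.exp_le_one_iff.2 (by simp)) t.isLt.le
  -- Every other price is strictly suboptimal at `x`, so all the mass of this level sits on `A₀`.
  have h3 : (M.levelLaw M.start πs t x).toReal = (M.jointLaw M.start πs t (x, A₀)).toReal := by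
    have h4 := M.sum_levelLaw M.start πs t (fun y => if y = x then 1 else 0)
    rw [Fintype.sum_prod_type] at h4
    simp only [mul_ite, mul_one, mul_zero, Finset.sum_ite_eq', Finset.mem_univ, if_true] at h4
    rw [h4, Finset.sum_eq_single x, Finset.sum_eq_single A₀]
    · simp
    · intro b _ hb
      have h5 := H.gap t b hb
      have h6 := M.bellman_le_optVal t.isLt x A₀
      rw [M.bellman_optVal_last ht H.level] at h6
      rw [hπ.jointLaw_eq_zero t.isLt x b (by
        rw [M.bellman_optVal_last ht H.level]; linarith [H.gap_pos])]
      simp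
    · simp
    · intro y _ hy
      simp [hy]
    · simp
  refine h2.trans (h1.trans ?_)
  rw [h3, M.priceProb_eq]
  exact Finset.single_le_sum (f := fun y => (M.jointLaw M.start πs t (y, A₀)).toReal)
    (fun _ _ => ENNReal.toReal_nonneg) (Finset.mem_univ x)

/-- Only the hidden price can be uncovered, and when it is covered `πs` gives it probability zero.
-/
theorem identificationTerm_eq (H : HiddenPrice M T x A₁ A₀ A₂ l v g) (πs : Policy L 𝒜) :
    identificationTerm M c lmax πs 𝒟 =
      ∑ t : Fin T, M.priceProb T πs t A₀ * eta M c lmax 𝒟 t A₀ := by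
  classical
  rw [OfflinePricing.identificationTerm_eq]
  refine Finset.sum_congr rfl fun t _ => ?_
  rw [Finset.sum_eq_single A₀]
  · rw [Set.indicator_apply]
    split_ifs with h
    · rfl
    · have h1 : A₀ ∈ covered M T πs t := by simpa using h
      have h2 : M.priceProb T πs t A₀ = 0 := by
        by_contra hne
        exact absurd (h1 ((M.priceProb_nonneg πs T t A₀).lt_of_ne' hne)) (by rw [H.prob₀]; simp)
      rw [h2, zero_mul]
  · intro b _ hb
    refine Set.indicator_of_notMem ?_ _
    rw [Set.mem_compl_iff, not_not]
    intro _
    rcases H.cases b with rfl | rfl | rfl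
    · rw [H.prob₁]; norm_num
    · exact absurd rfl hb
    · rw [H.prob₂]; norm_num
  · simp

/-- Each of the two radii is at most `2 * c * r`, so together they add at most `8 * c * r` to `v`.
-/
theorem eta_mem (H : HiddenPrice M T x A₁ A₀ A₂ l v g) (h𝒟 : M.Typical c (1 / 4) 𝒟)
    (hc : 0 ≤ c) (hN : 1 ≤ N) (hr : 8 * c * Real.sqrt (Real.log N / N) ≤ v) (t : Fin T) :
    v ≤ eta M c lmax 𝒟 t A₀ ∧ eta M c lmax 𝒟 t A₀ ≤ 2 * v := by
  rw [H.eta_eq h𝒟 hN]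
  have h1 := mul_le_mul_of_nonneg_left (H.rate_le h𝒟 hN t H.lt₁.ne) hc
  have h2 := mul_le_mul_of_nonneg_left (H.rate_le h𝒟 hN t H.lt₂.ne') hc
  have h3 := mul_nonneg hc (rate_nonneg 𝒟 t A₁)
  have h4 := mul_nonneg hc (rate_nonneg 𝒟 t A₂)
  simp only [delta]
  constructor <;> linarith

theorem identificationTerm_le (H : HiddenPrice M T x A₁ A₀ A₂ l v g)
    (h𝒟 : M.Typical c (1 / 4) 𝒟) (hc : 0 ≤ c) (hN : 1 ≤ N) (hv : 0 ≤ v)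
    (hr : 8 * c * Real.sqrt (Real.log N / N) ≤ v) (πs : Policy L 𝒜) :
    identificationTerm M c lmax πs 𝒟 ≤ T * (2 * v) := by
  rw [H.identificationTerm_eq]
  calc _ ≤ ∑ _t : Fin T, 2 * v := Finset.sum_le_sum fun t _ => ?_
    _ = T * (2 * v) := by simp
  have h1 : M.priceProb T πs t A₀ ≤ 1 := measureReal_le_one
  have h2 := H.eta_mem (lmax := lmax) h𝒟 hc hN hr t
  calc _ ≤ 1 * eta M c lmax 𝒟 t A₀ := mul_le_mul_of_nonneg_right h1 (hv.trans h2.1)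
    _ ≤ 2 * v := by linarith

theorem le_identificationTerm (H : HiddenPrice M T x A₁ A₀ A₂ l v g)
    (h𝒟 : M.Typical c (1 / 4) 𝒟) (hM : ∀ t < T, ∀ a, M.lam t a ≤ lmax) (hc : 0 ≤ c)
    (hN : 1 ≤ N) (hT : 1 ≤ T) (hv : 0 ≤ v) (hr : 8 * c * Real.sqrt (Real.log N / N) ≤ v)
    {πs : Policy L 𝒜} (hπ : M.IsOptimal T πs) :
    Real.exp (-lmax) ^ T * v ≤ identificationTerm M c lmax πs 𝒟 := by
  rw [H.identificationTerm_eq]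
  let t : Fin T := ⟨T - 1, by omega⟩
  have ht : (t : ℕ) + 1 = T := by simp only [t]; omega
  refine le_trans ?_ (Finset.single_le_sum
    (f := fun t => M.priceProb T πs t A₀ * eta M c lmax 𝒟 t A₀)
    (fun t _ => mul_nonneg (M.priceProb_nonneg πs T t A₀)
      (hv.trans (H.eta_mem h𝒟 hc hN hr t).1)) (Finset.mem_univ t))
  exact mul_le_mul (H.le_priceProb hM ht hπ) (H.eta_mem h𝒟 hc hN hr t).1 hv
    (M.priceProb_nonneg πs T t A₀)

theorem estimationTerm_le (H : HiddenPrice M T x A₁ A₀ A₂ l v g)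
    (h𝒟 : M.Typical c (1 / 4) 𝒟) (hN : 1 ≤ N) (πs : Policy L 𝒜) :
    estimationTerm M πs 𝒟 ≤ T * (2 * Real.sqrt (Real.log N / N)) := by
  refine OfflinePricing.estimationTerm_le (fun t a ha hpos => H.rate_le h𝒟 hN t ?_)
    (by positivity)
  rintro rfl
  have := ha hpos
  rw [H.prob₀] at this
  exact lt_irrefl _ this

end HiddenPrice

set_option maxHeartbeats 1000000 in
-- The scale `w` is fixed while `N` grows, so the estimation term is eventually dominated and the
-- bound is of order `w`, as is the revenue gap of the hidden price.
theorem identificationTerm_attainable {lmin lmax : ℝ≥0} (hlt : lmin < lmax) {c : ℝ}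
    (hc : (lmax : ℝ) + 2 ≤ c) (hL : 1 ≤ L) {abar : ℝ} (habar : 0 < abar) (hT : 1 ≤ T) :
    ∃ k : ℝ, 0 < k ∧ ∀ c' : ℝ, 0 < c' → c' ≤ k → ∃ w₀ : ℝ, 0 < w₀ ∧ ∀ w : ℝ, 0 < w → w ≤ w₀ →
      ∃ (𝒜 : Finset ℝ) (M₀ M : Model L 𝒜),
        (∀ a ∈ 𝒜, 0 < a ∧ a ≤ abar) ∧
        M₀.Admissible T lmin lmax ∧ (∀ t < T, StrictAnti (M₀.lam t)) ∧
        M.Admissible T lmin lmax ∧ (∀ t < T, StrictAnti (M.lam t)) ∧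
        M.behaviorLaw T = M₀.behaviorLaw T ∧ (∃ t < T, M.lam t ≠ M₀.lam t) ∧
        ∀ ε : ℝ, 0 < ε → ∃ N₀ : ℕ, ∀ N, N₀ ≤ N → ∀ πs, M.IsOptimal T πs →
          1 - ε ≤ (M₀.dataLaw T N).real {𝒟 |
            c' * w ≤ identificationTerm M c lmax πs 𝒟 ∧
            identificationTerm M c lmax πs 𝒟 ≤ w ∧
            ∀ act, IsPessimistic c lmin lmax 𝒟 act →
              c' * regretBound M c lmax πs 𝒟 ≤ M.regret T (markovPolicy act)} := by
  classical
  have hlt' : (lmin : ℝ) < lmax := hlt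
  have hlmin0 : (0 : ℝ) ≤ lmin := NNReal.coe_nonneg _
  have hc0 : 0 < c := by linarith
  have hT0 : (0 : ℝ) < T := by exact_mod_cast hT
  have hT1 : (1 : ℝ) ≤ T := by exact_mod_cast hT
  set E := Real.exp (-(lmax : ℝ)) with hE
  have hE0 : 0 < E := Real.exp_pos _
  have hE1 : E ≤ 1 := Real.exp_le_one_iff.2 (by linarith)
  set ρ := E ^ T with hρ
  have hρ0 : 0 < ρ := by positivity
  -- `κ₁ * w = ρ * v` matches the lower bound on the identification term; `κ₂` is `ρ * g` divided by
  -- the bound `3 * T * v` on the sum of both terms.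
  set κ₁ := ρ / (2 * T) with hκ₁
  set κ₂ := ρ * (abar * E / 4) / (3 * T) with hκ₂
  have hκ₁0 : 0 < κ₁ := by positivity
  have hκ₂0 : 0 < κ₂ := by positivity
  refine ⟨min κ₁ κ₂, lt_min hκ₁0 hκ₂0, fun c' hc'0 hc' => ?_⟩
  have hc'1 : c' ≤ κ₁ := hc'.trans (min_le_left _ _)
  have hc'2 : c' ≤ κ₂ := hc'.trans (min_le_right _ _)
  set D : ℝ := (lmax - lmin) / 2 with hD
  have hD0 : 0 < D := by rw [hD]; linarith
  refine ⟨min D 1, lt_min hD0 one_pos, fun w hw0 hw => ?_⟩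
  have hwD : w ≤ D := hw.trans (min_le_left _ _)
  have hw1 : w ≤ 1 := hw.trans (min_le_right _ _)
  set v : ℝ := w / (2 * T) with hv
  have hv0 : 0 < v := by positivity
  have hvw : v ≤ w := by
    rw [hv, div_le_iff₀ (by positivity)]
    nlinarith
  set l : ℝ := lmin + D with hl
  have hl0 : 0 < l := by linarith
  set G := 1 - Real.exp (-l) with hG
  have hG0 : 0 < G := sub_pos.2 (Real.exp_lt_one_iff.2 (by linarith))
  have hG1 : G < 1 := by
    have := Real.exp_pos (-l)
    linarith
  -- So low that even a certain sale earns less than `abar * G`, the revenue at the top price.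
  set a₁ : ℝ := abar * G / 2 with ha₁
  -- The discount costs at most `abar * E * v / 4`, while the extra demand `v / 2` gains at least
  -- `abar * E * v / 2`; the net gain is `g`.
  set a₀ : ℝ := abar * (1 - E / 4 * v) with ha₀
  have hEv : 0 < E / 4 * v := by positivity
  have hEv' : E / 4 * v ≤ 1 / 4 := by nlinarith
  have ha₁0 : 0 < a₁ := by positivity
  have h10 : a₁ < a₀ := by
    rw [ha₁, ha₀]
    nlinarith
  have h02 : a₀ < abar := by
    rw [ha₀]
    nlinarith
  obtain ⟨𝒜, h𝒜⟩ : ∃ 𝒜 : Finset ℝ, 𝒜 = {a₁, a₀, abar} := ⟨_, rfl⟩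
  let A₁ : 𝒜 := ⟨a₁, by simp [h𝒜]⟩
  let A₀ : 𝒜 := ⟨a₀, by simp [h𝒜]⟩
  let A₂ : 𝒜 := ⟨abar, by simp [h𝒜]⟩
  have hcov : ∀ b : 𝒜, b = A₁ ∨ b = A₀ ∨ b = A₂ := fun b => by
    have := b.2
    simp only [h𝒜, Finset.mem_insert, Finset.mem_singleton] at this
    rcases this with h | h | h
    · exact Or.inl (Subtype.ext h)
    · exact Or.inr (Or.inl (Subtype.ext h))
    · exact Or.inr (Or.inr (Subtype.ext h))
  have hA10 : A₁ < A₀ := h10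
  have hA02 : A₀ < A₂ := h02
  have hA12 : A₁ < A₂ := hA10.trans hA02
  have : Nonempty 𝒜 := ⟨A₁⟩
  -- `u` moves only the hidden parameter: `1 / 2` gives the process with the regret, `1 / 4` its
  -- indistinguishable alternative.
  let lam : ℝ → 𝒜 → ℝ≥0 := fun u a =>
    if a = A₁ then (l + v).toNNReal else if a = A₀ then (l + u * v).toNNReal else l.toNNReal
  have hlam₁ : ∀ u, (lam u A₁ : ℝ) = l + v := fun u => by
    simp only [lam, if_true]
    exact Real.coe_toNNReal _ (by linarith)
  have hlam₀ : ∀ u, 0 ≤ u → (lam u A₀ : ℝ) = l + u * v := fun u hu => by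
    simp only [lam, if_neg hA10.ne', if_true]
    exact Real.coe_toNNReal _ (by positivity)
  have hlam₂ : ∀ u, (lam u A₂ : ℝ) = l := fun u => by
    simp only [lam, if_neg hA12.ne', if_neg hA02.ne']
    exact Real.coe_toNNReal _ hl0.le
  have hanti : ∀ u, 0 < u → u < 1 → StrictAnti (lam u) := fun u hu hu1 a b hab => by
    rw [← NNReal.coe_lt_coe]
    have hk : 0 < u * v := by positivity
    have hk' : u * v < v := by nlinarith
    rcases hcov a with rfl | rfl | rfl <;> rcases hcov b with rfl | rfl | rfl
    · exact absurd hab (lt_irrefl _)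
    · rw [hlam₁, hlam₀ u hu.le]; linarith
    · rw [hlam₁, hlam₂]; linarith
    · exact absurd hab (not_lt.2 hA10.le)
    · exact absurd hab (lt_irrefl _)
    · rw [hlam₀ u hu.le, hlam₂]; linarith
    · exact absurd hab (not_lt.2 hA12.le)
    · exact absurd hab (not_lt.2 hA02.le)
    · exact absurd hab (lt_irrefl _)
  let x : Fin (L + 1) := ⟨1, by omega⟩
  let q : PMF 𝒜 := twoPoint A₁ A₂ (1 / 2) (by
    rw [← NNReal.coe_le_coe]; push_cast; norm_num)
  let M : ℝ → Model L 𝒜 := fun u => Model.iid x (lam u) q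
  have hadm : ∀ u, 0 < u → u < 1 → (M u).Admissible T lmin lmax := fun u hu hu1 => by
    have hk : 0 < u * v := by positivity
    have hk' : u * v < v := by nlinarith
    refine ⟨fun t _ a => ?_, fun t _ a => ?_, fun t _ => (hanti u hu hu1).antitone⟩
    · rw [← NNReal.coe_le_coe]
      change (lmin : ℝ) ≤ lam u a
      rcases hcov a with rfl | rfl | rfl
      · rw [hlam₁]; linarith
      · rw [hlam₀ u hu.le]; linarith
      · rw [hlam₂]; linarith
    · rw [← NNReal.coe_le_coe]
      change (lam u a : ℝ) ≤ lmax
      rcases hcov a with rfl | rfl | rfl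
      · rw [hlam₁]; linarith
      · rw [hlam₀ u hu.le]; linarith
      · rw [hlam₂]; linarith
  have hlaw : (M (1 / 2)).behaviorLaw T = (M (1 / 4)).behaviorLaw T := by
    refine Model.behaviorLaw_iid_congr x fun a ha => ?_
    have hne : a ≠ A₀ := by
      rintro rfl
      exact ha (twoPoint_of_ne hA10.ne' hA02.ne _ _)
    simp only [lam, if_neg hne]
  have hadm₂ := hadm (1 / 2) (by norm_num) (by norm_num)
  set g := abar * E / 4 * v with hg
  have H : HiddenPrice (M (1 / 2)) T x A₁ A₀ A₂ l v g := by
    refine ⟨hcov, hA10, hA02, ha₁0, rfl, rfl, fun t => ?_, fun t => ?_, fun t => ?_,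
      fun t => hlam₁ _, fun t => hlam₂ _, by positivity, fun t b hb => ?_⟩
    · rw [Model.priceProb_iid, twoPoint_left hA12.ne]; push_cast; norm_num
    · rw [Model.priceProb_iid, twoPoint_of_ne hA10.ne' hA02.ne]; simp
    · rw [Model.priceProb_iid, twoPoint_right hA12.ne]; push_cast; norm_num
    · have h1 : abar * G + g ≤ a₀ * (1 - Real.exp (-(lam (1 / 2) A₀ : ℝ))) := by
        rw [hlam₀ _ (by norm_num)]
        have e1 := exp_neg_sub_ge l (l + 1 / 2 * v)
        have e2 : E ≤ Real.exp (-(l + 1 / 2 * v)) := Real.exp_le_exp.2 (by linarith)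
        have e3 : E * (1 / 2 * v) ≤ Real.exp (-(l + 1 / 2 * v)) * (1 / 2 * v) := by gcongr
        rw [add_sub_cancel_left] at e1
        set Y := 1 - Real.exp (-(l + 1 / 2 * v)) with hY
        have e4 : G + E * (1 / 2 * v) ≤ Y := by rw [hG, hY]; linarith
        have e5 : Y ≤ 1 := by
          have := Real.exp_pos (-(l + 1 / 2 * v))
          linarith
        have e6 : E / 4 * v * Y ≤ E / 4 * v * 1 := by gcongr
        have e7 : G + E / 4 * v ≤ (1 - E / 4 * v) * Y := by linarith
        have e8 := mul_le_mul_of_nonneg_left e7 habar.le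
        rw [ha₀, hg]
        linarith
      have h2 : (b : ℝ) * (1 - Real.exp (-(lam (1 / 2) b : ℝ))) ≤ abar * G := by
        rcases hcov b with rfl | rfl | rfl
        · have e1 := Real.exp_pos (-(lam (1 / 2) A₁ : ℝ))
          calc a₁ * (1 - Real.exp (-(lam (1 / 2) A₁ : ℝ))) ≤ a₁ * 1 := by
                gcongr; linarith
            _ ≤ abar * G := by
                rw [ha₁]
                nlinarith [mul_pos habar hG0]
        · exact absurd rfl hb
        · rw [hlam₂]
      change g ≤ a₀ * (1 - Real.exp (-(lam (1 / 2) A₀ : ℝ))) -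
        b * (1 - Real.exp (-(lam (1 / 2) b : ℝ)))
      linarith
  refine ⟨𝒜, M (1 / 4), M (1 / 2), ?_, hadm _ (by norm_num) (by norm_num),
    fun t _ => hanti _ (by norm_num) (by norm_num), hadm₂,
    fun t _ => hanti _ (by norm_num) (by norm_num), hlaw, ⟨0, hT, fun h => ?_⟩, fun ε hε => ?_⟩
  · intro a ha
    simp only [h𝒜, Finset.mem_insert, Finset.mem_singleton] at ha
    rcases ha with rfl | rfl | rfl
    · exact ⟨ha₁0, (h10.trans h02).le⟩
    · exact ⟨ha₁0.trans h10, h02.le⟩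
    · exact ⟨habar, le_rfl⟩
  · have h1 : (lam (1 / 2) A₀ : ℝ) = lam (1 / 4) A₀ := congrArg NNReal.toReal (congrFun h A₀)
    rw [hlam₀ _ (by norm_num), hlam₀ _ (by norm_num)] at h1
    linarith
  have hev := (eventually_const_div_le
      (T * 𝒜.card * (1 / (1 / 4 : ℝ) ^ 2 + 1 / (1 / 4 : ℝ))) hε).and
    ((Filter.eventually_ge_atTop 1).and ((eventually_mul_rate_le (4 * c) (half_pos hl0)).and
      ((eventually_mul_rate_le (8 * c) hv0).and (eventually_mul_rate_le 2 hv0))))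
  refine Filter.eventually_atTop.1 (hev.mono ?_)
  rintro N ⟨hNε, hN, hrl, hrv, hrv'⟩ πs hπ
  have hdata : (M (1 / 4)).dataLaw T N = (M (1 / 2)).dataLaw T N := by
    simp only [Model.dataLaw, hlaw]
  rw [hdata]
  have htyp := (M (1 / 2)).one_sub_le_measureReal_typical hadm₂.upper hc
    (s := 1 / 4) (by norm_num) hN
  refine le_trans (by linarith) (htyp.trans (measureReal_mono ?_ (measure_ne_top _ _)))
  intro 𝒟 h𝒟
  have hS1 := H.le_identificationTerm h𝒟 hadm₂.upper hc0.le hN hT hv0.le hrv hπ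
  have hS2 := H.identificationTerm_le (lmax := lmax) h𝒟 hc0.le hN hv0.le hrv πs
  have hF := H.estimationTerm_le h𝒟 hN πs
  refine ⟨le_trans ?_ hS1, hS2.trans (le_of_eq ?_), fun act hact => ?_⟩
  · calc c' * w ≤ κ₁ * w := by gcongr
      _ = ρ * v := by rw [hκ₁, hv]; ring
  · rw [hv]; field_simp
  · let t : Fin T := ⟨T - 1, by omega⟩
    have ht : (t : ℕ) + 1 = T := by simp only [t]; omega
    have hne := H.act_ne h𝒟 hadm₂ hc0.le hN ht (by linarith) hact
    have hreg := (M (1 / 2)).mul_gap_le_regret hadm₂.upper (x := x) rfl rfl ht act A₀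
      H.gap_pos.le (H.gap t _ hne)
    refine le_trans ?_ hreg
    have hB : regretBound (M (1 / 2)) c lmax πs 𝒟 ≤ 3 * T * v := by
      rw [regretBound]
      have := mul_le_mul_of_nonneg_left hrv' hT0.le
      linarith
    calc c' * regretBound (M (1 / 2)) c lmax πs 𝒟 ≤ c' * (3 * T * v) := by gcongr
      _ ≤ κ₂ * (3 * T * v) := by gcongr
      _ = ρ * g := by rw [hκ₂, hg]; field_simp

end OfflinePricing

end

/-! ### Combining the regret bound with the two attainability constructions -/

theorem theorem1 (lmax : ℝ≥0) :
    ∃ c₀ : ℝ, 0 < c₀ ∧ ∀ c : ℝ, c₀ ≤ c → ∀ lmin : ℝ≥0, lmin ≤ lmax → ∀ (L : ℕ) (abar : ℝ),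
    -- the regret bound
    (∃ C : ℝ, 0 < C ∧
      ∀ (T N : ℕ) (𝒜 : Finset ℝ) (M : OfflinePricing.Model L 𝒜) (πs : OfflinePricing.Policy L 𝒜),
        (∀ a ∈ 𝒜, 0 ≤ a ∧ a ≤ abar) → M.Admissible T lmin lmax → M.IsOptimal T πs → 1 ≤ N →
        1 - ∑ t : Fin T, ((∫ 𝒟, ∑ a ∈ OfflinePricing.observed 𝒟 t,
              (OfflinePricing.count 𝒟 t a : ℝ)⁻¹ ∂(M.dataLaw T N)) + M.kappa T N t)
          ≤ (M.dataLaw T N).real {𝒟 | ∀ act, OfflinePricing.IsPessimistic c lmin lmax 𝒟 act →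
              M.regret T (OfflinePricing.markovPolicy act)
                ≤ C * OfflinePricing.regretBound M c lmax πs 𝒟}) ∧
    -- attainability, for every horizon
    (lmin < lmax → 1 ≤ L → 0 < abar → ∀ T : ℕ, 1 ≤ T → ∃ c' : ℝ, 0 < c' ∧
      -- of the estimation term, under partial coverage
      (∃ (𝒜 : Finset ℝ) (M : ℕ → OfflinePricing.Model L 𝒜),
        (∀ a ∈ 𝒜, 0 < a ∧ a ≤ abar) ∧
        (∀ N, (M N).Admissible T lmin lmax ∧ (∀ t < T, StrictAnti ((M N).lam t)) ∧
          ∀ πs, (M N).IsOptimal T πs → ∀ (t : Fin T) (a : 𝒜),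
            c' * (M N).priceProb T πs t a ≤ (M N).priceProb T (M N).behavior t a) ∧
        ∀ ε : ℝ, 0 < ε → ∃ N₀ : ℕ, ∀ N, N₀ ≤ N → ∀ πs, (M N).IsOptimal T πs →
          1 - ε ≤ ((M N).dataLaw T N).real {𝒟 |
            c' * Real.sqrt (Real.log N / N) ≤ OfflinePricing.estimationTerm (M N) πs 𝒟 ∧
            ∀ act, OfflinePricing.IsPessimistic c lmin lmax 𝒟 act →
              c' * OfflinePricing.regretBound (M N) c lmax πs 𝒟
                ≤ (M N).regret T (OfflinePricing.markovPolicy act)}) ∧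
      -- of the identification term, at every small scale `w`, by a process `M` that the
      -- distribution of the data does not distinguish from another process `M₀`
      (∃ w₀ : ℝ, 0 < w₀ ∧ ∀ w : ℝ, 0 < w → w ≤ w₀ →
        ∃ (𝒜 : Finset ℝ) (M₀ M : OfflinePricing.Model L 𝒜),
          (∀ a ∈ 𝒜, 0 < a ∧ a ≤ abar) ∧
          M₀.Admissible T lmin lmax ∧ (∀ t < T, StrictAnti (M₀.lam t)) ∧
          M.Admissible T lmin lmax ∧ (∀ t < T, StrictAnti (M.lam t)) ∧
          M.behaviorLaw T = M₀.behaviorLaw T ∧ (∃ t < T, M.lam t ≠ M₀.lam t) ∧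
          ∀ ε : ℝ, 0 < ε → ∃ N₀ : ℕ, ∀ N, N₀ ≤ N → ∀ πs, M.IsOptimal T πs →
            1 - ε ≤ (M₀.dataLaw T N).real {𝒟 |
              c' * w ≤ OfflinePricing.identificationTerm M c lmax πs 𝒟 ∧
              OfflinePricing.identificationTerm M c lmax πs 𝒟 ≤ w ∧
              ∀ act, OfflinePricing.IsPessimistic c lmin lmax 𝒟 act →
                c' * OfflinePricing.regretBound M c lmax πs 𝒟
                  ≤ M.regret T (OfflinePricing.markovPolicy act)})) := by
  have hl0 : (0 : ℝ) ≤ lmax := NNReal.coe_nonneg _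
  -- Concentration needs `lmax + 2`; the doubling lets it hold at `c / 2`, as the estimation example
  -- requires.
  refine ⟨2 * ((lmax : ℝ) + 2), by positivity, fun c hc lmin _ L abar => ⟨?_, ?_⟩⟩
  · have hc0 : 0 < c := by linarith
    -- `|abar| + 1` bounds the prices and stays positive even for `abar ≤ 0`.
    refine ⟨(|abar| + 1) * (L ^ 2 + 1) * (2 * c + 1), by positivity, ?_⟩
    intro T N 𝒜 M πs h𝒜 hM hπ hN
    refine OfflinePricing.measureReal_regret_le (by linarith) (fun a ha => ⟨(h𝒜 a ha).1, ?_⟩)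
      hM hπ hN rfl
    linarith [(h𝒜 a ha).2, le_abs_self abar]
  · intro hlt hL habar T hT
    obtain ⟨k₁, hk₁, h₁⟩ := OfflinePricing.estimationTerm_attainable hlt hc hL habar hT
    obtain ⟨k₂, hk₂, h₂⟩ := OfflinePricing.identificationTerm_attainable hlt
      (show (lmax : ℝ) + 2 ≤ c by linarith) hL habar hT
    exact ⟨min k₁ k₂, lt_min hk₁ hk₂, h₁ _ (lt_min hk₁ hk₂) (min_le_left _ _),
      h₂ _ (lt_min hk₁ hk₂) (min_le_right _ _)⟩
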